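/- **Conventions.** All categories and ordered groupoids are small. A category is *left-cancellative* if all its arrows are monomorphisms. An *ordered groupoid* $\mathcal G$ is an internal groupoid in posets such that for every (horizontal) arrow $f\colon A\to B$ and every $A'\le A$ there is a unique arrow $f|_{A'}\le f$ with domain $A'$. It is viewed as a double category: its horizontal arrows are the arrows of the groupoid, its vertical arrows are the relations $A'\le A$, its double cells are the relations $f'\le f$. *Double functors* are order-preserving functors. A *horizontal transformation* $\alpha\colon F\Rightarrow F'$ of double functors $\mathcal G\to\mathcal H$ is a family of horizontal arrows $\alpha_X\colon FX\to F'X$, natural in horizontal arrows, with $\alpha_X\le\alpha_Y$ whenever $X\le Y$. A *$\Lambda$-transformation* $F\Rightarrow F'$ is a horizontal transformation $F\Rightarrow F''$ together with $F''\le F'$ (pointwise on objects and arrows). Left-cancellative categories, functors and natural transformations form a 2-category $\mathbf{lcCat}$; ordered groupoids, double functors and $\Lambda$-transformations form a 2-category $\mathbf{oGpd}$. **The 2-functors.** $\mathbf L\colon\mathbf{oGpd}\to\mathbf{lcCat}$: the category $\mathbf L(\mathcal G)$ has the objects of $\mathcal G$; its arrows $A\to B$ are pairs of a horizontal arrow $h\colon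 A\to B'$ and a relation $B'\le B$; the composite of $(h\colon A\to B'\le B)$ and $(k\colon B\to C'\le C)$ has horizontal part $k|_{B'}\circ h$; $\mathbf L$ acts on 1-cells by applying the double functor, and on a $\Lambda$-transformation by taking its components. $\mathbf G\colon\mathbf{lcCat}\to\mathbf{oGpd}$: the objects of $\mathbf G(\mathcal C)$ are the subobjects $[m\colon A\to B]$ (arrows of $\mathcal C$ up to isomorphism over the codomain) with the usual order of subobjects of the same object; its horizontal arrows are the isomorphism classes $[m,n]\colon[m]\to[n]$ of spans $X\xleftarrow{m}A\xrightarrow{n}Y$, ordered by factorization of spans with the same feet, with $[m,n]\circ[k,m]=[k,n]$ and $[m,n]^{-1}=[n,m]$; $\mathbf G(F)$ sends $[m]$ to $[Fm]$ and $[m,n]$ to $[Fm,Fn]$; for $\theta\colon F\Rightarrow F'$, $\mathbf G(\theta)$ has components $[Fm,\,F'm\circ\theta_A]\colon[Fm]\to[F'm\circ\theta_A]\le[F'm]$. **Sites.** A *left-cancellative Grothendieck site* $(\mathcal C,J)$ is a left-cancellative category with a Grothendieck topology. A functor $F\colon(\mathcal C,J)\to(\mathcal C',J')$ is *covering-preserving*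 if for each covering sieve $S$ on $A$, the sieve generated by $F(S)$ covers $FA$, and *covering-flat* if for each diagram $D\colon I\to\mathcal C$ with $I$ a finite category and each cone $T$ over $FD$ with vertex $U$, the sieve of all $h\colon V\to U$ such that $T\circ h$ factors through the $F$-image of some cone over $D$ is $J'$-covering. A *vertical sieve* on an object $A$ of an ordered groupoid $\mathcal G$ is a down-closed set of objects below $A$. For $f=(A\xrightarrow{h}B'\le B)$ and a vertical sieve $\mathcal B$ on $B$, put $f^*\mathcal B=\{A'\le A\mid \mathrm{cod}(h|_{A'})\in\mathcal B\}$. An *Ehresmann topology* $T$ assigns to each object $A$ a set $T(A)$ of vertical sieves on $A$ such that (i) ${\downarrow}A\in T(A)$; (ii) if $\mathcal B\in T(B)$ and $f=(A\to B'\le B)$ then $f^*\mathcal B\in T(A)$; (iii) if $\mathcal A\in T(A)$ and $\mathcal B$ is a vertical sieve on $A$ with $f^*\mathcal B\in T(X)$ for all $f=(X\to A'\le A)$ with $A'\in\mathcal A$, then $\mathcal B\in T(A)$. An *Ehresmann site* is an ordered groupoid with an Ehresmann topology; it *has maximal objects* if each object is below a unique maximal object. A *finite diagram* in $\mathcal G$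 is a double functor $D\colon\mathbb I\to\mathcal G$ with $\mathbb I$ a finite ordered groupoid. An *hv-cone* over $D$ is an object $U$ with arrows $U\xrightarrow{\xi_i}E_i\le D_i$ for $i\in\mathbb I$, such that $D_\alpha|_{E_i}\circ\xi_i=\xi_{i'}$ for each horizontal $\alpha\colon i\to i'$ and $\xi_i=\xi_{i'}$ for each $i\le i'$. A double functor $F\colon(\mathcal G,T)\to(\mathcal G',T')$ is *covering-preserving* if for every $\mathcal A\in T(A)$ the vertical sieve generated by $F\mathcal A$ is in $T'(FA)$, and *covering-flat* if for every finite diagram $D$ in $\mathcal G$ and every hv-cone $(U,\xi)$ over $FD$ there is $\mathcal U\in T'(U)$ such that for every $U'\in\mathcal U$ there are an hv-cone $(P,\theta)$ over $D$ and $h\colon U'\to P'\le FP$ such that, for all $i$, the composite of $U'\le U$ with $(\xi_i,\ E_i\le FD_i)$ in $\mathbf L(\mathcal G')$ equals the composite of $h$ with the $F$-image of the leg at $i$ of $(P,\theta)$. Let $\mathbf{lcGsite}$ be the 2-category of left-cancellative Grothendieck sites, covering-preserving covering-flat functors and natural transformations, and $\mathbf{Esite}_{\max}$ the 2-category of Ehresmann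 sites with maximal objects, covering-preserving covering-flat double functors and $\Lambda$-transformations. For an Ehresmann topology $T$ on $\mathcal G$, let $J_T$ be the topology on $\mathbf L(\mathcal G)$ for which a sieve $S$ on $A$ covers iff $\{A'\mid (B\to A'\le A)\in S\}\in T(A)$. For a Grothendieck topology $J$ on a left-cancellative $\mathcal C$, let $T_J$ be the Ehresmann topology on $\mathbf G(\mathcal C)$ given by $T_J([m\colon A\to B])=\{\{[mn]\mid n\in S\}\mid S\in J(A)\}$. **Theorem.** The 2-functors $\mathbf G$ and $\mathbf L$ send covering-preserving covering-flat morphisms (of left-cancellative Grothendieck sites, respectively of Ehresmann sites with maximal objects) to covering-preserving covering-flat morphisms for the topologies $T_J$ and $J_T$. Hence $(\mathcal C,J)\mapsto(\mathbf G(\mathcal C),T_J)$ and $(\mathcal G,T)\mapsto(\mathbf L(\mathcal G),J_T)$ define 2-functors $\mathbf{lcGsite}\to\mathbf{Esite}_{\max}$ and $\mathbf{Esite}_{\max}\to\mathbf{lcGsite}$. These form a (strict) 2-adjunction $\mathbf G\dashv\mathbf L$, i.e. there are 2-natural transformations $\eta\colon 1\Rightarrow\mathbf{LG}$ and $\kappa\colon\mathbf{GL}\Rightarrow1$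 satisfying the triangle identities, where $\eta_{\mathcal C}$ sends $A$ to $[1_A]$ and $h\colon A\to B$ to $([1_A,h]\colon[1_A]\to[h]\le[1_B])$, and $\kappa_{\mathcal G}$ sends $[m\colon A\to B'\le B]$ to $B'$ and $[m,n]$ to $n'm'^{-1}$, with $m',n'$ the horizontal parts of $m,n$. This 2-adjunction is a biequivalence: each $\eta_{\mathcal C}\colon(\mathcal C,J)\to(\mathbf{LG}(\mathcal C),J_{T_J})$ is an internal equivalence in $\mathbf{lcGsite}$, and each $\kappa_{\mathcal G}\colon(\mathbf{GL}(\mathcal G),T_{J_T})\to(\mathcal G,T)$ is an internal equivalence in $\mathbf{Esite}_{\max}$, that is, it has a pseudo-inverse up to invertible 2-cells. -/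

import Mathlib

open CategoryTheory Bicategory

universe u v w u₁ u₂ v₁ v₂ w₁ w₂

namespace EhresmannSite

noncomputable section

section

/-- A (small) ordered groupoid, presented as an internal groupoid in partially ordered sets whose
source map is a fibration.  `Obj` is the poset of objects, i.e. the vertical category, and `Arr` is
the poset of horizontal arrows; a double cell from `f` to `g` is the relation `f ≤ g`.  Composition
`comp f g` is written in diagrammatic order: first `f`, then `g`. -/
structure OrderedGroupoid : Type (u + 1) where
  Obj : Type u
  Arr : Type u
  [ordObj : PartialOrder Obj]
  [ordArr : PartialOrder Arr]
  src : Arr → Obj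
  tgt : Arr → Obj
  one : Obj → Arr
  comp : (f g : Arr) → tgt f = src g → Arr
  inv : Arr → Arr
  src_one : ∀ X, src (one X) = X
  tgt_one : ∀ X, tgt (one X) = X
  src_comp : ∀ f g h, src (comp f g h) = src f
  tgt_comp : ∀ f g h, tgt (comp f g h) = tgt g
  one_comp : ∀ f, comp (one (src f)) f (tgt_one _) = f
  comp_one : ∀ f, comp f (one (tgt f)) (src_one _).symm = f
  assoc : ∀ f g k (h : tgt f = src g) (h' : tgt g = src k),
    comp (comp f g h) k ((tgt_comp f g h).trans h') =
      comp f (comp g k h') (h.trans (src_comp g k h').symm)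
  src_inv : ∀ f, src (inv f) = tgt f
  tgt_inv : ∀ f, tgt (inv f) = src f
  comp_inv : ∀ f, comp f (inv f) (src_inv f).symm = one (src f)
  inv_comp : ∀ f, comp (inv f) f (tgt_inv f) = one (tgt f)
  one_le_one : ∀ X Y, one X ≤ one Y ↔ X ≤ Y
  inv_le_inv : ∀ f g, f ≤ g → inv f ≤ inv g
  comp_le_comp : ∀ f f' g g' (h : tgt f = src g) (h' : tgt f' = src g'),
    f ≤ f' → g ≤ g' → comp f g h ≤ comp f' g' h'
  existsUnique_restrict : ∀ (f : Arr) (X : Obj), X ≤ src f → ∃! f' : Arr, src f' = X ∧ f' ≤ f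

attribute [instance] OrderedGroupoid.ordObj OrderedGroupoid.ordArr

namespace OrderedGroupoid

attribute [simp] src_one tgt_one src_comp tgt_comp src_inv tgt_inv comp_inv inv_comp one_le_one

variable (𝒢 : OrderedGroupoid.{u})

theorem comp_congr {f f' g g' : 𝒢.Arr} (hf : f = f') (hg : g = g') (h : 𝒢.tgt f = 𝒢.src g) :
    𝒢.comp f g h = 𝒢.comp f' g' (by rw [← hf, ← hg]; exact h) := by
  subst hf; subst hg; rfl

theorem src_mono {f g : 𝒢.Arr} (h : f ≤ g) : 𝒢.src f ≤ 𝒢.src g := by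
  have := 𝒢.comp_le_comp f g _ _ (𝒢.src_inv f).symm (𝒢.src_inv g).symm h (𝒢.inv_le_inv f g h)
  simpa using this

theorem tgt_mono {f g : 𝒢.Arr} (h : f ≤ g) : 𝒢.tgt f ≤ 𝒢.tgt g := by
  simpa using 𝒢.src_mono (𝒢.inv_le_inv f g h)

theorem one_comp' {X : 𝒢.Obj} {f : 𝒢.Arr} (h : 𝒢.tgt (𝒢.one X) = 𝒢.src f) :
    𝒢.comp (𝒢.one X) f h = f := by
  rw [tgt_one] at h; subst h; exact 𝒢.one_comp f

theorem comp_one' {X : 𝒢.Obj} {f : 𝒢.Arr} (h : 𝒢.tgt f = 𝒢.src (𝒢.one X)) :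
    𝒢.comp f (𝒢.one X) h = f := by
  rw [src_one] at h; subst h; exact 𝒢.comp_one f

theorem comp_left_cancel {f g g' : 𝒢.Arr} (h : 𝒢.tgt f = 𝒢.src g) (h' : 𝒢.tgt f = 𝒢.src g')
    (e : 𝒢.comp f g h = 𝒢.comp f g' h') : g = g' := by
  have key : ∀ (k : 𝒢.Arr) (hk : 𝒢.tgt f = 𝒢.src k),
      𝒢.comp (𝒢.inv f) (𝒢.comp f k hk) (by simp) = k := by
    intro k hk
    rw [← 𝒢.assoc _ _ _ (𝒢.tgt_inv f) hk, 𝒢.comp_congr (𝒢.inv_comp f) rfl, one_comp']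
  rw [← key g h, ← key g' h']
  exact 𝒢.comp_congr rfl e _

theorem comp_right_cancel {f f' g : 𝒢.Arr} (h : 𝒢.tgt f = 𝒢.src g) (h' : 𝒢.tgt f' = 𝒢.src g)
    (e : 𝒢.comp f g h = 𝒢.comp f' g h') : f = f' := by
  have key : ∀ (k : 𝒢.Arr) (hk : 𝒢.tgt k = 𝒢.src g),
      𝒢.comp (𝒢.comp k g hk) (𝒢.inv g) (by simp) = k := by
    intro k hk
    rw [𝒢.assoc _ _ _ hk (𝒢.src_inv g).symm, 𝒢.comp_congr rfl (𝒢.comp_inv g), comp_one']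
  rw [← key f h, ← key f' h']
  exact 𝒢.comp_congr e rfl _

variable {𝒢}

/-- The restriction `f|_X` of a horizontal arrow `f` to an object `X ≤ src f`. -/
def restrict (f : 𝒢.Arr) (X : 𝒢.Obj) (h : X ≤ 𝒢.src f) : 𝒢.Arr :=
  (𝒢.existsUnique_restrict f X h).choose

@[simp]
theorem src_restrict (f : 𝒢.Arr) (X : 𝒢.Obj) (h : X ≤ 𝒢.src f) : 𝒢.src (restrict f X h) = X :=
  (𝒢.existsUnique_restrict f X h).choose_spec.1.1

theorem restrict_le (f : 𝒢.Arr) (X : 𝒢.Obj) (h : X ≤ 𝒢.src f) : restrict f X h ≤ f :=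
  (𝒢.existsUnique_restrict f X h).choose_spec.1.2

theorem eq_of_le_of_src {f g k : 𝒢.Arr} (hf : f ≤ k) (hg : g ≤ k) (h : 𝒢.src f = 𝒢.src g) :
    f = g :=
  (𝒢.existsUnique_restrict k (𝒢.src f) (𝒢.src_mono hf)).unique ⟨rfl, hf⟩ ⟨h.symm, hg⟩

theorem eq_of_le_of_tgt {f g k : 𝒢.Arr} (hf : f ≤ k) (hg : g ≤ k) (h : 𝒢.tgt f = 𝒢.tgt g) :
    f = g := by
  have h1 : 𝒢.inv f = 𝒢.inv g :=
    eq_of_le_of_src (𝒢.inv_le_inv _ _ hf) (𝒢.inv_le_inv _ _ hg) (by simpa using h)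
  have h2 : 𝒢.comp f (𝒢.inv f) (𝒢.src_inv f).symm =
      𝒢.comp g (𝒢.inv f) (by rw [← h, src_inv]) := by
    rw [𝒢.comp_congr (f := g) rfl h1, comp_inv, comp_inv, ← 𝒢.tgt_inv f, h1, 𝒢.tgt_inv]
  exact 𝒢.comp_right_cancel _ _ h2

theorem restrict_eq {f g : 𝒢.Arr} {X : 𝒢.Obj} (h : X ≤ 𝒢.src f) (hs : 𝒢.src g = X) (hg : g ≤ f) :
    restrict f X h = g :=
  eq_of_le_of_src (restrict_le f X h) hg (by rw [src_restrict, hs])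

theorem tgt_restrict_le (f : 𝒢.Arr) (X : 𝒢.Obj) (h : X ≤ 𝒢.src f) :
    𝒢.tgt (restrict f X h) ≤ 𝒢.tgt f :=
  𝒢.tgt_mono (restrict_le f X h)

theorem restrict_self (f : 𝒢.Arr) {X : 𝒢.Obj} (h : 𝒢.src f = X) : restrict f X h.ge = f :=
  restrict_eq _ h le_rfl

theorem comp_inv_cancel {f g : 𝒢.Arr} (h : 𝒢.tgt f = 𝒢.src g) :
    𝒢.comp (𝒢.comp f g h) (𝒢.inv g) (by simp) = f := by
  rw [𝒢.assoc _ _ _ h (𝒢.src_inv g).symm, 𝒢.comp_congr rfl (𝒢.comp_inv g), comp_one']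

theorem comp_cancel_inv {f g : 𝒢.Arr} (h : 𝒢.tgt f = 𝒢.tgt g) :
    𝒢.comp (𝒢.comp f (𝒢.inv g) (by simpa using h)) g (by simp) = f := by
  rw [𝒢.assoc _ _ _ (by simpa using h) (𝒢.tgt_inv g), 𝒢.comp_congr rfl (𝒢.inv_comp g), comp_one']

theorem inv_comp_cancel {f g : 𝒢.Arr} (h : 𝒢.tgt f = 𝒢.src g) :
    𝒢.comp (𝒢.inv f) (𝒢.comp f g h) (by simp) = g := by
  rw [← 𝒢.assoc _ _ _ (𝒢.tgt_inv f) h, 𝒢.comp_congr (𝒢.inv_comp f) rfl, one_comp']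

theorem comp_inv_comp_cancel {f g : 𝒢.Arr} (h : 𝒢.src f = 𝒢.src g) :
    𝒢.comp f (𝒢.comp (𝒢.inv f) g (by simpa using h)) (by simp) = g := by
  rw [← 𝒢.assoc _ _ _ (𝒢.src_inv f).symm (by simpa using h), 𝒢.comp_congr (𝒢.comp_inv f) rfl,
    one_comp']

end OrderedGroupoid

/-- Ordered functors between ordered groupoids, i.e. double functors. -/
@[ext]
structure OrdFunctor (𝒢 : OrderedGroupoid.{u}) (ℋ : OrderedGroupoid.{v}) where
  obj : 𝒢.Obj → ℋ.Obj
  arr : 𝒢.Arr → ℋ.Arr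
  src_arr : ∀ f, ℋ.src (arr f) = obj (𝒢.src f)
  tgt_arr : ∀ f, ℋ.tgt (arr f) = obj (𝒢.tgt f)
  arr_one : ∀ X, arr (𝒢.one X) = ℋ.one (obj X)
  arr_comp : ∀ f g h, arr (𝒢.comp f g h) = ℋ.comp (arr f) (arr g) (by rw [tgt_arr, h, src_arr])
  arr_mono : ∀ f g, f ≤ g → arr f ≤ arr g

namespace OrdFunctor

attribute [simp] src_arr tgt_arr arr_one

variable {𝒢 : OrderedGroupoid.{u}} {ℋ : OrderedGroupoid.{v}} {𝒦 : OrderedGroupoid.{w}}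

theorem obj_mono (F : OrdFunctor 𝒢 ℋ) {X Y : 𝒢.Obj} (h : X ≤ Y) : F.obj X ≤ F.obj Y := by
  simpa using F.arr_mono _ _ ((𝒢.one_le_one X Y).2 h)

theorem arr_inv (F : OrdFunctor 𝒢 ℋ) (f : 𝒢.Arr) : F.arr (𝒢.inv f) = ℋ.inv (F.arr f) := by
  apply ℋ.comp_left_cancel (f := F.arr f) (by simp) (by simp)
  rw [← F.arr_comp f (𝒢.inv f) (by simp)]
  simp

theorem arr_restrict (F : OrdFunctor 𝒢 ℋ) (f : 𝒢.Arr) (X : 𝒢.Obj) (h : X ≤ 𝒢.src f) :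
    F.arr (OrderedGroupoid.restrict f X h) =
      OrderedGroupoid.restrict (F.arr f) (F.obj X) (by simpa using F.obj_mono h) :=
  (OrderedGroupoid.restrict_eq _ (by simp) (F.arr_mono _ _ (OrderedGroupoid.restrict_le _ _ _))).symm

/-- The identity ordered functor. -/
@[simps]
def id (𝒢 : OrderedGroupoid.{u}) : OrdFunctor 𝒢 𝒢 where
  obj X := X
  arr f := f
  src_arr _ := rfl
  tgt_arr _ := rfl
  arr_one _ := rfl
  arr_comp _ _ _ := rfl
  arr_mono _ _ h := h

/-- Composition of ordered functors (first `F`, then `G`). -/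
@[simps]
def comp (F : OrdFunctor 𝒢 ℋ) (G : OrdFunctor ℋ 𝒦) : OrdFunctor 𝒢 𝒦 where
  obj X := G.obj (F.obj X)
  arr f := G.arr (F.arr f)
  src_arr f := by simp
  tgt_arr f := by simp
  arr_one f := by simp
  arr_comp f g h := by rw [F.arr_comp f g h, G.arr_comp]
  arr_mono f g h := G.arr_mono _ _ (F.arr_mono _ _ h)

/-- `F ≤ G` holds precisely when there is a (unique) vertical transformation from `F` to `G`. -/
instance : PartialOrder (OrdFunctor 𝒢 ℋ) where
  le F G := (∀ X, F.obj X ≤ G.obj X) ∧ ∀ f, F.arr f ≤ G.arr f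
  le_refl F := ⟨fun _ => le_rfl, fun _ => le_rfl⟩
  le_trans F G H h k := ⟨fun X => (h.1 X).trans (k.1 X), fun f => (h.2 f).trans (k.2 f)⟩
  le_antisymm F G h k := OrdFunctor.ext (funext fun X => le_antisymm (h.1 X) (k.1 X))
    (funext fun f => le_antisymm (h.2 f) (k.2 f))

end OrdFunctor

/-- Horizontal transformations between double functors of ordered groupoids: a horizontal arrow
`app X : dom X → cod X` for each object `X`, natural with respect to horizontal arrows, and with a
double cell `app X ≤ app Y` for each vertical arrow `X ≤ Y`. -/
@[ext]
structure HorTrans (𝒢 : OrderedGroupoid.{u}) (ℋ : OrderedGroupoid.{v}) where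
  dom : OrdFunctor 𝒢 ℋ
  cod : OrdFunctor 𝒢 ℋ
  app : 𝒢.Obj → ℋ.Arr
  src_app : ∀ X, ℋ.src (app X) = dom.obj X
  tgt_app : ∀ X, ℋ.tgt (app X) = cod.obj X
  naturality : ∀ f : 𝒢.Arr,
    ℋ.comp (dom.arr f) (app (𝒢.tgt f)) (by rw [src_app, OrdFunctor.tgt_arr]) =
      ℋ.comp (app (𝒢.src f)) (cod.arr f) (by rw [tgt_app, OrdFunctor.src_arr])
  app_mono : ∀ X Y, X ≤ Y → app X ≤ app Y

namespace HorTrans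

attribute [simp] src_app tgt_app

variable {𝒢 : OrderedGroupoid.{u}} {ℋ : OrderedGroupoid.{v}} {𝒦 : OrderedGroupoid.{w}}

/-- A horizontal transformation is determined by its domain and its components. -/
theorem ext_app {α β : HorTrans 𝒢 ℋ} (h : α.dom = β.dom) (h' : ∀ X, α.app X = β.app X) :
    α = β := by
  obtain ⟨F, G, a, p, q, n, m⟩ := α
  obtain ⟨F', G', a', p', q', n', m'⟩ := β
  obtain rfl : F = F' := h
  obtain rfl : a = a' := funext h'
  have : G = G' := by
    apply OrdFunctor.ext
    · funext X; rw [← q, ← q']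
    · funext f
      have h1 : ℋ.tgt (a (𝒢.src f)) = ℋ.src (G.arr f) := by rw [q, OrdFunctor.src_arr]
      have h2 : ℋ.tgt (a (𝒢.src f)) = ℋ.src (G'.arr f) := by rw [q', OrdFunctor.src_arr]
      exact ℋ.comp_left_cancel h1 h2 ((n f).symm.trans (n' f))
  subst this
  rfl

/-- `α ≤ β` holds precisely when there is a (unique) modification from `α` to `β` whose vertical
boundaries are the vertical transformations `α.dom ≤ β.dom` and `α.cod ≤ β.cod`. -/
instance : PartialOrder (HorTrans 𝒢 ℋ) where
  le α β := α.dom ≤ β.dom ∧ α.cod ≤ β.cod ∧ ∀ X, α.app X ≤ β.app X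
  le_refl α := ⟨le_rfl, le_rfl, fun _ => le_rfl⟩
  le_trans α β γ h k := ⟨h.1.trans k.1, h.2.1.trans k.2.1, fun X => (h.2.2 X).trans (k.2.2 X)⟩
  le_antisymm α β h k := HorTrans.ext (le_antisymm h.1 k.1) (le_antisymm h.2.1 k.2.1)
    (funext fun X => le_antisymm (h.2.2 X) (k.2.2 X))

theorem le_iff {α β : HorTrans 𝒢 ℋ} :
    α ≤ β ↔ α.dom ≤ β.dom ∧ α.cod ≤ β.cod ∧ ∀ X, α.app X ≤ β.app X :=
  Iff.rfl

/-- The identity horizontal transformation. -/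
def one (F : OrdFunctor 𝒢 ℋ) : HorTrans 𝒢 ℋ where
  dom := F
  cod := F
  app X := ℋ.one (F.obj X)
  src_app X := by simp
  tgt_app X := by simp
  naturality f := by rw [ℋ.comp_one', ℋ.one_comp']
  app_mono X Y h := (ℋ.one_le_one _ _).2 (F.obj_mono h)

/-- Composition of horizontal transformations. -/
def comp (α β : HorTrans 𝒢 ℋ) (h : α.cod = β.dom) : HorTrans 𝒢 ℋ where
  dom := α.dom
  cod := β.cod
  app X := ℋ.comp (α.app X) (β.app X) (by simp [h])
  src_app X := by simp
  tgt_app X := by simp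
  naturality f := by
    obtain ⟨F, G, a, p, q, n, m⟩ := α
    obtain ⟨F', G', a', p', q', n', m'⟩ := β
    obtain rfl : G = F' := h
    dsimp only at *
    rw [← ℋ.assoc _ _ _ (by simp [p]) (by simp [q, p']), ℋ.comp_congr (n f) rfl,
      ℋ.assoc _ _ _ (by simp [q]) (by simp [p']), ℋ.comp_congr rfl (n' f),
      ← ℋ.assoc _ _ _ (by simp [q, p']) (by simp [q'])]
  app_mono X Y hXY := ℋ.comp_le_comp _ _ _ _ _ _ (α.app_mono _ _ hXY) (β.app_mono _ _ hXY)

theorem inv_naturality (α : HorTrans 𝒢 ℋ) (f : 𝒢.Arr) :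
    ℋ.comp (α.cod.arr f) (ℋ.inv (α.app (𝒢.tgt f))) (by simp) =
      ℋ.comp (ℋ.inv (α.app (𝒢.src f))) (α.dom.arr f) (by simp) := by
  apply ℋ.comp_left_cancel (f := α.app (𝒢.src f)) (by simp) (by simp)
  rw [OrderedGroupoid.comp_inv_comp_cancel (by simp), ← ℋ.assoc _ _ _ (by simp) (by simp),
    ← ℋ.comp_congr (α.naturality f) rfl (by simp), OrderedGroupoid.comp_inv_cancel]

/-- The inverse of a horizontal transformation. -/
def inv (α : HorTrans 𝒢 ℋ) : HorTrans 𝒢 ℋ where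
  dom := α.cod
  cod := α.dom
  app X := ℋ.inv (α.app X)
  src_app X := by simp
  tgt_app X := by simp
  naturality f := α.inv_naturality f
  app_mono X Y h := ℋ.inv_le_inv _ _ (α.app_mono _ _ h)

/-- The codomain of the restriction of a horizontal transformation. -/
def restrictCod (β : HorTrans 𝒢 ℋ) (F : OrdFunctor 𝒢 ℋ) (h : F ≤ β.dom) : OrdFunctor 𝒢 ℋ where
  obj X := ℋ.tgt (OrderedGroupoid.restrict (β.app X) (F.obj X) (by simpa using h.1 X))
  arr f := ℋ.comp
    (ℋ.inv (OrderedGroupoid.restrict (β.app (𝒢.src f)) (F.obj (𝒢.src f)) (by simpa using h.1 _)))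
    (ℋ.comp (F.arr f)
      (OrderedGroupoid.restrict (β.app (𝒢.tgt f)) (F.obj (𝒢.tgt f)) (by simpa using h.1 _))
      (by simp)) (by simp)
  src_arr f := by simp
  tgt_arr f := by simp
  arr_one X := by
    have := h.1 X
    simp only [OrdFunctor.arr_one, OrderedGroupoid.src_one, OrderedGroupoid.tgt_one]
    rw [ℋ.comp_congr rfl (ℋ.one_comp' _), ℋ.inv_comp]
  arr_comp f g e := by
    rw [ℋ.assoc _ _ _ (by simp) (by simp [e]), ]
    simp only [OrderedGroupoid.src_comp, OrderedGroupoid.tgt_comp]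
    apply ℋ.comp_congr rfl
    rw [ℋ.assoc _ _ _ (by simp) (by simp [e]), ℋ.comp_congr (F.arr_comp f g e) rfl,
      ℋ.assoc _ _ _ (by simp [e]) (by simp)]
    apply ℋ.comp_congr rfl
    simp only [e]
    rw [OrderedGroupoid.comp_inv_comp_cancel (by simp)]
  arr_mono f g e := by
    have key : ∀ X Y (e : X ≤ Y), OrderedGroupoid.restrict (β.app X) (F.obj X)
        (by simpa using h.1 X) ≤ OrderedGroupoid.restrict (β.app Y) (F.obj Y)
        (by simpa using h.1 Y) := by
      intro X Y e
      have h1 : OrderedGroupoid.restrict (β.app X) (F.obj X) (by simpa using h.1 X) =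
          OrderedGroupoid.restrict (OrderedGroupoid.restrict (β.app Y) (F.obj Y)
            (by simpa using h.1 Y)) (F.obj X) (by simpa using F.obj_mono e) :=
        OrderedGroupoid.eq_of_le_of_src (k := β.app Y)
          ((OrderedGroupoid.restrict_le _ _ _).trans (β.app_mono _ _ e))
          ((OrderedGroupoid.restrict_le _ _ _).trans (OrderedGroupoid.restrict_le _ _ _))
          (by simp)
      rw [h1]
      exact OrderedGroupoid.restrict_le _ _ _
    exact ℋ.comp_le_comp _ _ _ _ _ _ (ℋ.inv_le_inv _ _ (key _ _ (𝒢.src_mono e)))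
      (ℋ.comp_le_comp _ _ _ _ _ _ (F.arr_mono _ _ e) (key _ _ (𝒢.tgt_mono e)))

/-- The restriction of a horizontal transformation, computed componentwise. -/
def restrict (β : HorTrans 𝒢 ℋ) (F : OrdFunctor 𝒢 ℋ) (h : F ≤ β.dom) : HorTrans 𝒢 ℋ where
  dom := F
  cod := β.restrictCod F h
  app X := OrderedGroupoid.restrict (β.app X) (F.obj X) (by simpa using h.1 X)
  src_app X := by simp
  tgt_app X := rfl
  naturality f := by
    dsimp only [restrictCod]
    rw [OrderedGroupoid.comp_inv_comp_cancel (by simp)]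
  app_mono X Y e := by
    have h1 : OrderedGroupoid.restrict (β.app X) (F.obj X) (by simpa using h.1 X) =
        OrderedGroupoid.restrict (OrderedGroupoid.restrict (β.app Y) (F.obj Y)
          (by simpa using h.1 Y)) (F.obj X) (by simpa using F.obj_mono e) :=
      OrderedGroupoid.eq_of_le_of_src (k := β.app Y)
        ((OrderedGroupoid.restrict_le _ _ _).trans (β.app_mono _ _ e))
        ((OrderedGroupoid.restrict_le _ _ _).trans (OrderedGroupoid.restrict_le _ _ _))
        (by simp)
    rw [h1]
    exact OrderedGroupoid.restrict_le _ _ _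

theorem arr_cod (β : HorTrans 𝒢 ℋ) (f : 𝒢.Arr) :
    β.cod.arr f = ℋ.comp (ℋ.inv (β.app (𝒢.src f)))
      (ℋ.comp (β.dom.arr f) (β.app (𝒢.tgt f)) (by simp)) (by simp) := by
  rw [ℋ.comp_congr rfl (β.naturality f), OrderedGroupoid.inv_comp_cancel]

theorem restrict_le (β : HorTrans 𝒢 ℋ) (F : OrdFunctor 𝒢 ℋ) (h : F ≤ β.dom) :
    β.restrict F h ≤ β := by
  refine ⟨h, ⟨fun X => ?_, fun f => ?_⟩,
    fun X => OrderedGroupoid.restrict_le _ _ (by simpa using h.1 X)⟩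
  · exact (OrderedGroupoid.tgt_restrict_le (β.app X) (F.obj X)
      (by simpa using h.1 X)).trans_eq (β.tgt_app X)
  · rw [arr_cod β f]
    exact ℋ.comp_le_comp _ _ _ _ _ _ (ℋ.inv_le_inv _ _ (OrderedGroupoid.restrict_le _ _ _))
      (ℋ.comp_le_comp _ _ _ _ _ _ (h.2 f) (OrderedGroupoid.restrict_le _ _ _))

end HorTrans

/-- The ordered groupoid `DblCat(𝒢, ℋ)` of double functors, horizontal transformations, vertical
transformations and modifications. -/
def dblCat (𝒢 ℋ : OrderedGroupoid.{u}) : OrderedGroupoid.{u} where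
  Obj := OrdFunctor 𝒢 ℋ
  Arr := HorTrans 𝒢 ℋ
  src := HorTrans.dom
  tgt := HorTrans.cod
  one := HorTrans.one
  comp := HorTrans.comp
  inv := HorTrans.inv
  src_one _ := rfl
  tgt_one _ := rfl
  src_comp _ _ _ := rfl
  tgt_comp _ _ _ := rfl
  one_comp α := HorTrans.ext_app rfl fun X => ℋ.one_comp' _
  comp_one α := HorTrans.ext_app rfl fun X => ℋ.comp_one' _
  assoc α β γ h h' := HorTrans.ext_app rfl fun X => ℋ.assoc _ _ _ (by simp [h]) (by simp [h'])
  src_inv _ := rfl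
  tgt_inv _ := rfl
  comp_inv α := HorTrans.ext_app rfl fun X => by simp [HorTrans.comp, HorTrans.inv, HorTrans.one]
  inv_comp α := HorTrans.ext_app rfl fun X => by simp [HorTrans.comp, HorTrans.inv, HorTrans.one]
  one_le_one F G := ⟨fun h => (HorTrans.le_iff.1 h).1,
    fun h => HorTrans.le_iff.2 ⟨h, h, fun X => (ℋ.one_le_one _ _).2 (h.1 X)⟩⟩
  inv_le_inv α β h := HorTrans.le_iff.2 ⟨(HorTrans.le_iff.1 h).2.1, (HorTrans.le_iff.1 h).1,
    fun X => ℋ.inv_le_inv _ _ ((HorTrans.le_iff.1 h).2.2 X)⟩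
  comp_le_comp α α' β β' h h' k k' :=
    HorTrans.le_iff.2 ⟨(HorTrans.le_iff.1 k).1, (HorTrans.le_iff.1 k').2.1, fun X =>
      ℋ.comp_le_comp _ _ _ _ _ _ ((HorTrans.le_iff.1 k).2.2 X) ((HorTrans.le_iff.1 k').2.2 X)⟩
  existsUnique_restrict β F h := ⟨β.restrict F h, ⟨rfl, β.restrict_le F h⟩, by
    rintro α ⟨rfl, hα⟩
    exact HorTrans.ext_app rfl fun X =>
      (OrderedGroupoid.restrict_eq (by simpa using h.1 X) (by simp)
        ((HorTrans.le_iff.1 hα).2.2 X)).symm⟩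

end

section

/-! ### The left-cancellative category of an ordered groupoid -/

/-- An arrow `A ⟶ B` of the category `L(𝒢)`: a formal composite of a horizontal arrow `A → B'` and
a vertical arrow `B' ≤ B`. -/
@[ext]
structure LHom (𝒢 : OrderedGroupoid.{u}) (A B : 𝒢.Obj) : Type u where
  arr : 𝒢.Arr
  src_eq : 𝒢.src arr = A
  tgt_le : 𝒢.tgt arr ≤ B

namespace LHom

attribute [simp] src_eq

variable {𝒢 : OrderedGroupoid.{u}}

/-- The identity arrows of `L(𝒢)`. -/
@[simps]
def id (A : 𝒢.Obj) : LHom 𝒢 A A := ⟨𝒢.one A, 𝒢.src_one A, (𝒢.tgt_one A).le⟩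

theorem tgt_le_src {A B C : 𝒢.Obj} (f : LHom 𝒢 A B) (g : LHom 𝒢 B C) :
    𝒢.tgt f.arr ≤ 𝒢.src g.arr :=
  f.tgt_le.trans_eq g.src_eq.symm

/-- Composition in `L(𝒢)`: restrict the horizontal part of the second arrow. -/
@[simps]
def comp {A B C : 𝒢.Obj} (f : LHom 𝒢 A B) (g : LHom 𝒢 B C) : LHom 𝒢 A C where
  arr := 𝒢.comp f.arr (OrderedGroupoid.restrict g.arr (𝒢.tgt f.arr) (f.tgt_le_src g))
    (OrderedGroupoid.src_restrict _ _ _).symm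
  src_eq := (𝒢.src_comp _ _ _).trans f.src_eq
  tgt_le := (𝒢.tgt_comp _ _ _).trans_le ((OrderedGroupoid.tgt_restrict_le _ _ _).trans g.tgt_le)

theorem id_comp {A B : 𝒢.Obj} (f : LHom 𝒢 A B) : (LHom.id A).comp f = f := by
  apply LHom.ext
  simp only [comp_arr, id_arr]
  rw [𝒢.one_comp']
  exact OrderedGroupoid.restrict_eq _ (by simp) le_rfl

theorem comp_id {A B : 𝒢.Obj} (f : LHom 𝒢 A B) : f.comp (LHom.id B) = f := by
  apply LHom.ext
  have h : OrderedGroupoid.restrict (𝒢.one B) (𝒢.tgt f.arr) (by simpa using f.tgt_le) =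
      𝒢.one (𝒢.tgt f.arr) :=
    OrderedGroupoid.restrict_eq _ (by simp) ((𝒢.one_le_one _ _).2 f.tgt_le)
  simp only [comp_arr, id_arr]
  rw [𝒢.comp_congr rfl h, 𝒢.comp_one']

theorem comp_assoc {A B C D : 𝒢.Obj} (f : LHom 𝒢 A B) (g : LHom 𝒢 B C) (k : LHom 𝒢 C D) :
    (f.comp g).comp k = f.comp (g.comp k) := by
  apply LHom.ext
  simp only [comp_arr]
  rw [𝒢.assoc _ _ _ (by simp) (by simp)]
  apply 𝒢.comp_congr rfl
  symm
  apply OrderedGroupoid.restrict_eq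
  · simp
  · refine 𝒢.comp_le_comp _ _ _ _ _ _ (OrderedGroupoid.restrict_le _ _ _) ?_
    have h := OrderedGroupoid.tgt_restrict_le g.arr (𝒢.tgt f.arr) (f.tgt_le_src g)
    have e : OrderedGroupoid.restrict k.arr (𝒢.tgt (𝒢.comp f.arr (OrderedGroupoid.restrict g.arr
        (𝒢.tgt f.arr) (f.tgt_le_src g)) (OrderedGroupoid.src_restrict _ _ _).symm))
        (by simpa using h.trans (g.tgt_le_src k)) =
        OrderedGroupoid.restrict (OrderedGroupoid.restrict k.arr (𝒢.tgt g.arr) (g.tgt_le_src k))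
          (𝒢.tgt (OrderedGroupoid.restrict g.arr (𝒢.tgt f.arr) (f.tgt_le_src g)))
          (by simpa using h) :=
      OrderedGroupoid.eq_of_le_of_src (k := k.arr) (OrderedGroupoid.restrict_le _ _ _)
        ((OrderedGroupoid.restrict_le _ _ _).trans (OrderedGroupoid.restrict_le _ _ _)) (by simp)
    rw [e]
    exact OrderedGroupoid.restrict_le _ _ _

theorem right_cancel {A B C : 𝒢.Obj} {f g : LHom 𝒢 A B} (k : LHom 𝒢 B C)
    (h : f.comp k = g.comp k) : f = g := by
  have h' := congrArg LHom.arr h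
  simp only [comp_arr] at h'
  have e : OrderedGroupoid.restrict k.arr (𝒢.tgt f.arr) (f.tgt_le_src k) =
      OrderedGroupoid.restrict k.arr (𝒢.tgt g.arr) (g.tgt_le_src k) :=
    OrderedGroupoid.eq_of_le_of_tgt (OrderedGroupoid.restrict_le _ _ _)
      (OrderedGroupoid.restrict_le _ _ _) (by simpa using congrArg 𝒢.tgt h')
  have e' : 𝒢.tgt f.arr = 𝒢.tgt g.arr := by simpa using congrArg 𝒢.src e
  apply LHom.ext
  refine 𝒢.comp_right_cancel (OrderedGroupoid.src_restrict _ _ _).symm ?_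
    (h'.trans (𝒢.comp_congr rfl e.symm _))
  rw [OrderedGroupoid.src_restrict, e']

/-- The action of an ordered functor on the arrows of `L(𝒢)`. -/
@[simps]
def map {ℋ : OrderedGroupoid.{u}} (F : OrdFunctor 𝒢 ℋ) {A B : 𝒢.Obj} (f : LHom 𝒢 A B) :
    LHom ℋ (F.obj A) (F.obj B) where
  arr := F.arr f.arr
  src_eq := by simp
  tgt_le := by simpa using F.obj_mono f.tgt_le

end LHom

/-- The objects of the category `L(𝒢)`: those of `𝒢`. -/
structure LObj (𝒢 : OrderedGroupoid.{u}) : Type u where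
  obj : 𝒢.Obj

/-- The category `L(𝒢)`. -/
instance lCategory (𝒢 : OrderedGroupoid.{u}) : SmallCategory (LObj 𝒢) where
  Hom A B := LHom 𝒢 A.obj B.obj
  id A := LHom.id A.obj
  comp f g := f.comp g
  id_comp f := f.id_comp
  comp_id f := f.comp_id
  assoc f g k := f.comp_assoc g k

/-- A (small) left-cancellative category: all arrows are monomorphisms. -/
structure LcCat : Type (u + 1) where
  carrier : Type u
  [category : SmallCategory carrier]
  mono : ∀ {X Y : carrier} (f : X ⟶ Y), Mono f

attribute [instance] LcCat.category LcCat.mono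

/-- The left-cancellative category `L(𝒢)` of an ordered groupoid. -/
def lCat (𝒢 : OrderedGroupoid.{u}) : LcCat.{u} where
  carrier := LObj 𝒢
  mono f := ⟨fun _ _ h => LHom.right_cancel f h⟩

/-- The 2-category of left-cancellative categories, functors and natural transformations. -/
instance lcCatBicategory : Bicategory LcCat.{u} where
  Hom C D := C.carrier ⥤ D.carrier
  id C := 𝟭 C.carrier
  comp F G := F ⋙ G
  homCategory C D := inferInstanceAs (Category (C.carrier ⥤ D.carrier))
  whiskerLeft F _ _ η := Functor.whiskerLeft F η
  whiskerRight η G := Functor.whiskerRight η G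
  associator F G H := Functor.associator F G H
  leftUnitor F := Functor.leftUnitor F
  rightUnitor F := Functor.rightUnitor F
  whiskerLeft_id _ _ := Functor.whiskerLeft_id' _
  whiskerLeft_comp F _ _ _ η θ := Functor.whiskerLeft_comp F η θ
  id_whiskerLeft η := NatTrans.ext (funext fun X => by simp)
  comp_whiskerLeft F G _ _ η := NatTrans.ext (funext fun X => by simp)
  id_whiskerRight F G := Functor.whiskerRight_id' _
  comp_whiskerRight η θ G := Functor.whiskerRight_comp η θ G
  whiskerRight_id η := NatTrans.ext (funext fun X => by simp)
  whiskerRight_comp η F G := NatTrans.ext (funext fun X => by simp)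
  whisker_assoc F _ _ η G := NatTrans.ext (funext fun X => by simp)
  whisker_exchange η θ := NatTrans.ext (funext fun X => by simp)
  pentagon _ _ _ _ := NatTrans.ext (funext fun X => by simp)
  triangle _ _ := NatTrans.ext (funext fun X => by simp)

instance : Bicategory.Strict LcCat.{u} where
  id_comp _ := rfl
  comp_id _ := rfl
  assoc _ _ _ := rfl
  leftUnitor_eqToIso _ := rfl
  rightUnitor_eqToIso _ := rfl
  associator_eqToIso _ _ _ := rfl

/-! ### The 2-category of ordered groupoids -/

/-- The category `L(DblCat(𝒢, ℋ))` of double functors and `Λ`-transformations. -/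
instance ordFunctorCategory (𝒢 ℋ : OrderedGroupoid.{u}) : Category.{u} (OrdFunctor 𝒢 ℋ) where
  Hom F G := LHom (dblCat 𝒢 ℋ) F G
  id F := LHom.id (𝒢 := dblCat 𝒢 ℋ) F
  comp f g := LHom.comp (𝒢 := dblCat 𝒢 ℋ) f g
  id_comp f := LHom.id_comp (𝒢 := dblCat 𝒢 ℋ) f
  comp_id f := LHom.comp_id (𝒢 := dblCat 𝒢 ℋ) f
  assoc f g k := LHom.comp_assoc (𝒢 := dblCat 𝒢 ℋ) f g k

namespace Lambda

variable {𝒢 ℋ 𝒦 : OrderedGroupoid.{u}}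

/-- The horizontal transformation underlying a `Λ`-transformation. -/
def hor {F G : OrdFunctor 𝒢 ℋ} (β : F ⟶ G) : HorTrans 𝒢 ℋ := LHom.arr β

theorem dom_hor {F G : OrdFunctor 𝒢 ℋ} (β : F ⟶ G) : (hor β).dom = F := LHom.src_eq β

theorem cod_hor_le {F G : OrdFunctor 𝒢 ℋ} (β : F ⟶ G) : (hor β).cod ≤ G := LHom.tgt_le β

/-- A `Λ`-transformation `F ⇒ G`, from a horizontal transformation `F ⇒ G'` with `G' ≤ G`. -/
def mk {F G : OrdFunctor 𝒢 ℋ} (α : HorTrans 𝒢 ℋ) (h : α.dom = F) (h' : α.cod ≤ G) : F ⟶ G :=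
  (⟨α, h, h'⟩ : LHom (dblCat 𝒢 ℋ) F G)

/-- The component of a `Λ`-transformation at an object `X`, as an arrow of `L(ℋ)`. -/
@[simps]
def app {F G : OrdFunctor 𝒢 ℋ} (β : F ⟶ G) (X : 𝒢.Obj) : LHom ℋ (F.obj X) (G.obj X) where
  arr := (hor β).app X
  src_eq := by rw [HorTrans.src_app, dom_hor]
  tgt_le := by rw [HorTrans.tgt_app]; exact (cod_hor_le β).1 X

theorem ext {F G : OrdFunctor 𝒢 ℋ} {β γ : F ⟶ G} (h : ∀ X, app β X = app γ X) : β = γ := by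
  apply LHom.ext (𝒢 := dblCat 𝒢 ℋ)
  exact HorTrans.ext_app ((dom_hor β).trans (dom_hor γ).symm)
    fun X => congrArg LHom.arr (h X)

theorem app_id (F : OrdFunctor 𝒢 ℋ) (X : 𝒢.Obj) : app (𝟙 F) X = LHom.id (F.obj X) := rfl

theorem app_comp {F G H : OrdFunctor 𝒢 ℋ} (β : F ⟶ G) (γ : G ⟶ H) (X : 𝒢.Obj) :
    app (β ≫ γ) X = (app β X).comp (app γ X) := by
  apply LHom.ext
  have hle : (hor β).cod ≤ (hor γ).dom := (cod_hor_le β).trans_eq (dom_hor γ).symm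
  have key : OrderedGroupoid.restrict (𝒢 := dblCat 𝒢 ℋ) (hor γ) (hor β).cod hle =
      (hor γ).restrict (hor β).cod hle :=
    OrderedGroupoid.restrict_eq (𝒢 := dblCat 𝒢 ℋ) hle rfl ((hor γ).restrict_le _ hle)
  have e : hor (β ≫ γ) = HorTrans.comp (hor β) ((hor γ).restrict (hor β).cod hle) rfl :=
    (dblCat 𝒢 ℋ).comp_congr (f := hor β) rfl key
      (OrderedGroupoid.src_restrict (𝒢 := dblCat 𝒢 ℋ) (hor γ) (hor β).cod hle).symm
  simp only [app_arr, LHom.comp_arr]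
  rw [e]
  refine ℋ.comp_congr rfl ?_ _
  refine OrderedGroupoid.eq_of_le_of_src (k := (hor γ).app X)
    (OrderedGroupoid.restrict_le _ _ (by simpa using hle.1 X))
    (OrderedGroupoid.restrict_le _ _ _) ?_
  rw [HorTrans.src_app, OrderedGroupoid.src_restrict, HorTrans.tgt_app]
  rfl

/-- Naturality of the components of a `Λ`-transformation with respect to arrows of `L(𝒢)`. -/
theorem naturality {F G : OrdFunctor 𝒢 ℋ} (β : F ⟶ G) {A B : 𝒢.Obj} (f : LHom 𝒢 A B) :
    (f.map F).comp (app β B) = (app β A).comp (f.map G) := by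
  obtain ⟨f, rfl, hB⟩ := f
  apply LHom.ext
  have hF := dom_hor β
  have hs : ∀ X, ℋ.src ((hor β).app X) = F.obj X := fun X => by rw [HorTrans.src_app, hF]
  simp only [LHom.comp_arr, app_arr, LHom.map_arr]
  have h1 : OrderedGroupoid.restrict ((hor β).app B) (ℋ.tgt (F.arr f))
      (by rw [hs, OrdFunctor.tgt_arr]; exact F.obj_mono hB) = (hor β).app (𝒢.tgt f) :=
    OrderedGroupoid.restrict_eq _ (by rw [hs, OrdFunctor.tgt_arr]) ((hor β).app_mono _ _ hB)
  have h2 : OrderedGroupoid.restrict (G.arr f) (ℋ.tgt ((hor β).app (𝒢.src f)))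
      (by rw [HorTrans.tgt_app, OrdFunctor.src_arr]; exact (cod_hor_le β).1 _) =
      (hor β).cod.arr f :=
    OrderedGroupoid.restrict_eq _ (by simp) ((cod_hor_le β).2 f)
  rw [ℋ.comp_congr rfl h1, ℋ.comp_congr (f := (hor β).app (𝒢.src f)) rfl h2,
    ← (hor β).naturality f]
  exact ℋ.comp_congr (by rw [hF]) rfl _

/-- Left whiskering of horizontal transformations. -/
def horWhiskerLeft (F : OrdFunctor 𝒢 ℋ) (α : HorTrans ℋ 𝒦) : HorTrans 𝒢 𝒦 where
  dom := F.comp α.dom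
  cod := F.comp α.cod
  app X := α.app (F.obj X)
  src_app X := α.src_app _
  tgt_app X := α.tgt_app _
  naturality f := by
    have := α.naturality (F.arr f)
    simp only [OrdFunctor.src_arr, OrdFunctor.tgt_arr] at this
    exact this
  app_mono X Y h := α.app_mono _ _ (F.obj_mono h)

/-- Right whiskering of horizontal transformations. -/
def horWhiskerRight (α : HorTrans 𝒢 ℋ) (H : OrdFunctor ℋ 𝒦) : HorTrans 𝒢 𝒦 where
  dom := α.dom.comp H
  cod := α.cod.comp H
  app X := H.arr (α.app X)
  src_app X := by simp
  tgt_app X := by simp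
  naturality f := by
    have := congrArg H.arr (α.naturality f)
    rw [H.arr_comp, H.arr_comp] at this
    exact this
  app_mono X Y h := H.arr_mono _ _ (α.app_mono _ _ h)

/-- Left whiskering of `Λ`-transformations. -/
def whiskerLeft (F : OrdFunctor 𝒢 ℋ) {G H : OrdFunctor ℋ 𝒦} (β : G ⟶ H) :
    F.comp G ⟶ F.comp H :=
  mk (horWhiskerLeft F (hor β)) (congrArg (fun K => F.comp K) (dom_hor β))
    ⟨fun _ => (cod_hor_le β).1 _, fun _ => (cod_hor_le β).2 _⟩

/-- Right whiskering of `Λ`-transformations. -/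
def whiskerRight {F G : OrdFunctor 𝒢 ℋ} (β : F ⟶ G) (H : OrdFunctor ℋ 𝒦) :
    F.comp H ⟶ G.comp H :=
  mk (horWhiskerRight (hor β) H) (congrArg (fun K => OrdFunctor.comp K H) (dom_hor β))
    ⟨fun _ => H.obj_mono ((cod_hor_le β).1 _), fun _ => H.arr_mono _ _ ((cod_hor_le β).2 _)⟩

theorem app_whiskerLeft (F : OrdFunctor 𝒢 ℋ) {G H : OrdFunctor ℋ 𝒦} (β : G ⟶ H) (X : 𝒢.Obj) :
    app (whiskerLeft F β) X = app β (F.obj X) := rfl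

theorem app_whiskerRight {F G : OrdFunctor 𝒢 ℋ} (β : F ⟶ G) (H : OrdFunctor ℋ 𝒦) (X : 𝒢.Obj) :
    app (whiskerRight β H) X = (app β X).map H := rfl

end Lambda

theorem LHom.map_id {𝒢 ℋ : OrderedGroupoid.{u}} (F : OrdFunctor 𝒢 ℋ) (A : 𝒢.Obj) :
    (LHom.id A).map F = LHom.id (F.obj A) :=
  LHom.ext (F.arr_one A)

theorem LHom.map_comp {𝒢 ℋ : OrderedGroupoid.{u}} (F : OrdFunctor 𝒢 ℋ) {A B C : 𝒢.Obj}
    (f : LHom 𝒢 A B) (g : LHom 𝒢 B C) : (f.comp g).map F = (f.map F).comp (g.map F) := by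
  apply LHom.ext
  simp only [LHom.map_arr, LHom.comp_arr]
  rw [F.arr_comp]
  apply ℋ.comp_congr rfl
  rw [F.arr_restrict]
  simp

theorem Lambda.whiskerLeft_id {𝒢 ℋ 𝒦 : OrderedGroupoid.{u}} (F : OrdFunctor 𝒢 ℋ)
    (G : OrdFunctor ℋ 𝒦) : Lambda.whiskerLeft F (𝟙 G) = 𝟙 (F.comp G) :=
  Lambda.ext fun _ => rfl

theorem Lambda.whiskerRight_id {𝒢 ℋ 𝒦 : OrderedGroupoid.{u}} (F : OrdFunctor 𝒢 ℋ)
    (G : OrdFunctor ℋ 𝒦) : Lambda.whiskerRight (𝟙 F) G = 𝟙 (F.comp G) :=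
  Lambda.ext fun _ => LHom.map_id _ _

/-- The 2-category of ordered groupoids, double functors and `Λ`-transformations. -/
instance ordGpdBicategory : Bicategory OrderedGroupoid.{u} where
  Hom 𝒢 ℋ := OrdFunctor 𝒢 ℋ
  id 𝒢 := OrdFunctor.id 𝒢
  comp F G := F.comp G
  homCategory 𝒢 ℋ := ordFunctorCategory 𝒢 ℋ
  whiskerLeft F _ _ β := Lambda.whiskerLeft F β
  whiskerRight β G := Lambda.whiskerRight β G
  associator F G H := Iso.refl (F.comp (G.comp H))
  leftUnitor F := Iso.refl F
  rightUnitor F := Iso.refl F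
  whiskerLeft_id F G := Lambda.whiskerLeft_id F G
  whiskerLeft_comp F _ _ _ η θ := Lambda.ext fun X => by
    rw [Lambda.app_comp]; simp only [Lambda.app_whiskerLeft]; rw [Lambda.app_comp]; rfl
  id_whiskerLeft η := Lambda.ext fun X => by
    erw [Category.id_comp, Category.comp_id]; rfl
  comp_whiskerLeft F G _ _ η := Lambda.ext fun X => by
    erw [Category.id_comp, Category.comp_id]; rfl
  id_whiskerRight F G := Lambda.whiskerRight_id F G
  comp_whiskerRight η θ G := Lambda.ext fun X => by
    rw [Lambda.app_comp]; simp only [Lambda.app_whiskerRight]; rw [Lambda.app_comp, LHom.map_comp]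
    rfl
  whiskerRight_id η := Lambda.ext fun X => by
    erw [Category.id_comp, Category.comp_id]; rfl
  whiskerRight_comp η F G := Lambda.ext fun X => by
    erw [Category.id_comp, Category.comp_id]; rfl
  whisker_assoc F _ _ η G := Lambda.ext fun X => by
    erw [Category.id_comp, Category.comp_id]; rfl
  whisker_exchange η θ := Lambda.ext fun X => by
    rw [Lambda.app_comp, Lambda.app_comp]
    simp only [Lambda.app_whiskerRight, Lambda.app_whiskerLeft]
    exact (Lambda.naturality θ _).symm
  pentagon F G H K := by
    simp only [Iso.refl_hom]
    erw [Lambda.whiskerRight_id, Lambda.whiskerLeft_id, Category.id_comp, Category.id_comp]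
  triangle F G := by
    simp only [Iso.refl_hom]
    erw [Lambda.whiskerRight_id, Lambda.whiskerLeft_id, Category.id_comp]
    rfl

instance : Bicategory.Strict OrderedGroupoid.{u} where
  id_comp _ := rfl
  comp_id _ := rfl
  assoc _ _ _ := rfl
  leftUnitor_eqToIso _ := rfl
  rightUnitor_eqToIso _ := rfl
  associator_eqToIso _ _ _ := rfl


/-! ### The 2-functor `L` -/

/-- The functor `L(F)`. -/
@[simps]
def lFunctor {𝒢 ℋ : OrderedGroupoid.{u}} (F : OrdFunctor 𝒢 ℋ) : LObj 𝒢 ⥤ LObj ℋ where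
  obj X := ⟨F.obj X.obj⟩
  map f := LHom.map F f
  map_id X := LHom.map_id F X.obj
  map_comp f g := LHom.map_comp F f g

/-- The natural transformation `L(β)`. -/
@[simps]
def lNatTrans {𝒢 ℋ : OrderedGroupoid.{u}} {F G : OrdFunctor 𝒢 ℋ} (β : F ⟶ G) :
    lFunctor F ⟶ lFunctor G where
  app X := Lambda.app β X.obj
  naturality _ _ f := Lambda.naturality β f

/-- The 2-functor `L` from ordered groupoids to left-cancellative categories. -/
def L : StrictPseudofunctor OrderedGroupoid.{u} LcCat.{u} :=
  StrictPseudofunctor.mk''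
    { obj := lCat
      map := fun F => lFunctor F
      map₂ := fun β => lNatTrans β
      map₂_id := fun F => NatTrans.ext (funext fun X => Lambda.app_id F X.obj)
      map₂_comp := fun β γ => NatTrans.ext (funext fun X => Lambda.app_comp β γ X.obj)
      map_id := fun _ => rfl
      map_comp := fun _ _ => rfl
      map₂_whisker_left := fun F _ _ β => by
        erw [Category.id_comp, Category.comp_id]; rfl
      map₂_whisker_right := fun β F => by
        erw [Category.id_comp, Category.comp_id]; rfl }

end

section

/-! ### The ordered groupoid of a left-cancellative category -/

/-- An arrow of `C`, seen as representing a subobject of its codomain. -/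
structure SubRep (C : LcCat.{u}) : Type u where
  dom : C.carrier
  cod : C.carrier
  hom : dom ⟶ cod

/-- A span `left ← apex → right` in `C`. -/
structure SpanRep (C : LcCat.{u}) : Type u where
  apex : C.carrier
  left : C.carrier
  right : C.carrier
  fst : apex ⟶ left
  snd : apex ⟶ right

/-- `m ≤ m'` when `m` and `m'` have the same codomain and `m` factors through `m'`. -/
inductive SubRep.Le {C : LcCat.{u}} : SubRep C → SubRep C → Prop
  | intro {A A' B : C.carrier} (h : A ⟶ A') (m : A ⟶ B) (m' : A' ⟶ B) (w : h ≫ m' = m) :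
    SubRep.Le ⟨A, B, m⟩ ⟨A', B, m'⟩

/-- `(m, n) ≤ (m', n')` when the feet agree and some arrow between the apexes commutes with the
legs. -/
inductive SpanRep.Le {C : LcCat.{u}} : SpanRep C → SpanRep C → Prop
  | intro {A A' X Y : C.carrier} (h : A ⟶ A') (m : A ⟶ X) (n : A ⟶ Y) (m' : A' ⟶ X) (n' : A' ⟶ Y)
      (w : h ≫ m' = m) (w' : h ≫ n' = n) :
    SpanRep.Le ⟨A, X, Y, m, n⟩ ⟨A', X, Y, m', n'⟩

variable {C D E : LcCat.{u}}

instance SubRep.preorder : Preorder (SubRep C) where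
  le := SubRep.Le
  le_refl m := ⟨𝟙 _, _, _, Category.id_comp _⟩
  le_trans a b c h k := by
    obtain ⟨h, m, m', w⟩ := h
    obtain ⟨k, _, m'', w'⟩ := k
    exact ⟨h ≫ k, _, _, by rw [Category.assoc, w', w]⟩

instance SpanRep.preorder : Preorder (SpanRep C) where
  le := SpanRep.Le
  le_refl m := ⟨𝟙 _, _, _, _, _, Category.id_comp _, Category.id_comp _⟩
  le_trans a b c h k := by
    obtain ⟨h, m, n, m', n', w, w'⟩ := h
    obtain ⟨k, _, _, m'', n'', v, v'⟩ := k
    exact ⟨h ≫ k, _, _, _, _, by rw [Category.assoc, v, w], by rw [Category.assoc, v', w']⟩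

theorem SubRep.le_iff {A A' B : C.carrier} {m : A ⟶ B} {m' : A' ⟶ B} :
    (⟨A, B, m⟩ : SubRep C) ≤ ⟨A', B, m'⟩ ↔ ∃ h : A ⟶ A', h ≫ m' = m :=
  ⟨by rintro ⟨h, _, _, w⟩; exact ⟨h, w⟩, fun ⟨h, w⟩ => ⟨h, _, _, w⟩⟩

theorem SpanRep.le_iff {A A' X Y : C.carrier} {m : A ⟶ X} {n : A ⟶ Y} {m' : A' ⟶ X}
    {n' : A' ⟶ Y} : (⟨A, X, Y, m, n⟩ : SpanRep C) ≤ ⟨A', X, Y, m', n'⟩ ↔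
      ∃ h : A ⟶ A', h ≫ m' = m ∧ h ≫ n' = n :=
  ⟨by rintro ⟨h, _, _, _, _, w, w'⟩; exact ⟨h, w, w'⟩, fun ⟨h, w, w'⟩ => ⟨h, _, _, _, _, w, w'⟩⟩

/-- The objects of `G(C)`: subobjects in `C`.  As all arrows of `C` are monomorphisms, two arrows
factor through each other if and only if they are isomorphic over their common codomain, see
`gObj_mk_eq_iff`. -/
abbrev GObj (C : LcCat.{u}) : Type u := Antisymmetrization (SubRep C) (· ≤ ·)

/-- The horizontal arrows of `G(C)`: isomorphism classes of spans, see `gArr_mk_eq_iff`. -/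
abbrev GArr (C : LcCat.{u}) : Type u := Antisymmetrization (SpanRep C) (· ≤ ·)

/-- The subobject `[m]` represented by an arrow `m`. -/
def GObj.mk {A B : C.carrier} (m : A ⟶ B) : GObj C := toAntisymmetrization (· ≤ ·) ⟨A, B, m⟩

/-- The horizontal arrow `[m, n]` represented by a span. -/
def GArr.mk {A X Y : C.carrier} (m : A ⟶ X) (n : A ⟶ Y) : GArr C :=
  toAntisymmetrization (· ≤ ·) ⟨A, X, Y, m, n⟩

theorem GObj.ind {p : GObj C → Prop} (h : ∀ {A B : C.carrier} (m : A ⟶ B), p (GObj.mk m))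
    (X : GObj C) : p X :=
  Quotient.inductionOn X fun m => h m.hom

theorem GArr.ind {p : GArr C → Prop}
    (h : ∀ {A X Y : C.carrier} (m : A ⟶ X) (n : A ⟶ Y), p (GArr.mk m n)) (f : GArr C) : p f :=
  Quotient.inductionOn f fun s => h s.fst s.snd

theorem GObj.mk_le_iff {A A' B : C.carrier} {m : A ⟶ B} {m' : A' ⟶ B} :
    GObj.mk m ≤ GObj.mk m' ↔ ∃ h : A ⟶ A', h ≫ m' = m :=
  SubRep.le_iff

theorem GArr.mk_le_iff {A A' X Y : C.carrier} {m : A ⟶ X} {n : A ⟶ Y} {m' : A' ⟶ X}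
    {n' : A' ⟶ Y} : GArr.mk m n ≤ GArr.mk m' n' ↔ ∃ h : A ⟶ A', h ≫ m' = m ∧ h ≫ n' = n :=
  SpanRep.le_iff

theorem GObj.mk_le_cases {A A' B B' : C.carrier} {m : A ⟶ B} {m' : A' ⟶ B'}
    (h : GObj.mk m ≤ GObj.mk m') : ∃ e : B' = B, ∃ h : A ⟶ A', h ≫ m' ≫ eqToHom e = m := by
  have h' : (⟨A, B, m⟩ : SubRep C) ≤ ⟨A', B', m'⟩ := h
  obtain ⟨k, _, _, w⟩ := h'
  exact ⟨rfl, k, by simpa using w⟩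

/-- If `X ≤ [m]` then `X = [n ≫ m]` for some `n`. -/
theorem GObj.exists_of_le_mk {A B : C.carrier} {m : A ⟶ B} {X : GObj C} (h : X ≤ GObj.mk m) :
    ∃ (A' : C.carrier) (n : A' ⟶ A), X = GObj.mk (n ≫ m) := by
  induction X using GObj.ind with
  | h p =>
    obtain ⟨rfl, k, w⟩ := GObj.mk_le_cases h
    exact ⟨_, k, by rw [← w]; simp⟩

/-- If `f ≤ [m, n]` then `f = [k ≫ m, k ≫ n]` for some `k`. -/
theorem GArr.exists_of_le_mk {A X Y : C.carrier} {m : A ⟶ X} {n : A ⟶ Y} {f : GArr C}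
    (h : f ≤ GArr.mk m n) :
    ∃ (A' : C.carrier) (k : A' ⟶ A), f = GArr.mk (k ≫ m) (k ≫ n) := by
  induction f using GArr.ind with
  | h p q =>
    have h' : (⟨_, _, _, p, q⟩ : SpanRep C) ≤ ⟨_, _, _, m, n⟩ := h
    obtain ⟨k, _, _, _, _, w, w'⟩ := h'
    exact ⟨_, k, by rw [w, w']⟩

theorem gObj_mk_eq_iff {A A' B : C.carrier} {m : A ⟶ B} {m' : A' ⟶ B} :
    GObj.mk m = GObj.mk m' ↔ ∃ k : A ≅ A', k.hom ≫ m' = m := by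
  constructor
  · intro h
    obtain ⟨a, ha⟩ := GObj.mk_le_iff.1 h.le
    obtain ⟨b, hb⟩ := GObj.mk_le_iff.1 h.ge
    exact ⟨⟨a, b, by rw [← cancel_mono m, Category.assoc, hb, ha, Category.id_comp],
      by rw [← cancel_mono m', Category.assoc, ha, hb, Category.id_comp]⟩, ha⟩
  · rintro ⟨k, rfl⟩
    exact le_antisymm (GObj.mk_le_iff.2 ⟨k.hom, rfl⟩) (GObj.mk_le_iff.2 ⟨k.inv, by simp⟩)

theorem gArr_mk_eq_iff {A A' X Y : C.carrier} {m : A ⟶ X} {n : A ⟶ Y} {m' : A' ⟶ X}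
    {n' : A' ⟶ Y} : GArr.mk m n = GArr.mk m' n' ↔
      ∃ k : A ≅ A', k.hom ≫ m' = m ∧ k.hom ≫ n' = n := by
  constructor
  · intro h
    obtain ⟨a, ha, ha'⟩ := GArr.mk_le_iff.1 h.le
    obtain ⟨b, hb, hb'⟩ := GArr.mk_le_iff.1 h.ge
    exact ⟨⟨a, b, by rw [← cancel_mono m, Category.assoc, hb, ha, Category.id_comp],
      by rw [← cancel_mono m', Category.assoc, ha, hb, Category.id_comp]⟩, ha, ha'⟩
  · rintro ⟨k, rfl, rfl⟩
    exact le_antisymm (GArr.mk_le_iff.2 ⟨k.hom, rfl, rfl⟩)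
      (GArr.mk_le_iff.2 ⟨k.inv, by simp, by simp⟩)

namespace GArr

theorem src_aux (s t : SpanRep C) (h : s ≤ t) : GObj.mk s.fst ≤ GObj.mk t.fst := by
  obtain ⟨h, _, _, _, _, w, _⟩ := h
  exact GObj.mk_le_iff.2 ⟨h, w⟩

theorem tgt_aux (s t : SpanRep C) (h : s ≤ t) : GObj.mk s.snd ≤ GObj.mk t.snd := by
  obtain ⟨h, _, _, _, _, _, w⟩ := h
  exact GObj.mk_le_iff.2 ⟨h, w⟩

theorem inv_aux (s t : SpanRep C) (h : s ≤ t) :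
    GArr.mk s.snd s.fst ≤ GArr.mk t.snd t.fst := by
  obtain ⟨h, _, _, _, _, w, w'⟩ := h
  exact GArr.mk_le_iff.2 ⟨h, w', w⟩

theorem one_aux (s t : SubRep C) (h : s ≤ t) : GArr.mk s.hom s.hom ≤ GArr.mk t.hom t.hom := by
  obtain ⟨h, _, _, w⟩ := h
  exact GArr.mk_le_iff.2 ⟨h, w, w⟩

/-- The source of `[m, n]` is `[m]`. -/
def src : GArr C → GObj C :=
  Quotient.lift (fun s => GObj.mk s.fst)
    fun s t h => le_antisymm (src_aux s t h.1) (src_aux t s h.2)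

/-- The target of `[m, n]` is `[n]`. -/
def tgt : GArr C → GObj C :=
  Quotient.lift (fun s => GObj.mk s.snd)
    fun s t h => le_antisymm (tgt_aux s t h.1) (tgt_aux t s h.2)

/-- The inverse of `[m, n]` is `[n, m]`. -/
def inv : GArr C → GArr C :=
  Quotient.lift (fun s => GArr.mk s.snd s.fst)
    fun s t h => le_antisymm (inv_aux s t h.1) (inv_aux t s h.2)

/-- The identity of `[m]` is `[m, m]`. -/
def one : GObj C → GArr C :=
  Quotient.lift (fun s => GArr.mk s.hom s.hom)
    fun s t h => le_antisymm (one_aux s t h.1) (one_aux t s h.2)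

@[simp] theorem src_mk {A X Y : C.carrier} (m : A ⟶ X) (n : A ⟶ Y) :
    src (GArr.mk m n) = GObj.mk m := rfl

@[simp] theorem tgt_mk {A X Y : C.carrier} (m : A ⟶ X) (n : A ⟶ Y) :
    tgt (GArr.mk m n) = GObj.mk n := rfl

@[simp] theorem inv_mk {A X Y : C.carrier} (m : A ⟶ X) (n : A ⟶ Y) :
    inv (GArr.mk m n) = GArr.mk n m := rfl

@[simp] theorem one_mk {A X : C.carrier} (m : A ⟶ X) : one (GObj.mk m) = GArr.mk m m := rfl

theorem exists_rep_src {f : GArr C} {A X : C.carrier} (m : A ⟶ X) (h : GObj.mk m = src f) :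
    ∃ (Y : C.carrier) (n : A ⟶ Y), f = GArr.mk m n := by
  induction f using GArr.ind with
  | h p q =>
    rw [src_mk] at h
    obtain ⟨rfl, -⟩ := GObj.mk_le_cases h.le
    obtain ⟨k, hk⟩ := gObj_mk_eq_iff.1 h
    exact ⟨_, k.hom ≫ q, (gArr_mk_eq_iff.2 ⟨k, hk, rfl⟩).symm⟩

/-- Composable horizontal arrows are represented by spans with a common middle leg. -/
theorem exists_rep (f g : GArr C) (h : tgt f = src g) :
    ∃ (A X Y Z : C.carrier) (k : A ⟶ X) (m : A ⟶ Y) (n : A ⟶ Z),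
      f = GArr.mk k m ∧ g = GArr.mk m n := by
  induction f using GArr.ind with
  | h k m =>
    obtain ⟨Z, n, hn⟩ := exists_rep_src m h
    exact ⟨_, _, _, _, k, m, n, rfl, hn⟩

theorem exists_comp (f g : GArr C) (h : tgt f = src g) :
    ∃ (x : GArr C) (A X Y Z : C.carrier) (k : A ⟶ X) (m : A ⟶ Y) (n : A ⟶ Z),
      f = GArr.mk k m ∧ g = GArr.mk m n ∧ x = GArr.mk k n := by
  obtain ⟨A, X, Y, Z, k, m, n, hf, hg⟩ := exists_rep f g h
  exact ⟨_, A, X, Y, Z, k, m, n, hf, hg, rfl⟩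

/-- Composition in `G(C)`: the composite of `[k, m]` and `[m, n]` is `[k, n]`, see `comp_mk`. -/
def comp (f g : GArr C) (h : tgt f = src g) : GArr C := (exists_comp f g h).choose

theorem comp_aux {A A' X X' Y Y' Z Z' : C.carrier} {k : A ⟶ X} {m : A ⟶ Y} {n : A ⟶ Z}
    {k' : A' ⟶ X'} {m' : A' ⟶ Y'} {n' : A' ⟶ Z'} (h : GArr.mk k m ≤ GArr.mk k' m')
    (h' : GArr.mk m n ≤ GArr.mk m' n') : GArr.mk k n ≤ GArr.mk k' n' := by
  have h1 : (⟨_, _, _, k, m⟩ : SpanRep C) ≤ ⟨_, _, _, k', m'⟩ := h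
  have h2 : (⟨_, _, _, m, n⟩ : SpanRep C) ≤ ⟨_, _, _, m', n'⟩ := h'
  obtain ⟨a, _, _, _, _, w, w'⟩ := h1
  obtain ⟨b, _, _, _, _, v, v'⟩ := h2
  obtain rfl : a = b := by rw [← cancel_mono, w', v]
  exact GArr.mk_le_iff.2 ⟨a, w, v'⟩

@[simp] theorem comp_mk {A X Y Z : C.carrier} (k : A ⟶ X) (m : A ⟶ Y) (n : A ⟶ Z)
    (h : tgt (GArr.mk k m) = src (GArr.mk m n)) :
    comp (GArr.mk k m) (GArr.mk m n) h = GArr.mk k n := by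
  obtain ⟨A', X', Y', Z', k', m', n', h1, h2, h3⟩ := (exists_comp _ _ h).choose_spec
  exact h3.trans (le_antisymm (comp_aux h1.ge h2.ge) (comp_aux h1.le h2.le))

end GArr

/-- The ordered groupoid `G(C)` of a left-cancellative category. -/
def gGpd (C : LcCat.{u}) : OrderedGroupoid.{u} where
  Obj := GObj C
  Arr := GArr C
  src := GArr.src
  tgt := GArr.tgt
  one := GArr.one
  comp := GArr.comp
  inv := GArr.inv
  src_one X := by induction X using GObj.ind; simp
  tgt_one X := by induction X using GObj.ind; simp
  src_comp f g h := by
    obtain ⟨_, _, _, _, k, m, n, rfl, rfl⟩ := GArr.exists_rep f g h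
    simp
  tgt_comp f g h := by
    obtain ⟨_, _, _, _, k, m, n, rfl, rfl⟩ := GArr.exists_rep f g h
    simp
  one_comp f := by induction f using GArr.ind; simp
  comp_one f := by induction f using GArr.ind; simp
  assoc f g p h h' := by
    obtain ⟨_, _, _, _, k, m, n, rfl, rfl⟩ := GArr.exists_rep f g h
    obtain ⟨_, q, rfl⟩ := GArr.exists_rep_src n h'
    simp
  src_inv f := by induction f using GArr.ind; simp
  tgt_inv f := by induction f using GArr.ind; simp
  comp_inv f := by induction f using GArr.ind; simp
  inv_comp f := by induction f using GArr.ind; simp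
  one_le_one X Y := by
    induction X using GObj.ind with
    | h m =>
    induction Y using GObj.ind with
    | h n =>
    refine ⟨fun h => GArr.src_aux _ _ h, fun h => GArr.one_aux _ _ h⟩
  inv_le_inv f g h := by
    induction f using GArr.ind
    induction g using GArr.ind
    exact GArr.inv_aux _ _ h
  comp_le_comp f f' g g' h h' hf hg := by
    obtain ⟨_, _, _, _, k, m, n, rfl, rfl⟩ := GArr.exists_rep f g h
    obtain ⟨_, _, _, _, k', m', n', rfl, rfl⟩ := GArr.exists_rep f' g' h'
    rw [GArr.comp_mk, GArr.comp_mk]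
    exact GArr.comp_aux hf hg
  existsUnique_restrict f X h := by
    induction f using GArr.ind with
    | h m n =>
    obtain ⟨A, k, rfl⟩ := GObj.exists_of_le_mk h
    refine ⟨GArr.mk (k ≫ m) (k ≫ n), ⟨rfl, GArr.mk_le_iff.2 ⟨k, rfl, rfl⟩⟩, ?_⟩
    rintro f' ⟨hs, hle⟩
    obtain ⟨A', k', rfl⟩ := GArr.exists_of_le_mk hle
    obtain ⟨i, hi⟩ := gObj_mk_eq_iff.1 hs
    have : i.hom ≫ k = k' := by rw [← cancel_mono m, Category.assoc, hi]
    exact gArr_mk_eq_iff.2 ⟨i, by simp [← this], by simp [← this]⟩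

/-! ### The 2-functor `G` -/

section GFunctor

variable (K : C.carrier ⥤ D.carrier)

theorem GObj.map_aux (s t : SubRep C) (h : s ≤ t) :
    GObj.mk (K.map s.hom) ≤ GObj.mk (K.map t.hom) := by
  obtain ⟨h, _, _, w⟩ := h
  exact GObj.mk_le_iff.2 ⟨K.map h, by rw [← K.map_comp, w]⟩

theorem GArr.map_aux (s t : SpanRep C) (h : s ≤ t) :
    GArr.mk (K.map s.fst) (K.map s.snd) ≤ GArr.mk (K.map t.fst) (K.map t.snd) := by
  obtain ⟨h, _, _, _, _, w, w'⟩ := h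
  exact GArr.mk_le_iff.2 ⟨K.map h, by rw [← K.map_comp, w], by rw [← K.map_comp, w']⟩

/-- `G(K)` sends `[m]` to `[K m]`. -/
def GObj.map : GObj C → GObj D :=
  Quotient.lift (fun s => GObj.mk (K.map s.hom))
    fun s t h => le_antisymm (GObj.map_aux K s t h.1) (GObj.map_aux K t s h.2)

/-- `G(K)` sends `[m, n]` to `[K m, K n]`. -/
def GArr.map : GArr C → GArr D :=
  Quotient.lift (fun s => GArr.mk (K.map s.fst) (K.map s.snd))
    fun s t h => le_antisymm (GArr.map_aux K s t h.1) (GArr.map_aux K t s h.2)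

@[simp] theorem GObj.map_mk {A B : C.carrier} (m : A ⟶ B) :
    GObj.map K (GObj.mk m) = GObj.mk (K.map m) := rfl

@[simp] theorem GArr.map_mk {A X Y : C.carrier} (m : A ⟶ X) (n : A ⟶ Y) :
    GArr.map K (GArr.mk m n) = GArr.mk (K.map m) (K.map n) := rfl

/-- The ordered functor `G(K)`. -/
def gFunctor : OrdFunctor (gGpd C) (gGpd D) where
  obj := GObj.map K
  arr := GArr.map K
  src_arr f := by induction f using GArr.ind; rfl
  tgt_arr f := by induction f using GArr.ind; rfl
  arr_one X := by induction X using GObj.ind; rfl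
  arr_comp f g h := by
    obtain ⟨_, _, _, _, k, m, n, rfl, rfl⟩ := GArr.exists_rep f g h
    exact (congrArg (GArr.map K) (GArr.comp_mk k m n h)).trans
      (GArr.comp_mk (K.map k) (K.map m) (K.map n) rfl).symm
  arr_mono f g h := by
    induction f using GArr.ind
    induction g using GArr.ind
    exact GArr.map_aux K _ _ h

end GFunctor

section GNatTrans

variable {K K' : C.carrier ⥤ D.carrier} (θ : K ⟶ K')

theorem GObj.twist_aux (s t : SubRep C) (h : s ≤ t) :
    GObj.mk (θ.app s.dom ≫ K'.map s.hom) ≤ GObj.mk (θ.app t.dom ≫ K'.map t.hom) := by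
  obtain ⟨h, _, _, w⟩ := h
  exact GObj.mk_le_iff.2 ⟨K.map h, by simp [← w]⟩

theorem GArr.twist_aux (s t : SpanRep C) (h : s ≤ t) :
    GArr.mk (θ.app s.apex ≫ K'.map s.fst) (θ.app s.apex ≫ K'.map s.snd) ≤
      GArr.mk (θ.app t.apex ≫ K'.map t.fst) (θ.app t.apex ≫ K'.map t.snd) := by
  obtain ⟨h, _, _, _, _, w, w'⟩ := h
  exact GArr.mk_le_iff.2 ⟨K.map h, by simp [← w], by simp [← w']⟩

theorem GArr.comparison_aux (s t : SubRep C) (h : s ≤ t) :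
    GArr.mk (K.map s.hom) (θ.app s.dom ≫ K'.map s.hom) ≤
      GArr.mk (K.map t.hom) (θ.app t.dom ≫ K'.map t.hom) := by
  obtain ⟨h, _, _, w⟩ := h
  exact GArr.mk_le_iff.2 ⟨K.map h, by simp [← w], by simp [← w]⟩

/-- The intermediate double functor of the `Λ`-transformation `G(θ)`; it sends `[m : A ⟶ B]` to
`[K' m ∘ θ_A]`. -/
def gMiddle : OrdFunctor (gGpd C) (gGpd D) where
  obj := Quotient.lift (fun s => GObj.mk (θ.app s.dom ≫ K'.map s.hom))
    fun s t h => le_antisymm (GObj.twist_aux θ s t h.1) (GObj.twist_aux θ t s h.2)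
  arr := Quotient.lift
    (fun s => GArr.mk (θ.app s.apex ≫ K'.map s.fst) (θ.app s.apex ≫ K'.map s.snd))
    fun s t h => le_antisymm (GArr.twist_aux θ s t h.1) (GArr.twist_aux θ t s h.2)
  src_arr f := by induction f using GArr.ind; rfl
  tgt_arr f := by induction f using GArr.ind; rfl
  arr_one X := by induction X using GObj.ind; rfl
  arr_comp f g h := by
    obtain ⟨_, _, _, _, k, m, n, rfl, rfl⟩ := GArr.exists_rep f g h
    exact (congrArg (Quotient.lift _ _) (GArr.comp_mk k m n h)).trans
      (GArr.comp_mk (θ.app _ ≫ K'.map k) (θ.app _ ≫ K'.map m) (θ.app _ ≫ K'.map n) rfl).symm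
  arr_mono f g h := by
    induction f using GArr.ind
    induction g using GArr.ind
    exact GArr.twist_aux θ _ _ h

/-- The horizontal transformation with components `[K m, K' m ∘ θ_A] : [K m] → [K' m ∘ θ_A]`. -/
def gHor : HorTrans (gGpd C) (gGpd D) where
  dom := gFunctor K
  cod := gMiddle θ
  app := Quotient.lift (fun s => GArr.mk (K.map s.hom) (θ.app s.dom ≫ K'.map s.hom))
    fun s t h => le_antisymm (GArr.comparison_aux θ s t h.1) (GArr.comparison_aux θ t s h.2)
  src_app X := by induction X using GObj.ind; rfl
  tgt_app X := by induction X using GObj.ind; rfl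
  naturality f := by
    induction f using GArr.ind with
    | h m n =>
    exact (GArr.comp_mk (K.map m) (K.map n) (θ.app _ ≫ K'.map n) rfl).trans
      (GArr.comp_mk (K.map m) (θ.app _ ≫ K'.map m) (θ.app _ ≫ K'.map n) rfl).symm
  app_mono X Y h := by
    induction X using GObj.ind
    induction Y using GObj.ind
    exact GArr.comparison_aux θ _ _ h

/-- The `Λ`-transformation `G(θ)`. -/
def gLambda : gFunctor K ⟶ gFunctor K' :=
  Lambda.mk (gHor θ) rfl
    ⟨fun X => by
      induction X using GObj.ind
      exact GObj.mk_le_iff.2 ⟨θ.app _, rfl⟩,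
    fun f => by
      induction f using GArr.ind
      exact GArr.mk_le_iff.2 ⟨θ.app _, rfl, rfl⟩⟩

theorem gLambda_app_arr {A B : C.carrier} (m : A ⟶ B) :
    (Lambda.app (gLambda θ) (GObj.mk m)).arr =
      GArr.mk (K.map m) (θ.app A ≫ K'.map m) := rfl

end GNatTrans

theorem gFunctor_id (C : LcCat.{u}) : gFunctor (𝟭 C.carrier) = OrdFunctor.id (gGpd C) :=
  OrdFunctor.ext (funext fun X => by induction X using GObj.ind; rfl)
    (funext fun f => by induction f using GArr.ind; rfl)

theorem gFunctor_comp (K : C.carrier ⥤ D.carrier) (K' : D.carrier ⥤ E.carrier) :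
    gFunctor (K ⋙ K') = (gFunctor K).comp (gFunctor K') :=
  OrdFunctor.ext (funext fun X => by induction X using GObj.ind; rfl)
    (funext fun f => by induction f using GArr.ind; rfl)

theorem Lambda.eqToHom_app_arr {𝒢 ℋ : OrderedGroupoid.{u}} {F G : OrdFunctor 𝒢 ℋ} (h : F = G)
    (X : 𝒢.Obj) : (Lambda.app (eqToHom h) X).arr = ℋ.one (F.obj X) := by
  subst h; rfl

theorem Lambda.eqToHom_comp_app_arr {𝒢 ℋ : OrderedGroupoid.{u}} {F F' G G' : OrdFunctor 𝒢 ℋ}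
    (h : F = F') (β : F' ⟶ G) (h' : G = G') (X : 𝒢.Obj) :
    (Lambda.app (eqToHom h ≫ β ≫ eqToHom h') X).arr = (Lambda.app β X).arr := by
  subst h; subst h'; simp

/-- Computation of composites in `L(G(C))`. -/
theorem lHom_comp_arr_mk {X Y Z : (gGpd C).Obj} (f : LHom (gGpd C) X Y) (g : LHom (gGpd C) Y Z)
    {A P Q R : C.carrier} {m : A ⟶ P} {n : A ⟶ Q} {r : A ⟶ R} (hf : f.arr = GArr.mk m n)
    (hg : GArr.mk n r ≤ g.arr) : (f.comp g).arr = GArr.mk m r := by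
  have h : OrderedGroupoid.restrict g.arr ((gGpd C).tgt f.arr) (f.tgt_le_src g) =
      GArr.mk n r := OrderedGroupoid.restrict_eq _ (by rw [hf]; rfl) hg
  rw [LHom.comp_arr, (gGpd C).comp_congr hf h]
  exact GArr.comp_mk m n r rfl

theorem gLambda_comp {K K' K'' : C.carrier ⥤ D.carrier} (θ : K ⟶ K') (θ' : K' ⟶ K'') :
    gLambda (θ ≫ θ') = gLambda θ ≫ gLambda θ' := by
  apply Lambda.ext
  intro X
  induction X using GObj.ind with
  | h m =>
  apply LHom.ext
  refine Eq.trans ?_ (congrArg LHom.arr (Lambda.app_comp _ _ _)).symm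
  refine Eq.symm (lHom_comp_arr_mk _ _ (gLambda_app_arr θ m) ?_)
  exact GArr.mk_le_iff.2 ⟨θ.app _, rfl, by simp⟩

/-- The 2-functor `G` from left-cancellative categories to ordered groupoids. -/
def G : StrictPseudofunctor LcCat.{u} OrderedGroupoid.{u} :=
  StrictPseudofunctor.mk''
    { obj := gGpd
      map := fun K => gFunctor K
      map₂ := fun θ => gLambda θ
      map₂_id := fun K => by
        apply Lambda.ext
        intro X
        induction X using GObj.ind with
        | h m =>
        apply LHom.ext
        refine (gLambda_app_arr _ m).trans ?_
        erw [Category.id_comp]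
        rfl
      map₂_comp := fun θ θ' => gLambda_comp θ θ'
      map_id := fun C => gFunctor_id C
      map_comp := fun K K' => gFunctor_comp K K'
      map₂_whisker_left := fun K K' K'' θ => by
        apply Lambda.ext
        intro X
        apply LHom.ext
        erw [Lambda.eqToHom_comp_app_arr]
        induction X using GObj.ind
        rfl
      map₂_whisker_right := fun {_ _ _} {F F'} θ K => by
        apply Lambda.ext
        intro X
        apply LHom.ext
        erw [Lambda.eqToHom_comp_app_arr]
        induction X using GObj.ind with
        | h m =>
        refine (gLambda_app_arr _ m).trans ?_
        change GArr.mk (K.map (F.map m)) (K.map (θ.app _) ≫ K.map (F'.map m)) =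
          GArr.mk (K.map (F.map m)) (K.map (θ.app _ ≫ F'.map m))
        rw [K.map_comp] }

end

section

/-! ### Unit and counit -/

theorem OrderedGroupoid.inv_comp_comp {𝒢 : OrderedGroupoid.{u}} {h p q : 𝒢.Arr}
    (hp : 𝒢.tgt h = 𝒢.src p) (hq : 𝒢.tgt h = 𝒢.src q) :
    𝒢.comp (𝒢.inv (𝒢.comp h p hp)) (𝒢.comp h q hq) (by simp) =
      𝒢.comp (𝒢.inv p) q (by rw [tgt_inv, ← hp, hq]) := by
  apply 𝒢.comp_left_cancel (f := 𝒢.comp h p hp) (by simp) (by simp)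
  rw [comp_inv_comp_cancel (by simp), 𝒢.assoc _ _ _ hp (by simp)]
  exact 𝒢.comp_congr rfl (comp_inv_comp_cancel (hp.symm.trans hq)).symm _

variable {C D E : LcCat.{u}}

/-- The functor `η_C : C ⥤ L(G(C))`, `A ↦ [1_A]`, `h ↦ [h]`. -/
@[simps]
def eta (C : LcCat.{u}) : C.carrier ⥤ LObj (gGpd C) where
  obj A := ⟨GObj.mk (𝟙 A)⟩
  map {A B} h := (⟨GArr.mk (𝟙 A) h, rfl, GObj.mk_le_iff.2 ⟨h, Category.comp_id h⟩⟩ :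
    LHom (gGpd C) (GObj.mk (𝟙 A)) (GObj.mk (𝟙 B)))
  map_id A := rfl
  map_comp f g := by
    apply LHom.ext
    refine (lHom_comp_arr_mk _ _ rfl ?_).symm
    exact GArr.mk_le_iff.2 ⟨f, Category.comp_id f, rfl⟩

section Kappa

variable {𝒢 : OrderedGroupoid.{u}}

/-- The horizontal part of an arrow of `L(𝒢)`. -/
def lArr {A B : LObj 𝒢} (f : A ⟶ B) : 𝒢.Arr := LHom.arr f

theorem src_lArr {A B : LObj 𝒢} (f : A ⟶ B) : 𝒢.src (lArr f) = A.obj := LHom.src_eq f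

theorem tgt_lArr_le {A B : LObj 𝒢} (f : A ⟶ B) : 𝒢.tgt (lArr f) ≤ B.obj := LHom.tgt_le f

theorem lArr_comp {A B B' : LObj 𝒢} (f : A ⟶ B) (g : B ⟶ B') :
    lArr (f ≫ g) = 𝒢.comp (lArr f) (OrderedGroupoid.restrict (lArr g) (𝒢.tgt (lArr f))
      (LHom.tgt_le_src f g)) (OrderedGroupoid.src_restrict _ _ _).symm := rfl

theorem kappaObj_aux (s t : SubRep (lCat 𝒢)) (h : s ≤ t) :
    𝒢.tgt (lArr s.hom) ≤ 𝒢.tgt (lArr t.hom) := by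
  obtain ⟨h, m, m', rfl⟩ := h
  dsimp only
  erw [lArr_comp]
  rw [OrderedGroupoid.tgt_comp]
  exact OrderedGroupoid.tgt_restrict_le _ _ _

/-- The horizontal arrow `n m⁻¹` of `𝒢` determined by a span in `L(𝒢)`. -/
def kappaSpan (s : SpanRep (lCat 𝒢)) : 𝒢.Arr :=
  𝒢.comp (𝒢.inv (lArr s.fst)) (lArr s.snd)
    (by rw [OrderedGroupoid.tgt_inv]; exact (src_lArr s.fst).trans (src_lArr s.snd).symm)

theorem kappaArr_aux (s t : SpanRep (lCat 𝒢)) (h : s ≤ t) : kappaSpan s ≤ kappaSpan t := by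
  obtain ⟨h, m, n, m', n', w, w'⟩ := h
  have e : kappaSpan (⟨_, _, _, m, n⟩ : SpanRep (lCat 𝒢)) =
      𝒢.comp (𝒢.inv (OrderedGroupoid.restrict (lArr m') (𝒢.tgt (lArr h)) (LHom.tgt_le_src h m')))
        (OrderedGroupoid.restrict (lArr n') (𝒢.tgt (lArr h)) (LHom.tgt_le_src h n'))
        (by rw [OrderedGroupoid.tgt_inv]; exact (OrderedGroupoid.src_restrict _ _ _).trans
              (OrderedGroupoid.src_restrict _ _ _).symm) := by
    subst w
    subst w'
    exact OrderedGroupoid.inv_comp_comp (OrderedGroupoid.src_restrict _ _ _).symm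
      (OrderedGroupoid.src_restrict _ _ _).symm
  rw [e]
  exact 𝒢.comp_le_comp _ _ _ _ _ _ (𝒢.inv_le_inv _ _ (OrderedGroupoid.restrict_le _ _ _))
    (OrderedGroupoid.restrict_le _ _ _)

/-- The double functor `κ_𝒢 : G(L(𝒢)) → 𝒢`.  It sends the subobject represented by
`A → B' ≤ B` to `B'` and the span with horizontal parts `m`, `n` to `n m⁻¹`. -/
def kappa (𝒢 : OrderedGroupoid.{u}) : OrdFunctor (gGpd (lCat 𝒢)) 𝒢 where
  obj := Quotient.lift (fun s : SubRep (lCat 𝒢) => 𝒢.tgt (lArr s.hom))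
    fun s t h => le_antisymm (kappaObj_aux s t h.1) (kappaObj_aux t s h.2)
  arr := Quotient.lift kappaSpan
    fun s t h => le_antisymm (kappaArr_aux s t h.1) (kappaArr_aux t s h.2)
  src_arr f := by
    induction f using GArr.ind
    exact (𝒢.src_comp _ _ _).trans (𝒢.src_inv _)
  tgt_arr f := by
    induction f using GArr.ind
    exact 𝒢.tgt_comp _ _ _
  arr_one X := by
    induction X using GObj.ind
    exact 𝒢.inv_comp _
  arr_comp f g h := by
    obtain ⟨_, _, _, _, k, m, n, rfl, rfl⟩ := GArr.exists_rep f g h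
    refine (congrArg (Quotient.lift _ _) (GArr.comp_mk k m n h)).trans ?_
    have hk : 𝒢.src (lArr k) = 𝒢.src (lArr m) := (src_lArr k).trans (src_lArr m).symm
    have hn : 𝒢.src (lArr m) = 𝒢.src (lArr n) := (src_lArr m).trans (src_lArr n).symm
    change 𝒢.comp (𝒢.inv (lArr k)) (lArr n) (by simpa using hk.trans hn) =
      𝒢.comp (𝒢.comp (𝒢.inv (lArr k)) (lArr m) (by simpa using hk))
        (𝒢.comp (𝒢.inv (lArr m)) (lArr n) (by simpa using hn)) (by simp)
    rw [𝒢.assoc _ _ _ (by simpa using hk) (by simp)]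
    exact 𝒢.comp_congr rfl (OrderedGroupoid.comp_inv_comp_cancel hn).symm _
  arr_mono f g h := by
    induction f using GArr.ind
    induction g using GArr.ind
    exact kappaArr_aux _ _ h

end Kappa

/-! ### Left-cancellative Grothendieck sites -/

/-- For a diagram `K` in the domain of `F` and a cone `T` over `K ⋙ F`, the sieve of all arrows `h`
into the vertex of `T` such that `T` precomposed with `h` factors through the `F`-image of some cone
over `K`. -/
def factorSieve (F : C.carrier ⥤ D.carrier) {I : Type} [SmallCategory I] (K : I ⥤ C.carrier)
    (T : Limits.Cone (K ⋙ F)) : Sieve T.pt where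
  arrows V h := ∃ (S : Limits.Cone K) (g : V ⟶ F.obj S.pt),
    ∀ i, h ≫ T.π.app i = g ≫ F.map (S.π.app i)
  downward_closed := by
    rintro V W h ⟨S, g, hg⟩ k
    exact ⟨S, k ≫ g, fun i => by rw [Category.assoc, hg i, Category.assoc]⟩

/-- Covering-flat functors. -/
def CoveringFlat (J : GrothendieckTopology D.carrier) (F : C.carrier ⥤ D.carrier) : Prop :=
  ∀ (I : Type) [SmallCategory I] [FinCategory I] (K : I ⥤ C.carrier) (T : Limits.Cone (K ⋙ F)),
    factorSieve F K T ∈ J T.pt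

/-- A left-cancellative Grothendieck site. -/
structure LcGSite : Type (u + 1) where
  cat : LcCat.{u}
  topology : GrothendieckTopology cat.carrier

/-- Morphisms of left-cancellative Grothendieck sites: covering-preserving, covering-flat
functors. -/
structure IsGSiteMorphism (S S' : LcGSite.{u}) (F : S.cat.carrier ⥤ S'.cat.carrier) : Prop where
  coverPreserving : CoverPreserving S.topology S'.topology F
  coveringFlat : CoveringFlat S'.topology F

theorem IsGSiteMorphism.id (S : LcGSite.{u}) : IsGSiteMorphism S S (𝟭 S.cat.carrier) where
  coverPreserving := idCoverPreserving _
  coveringFlat I _ _ K T :=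
    S.topology.superset_covering (S := ⊤) (fun V h _ => ⟨T, h, fun _ => rfl⟩)
      (S.topology.top_mem _)

theorem IsGSiteMorphism.comp {S S' S'' : LcGSite.{u}} {F : S.cat.carrier ⥤ S'.cat.carrier}
    {F' : S'.cat.carrier ⥤ S''.cat.carrier} (hF : IsGSiteMorphism S S' F)
    (hF' : IsGSiteMorphism S' S'' F') : IsGSiteMorphism S S'' (F ⋙ F') where
  coverPreserving := hF.coverPreserving.comp _ _ hF'.coverPreserving
  coveringFlat I _ _ K T := by
    let T' : Limits.Cone ((K ⋙ F) ⋙ F') := T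
    refine S''.topology.transitive (hF'.coveringFlat I (K ⋙ F) T') _ fun V h hh => ?_
    obtain ⟨P, g, hg⟩ := hh
    refine S''.topology.superset_covering ?_ (S''.topology.pullback_stable g
      (hF'.coverPreserving.cover_preserve (hF.coveringFlat I K P)))
    rintro W k ⟨Z, s, r, ⟨Q, t, ht⟩, hr⟩
    refine ⟨Q, r ≫ F'.map t, fun i => ?_⟩
    have h1 : (k ≫ h) ≫ T.π.app i = k ≫ g ≫ F'.map (P.π.app i) := by
      rw [Category.assoc]; exact congrArg (k ≫ ·) (hg i)
    rw [h1, ← Category.assoc, hr, Category.assoc, Category.assoc, ← F'.map_comp, ht i, F'.map_comp]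
    rfl

/-! ### Ehresmann sites -/

section Ehresmann

variable {𝒢 ℋ 𝒦 : OrderedGroupoid.{u}}

/-- A vertical sieve on `A`: an order ideal of the poset of objects below `A`. -/
@[ext]
structure VSieve (𝒢 : OrderedGroupoid.{u}) (A : 𝒢.Obj) : Type u where
  carrier : Set 𝒢.Obj
  le : ∀ X ∈ carrier, X ≤ A
  downward_closed : ∀ X ∈ carrier, ∀ Y, Y ≤ X → Y ∈ carrier

/-- The trivial vertical sieve `↓A`. -/
def VSieve.top (A : 𝒢.Obj) : VSieve 𝒢 A where
  carrier := {X | X ≤ A}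
  le _ h := h
  downward_closed _ h _ h' := le_trans h' h

/-- The vertical sieve `f^*𝓑 = {A' ≤ A | cod (f|_{A'}) ∈ 𝓑}` on `A`, for `f : A → B' ≤ B`. -/
def VSieve.pullback {B : 𝒢.Obj} (𝓑 : VSieve 𝒢 B) {A : 𝒢.Obj} (f : LHom 𝒢 A B) : VSieve 𝒢 A where
  carrier := {A' | ∃ h : A' ≤ 𝒢.src f.arr, 𝒢.tgt (OrderedGroupoid.restrict f.arr A' h) ∈ 𝓑.carrier}
  le _ h := h.1.trans_eq f.src_eq
  downward_closed := by
    rintro X ⟨h, hX⟩ Y hY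
    refine ⟨hY.trans h, 𝓑.downward_closed _ hX _ ?_⟩
    have e : OrderedGroupoid.restrict f.arr Y (hY.trans h) = OrderedGroupoid.restrict
        (OrderedGroupoid.restrict f.arr X h) Y (by simpa using hY) :=
      OrderedGroupoid.eq_of_le_of_src (k := f.arr) (OrderedGroupoid.restrict_le _ _ _)
        ((OrderedGroupoid.restrict_le _ _ _).trans (OrderedGroupoid.restrict_le _ _ _)) (by simp)
    rw [e]
    exact OrderedGroupoid.tgt_restrict_le _ _ _

/-- An Ehresmann topology on an ordered groupoid. -/
structure EhresmannTopology (𝒢 : OrderedGroupoid.{u}) : Type u where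
  covers : ∀ A : 𝒢.Obj, Set (VSieve 𝒢 A)
  top_mem : ∀ A, VSieve.top A ∈ covers A
  pullback_mem : ∀ {A B : 𝒢.Obj} (𝓑 : VSieve 𝒢 B), 𝓑 ∈ covers B → ∀ f : LHom 𝒢 A B,
    𝓑.pullback f ∈ covers A
  transitive : ∀ {A : 𝒢.Obj} (𝒜 : VSieve 𝒢 A), 𝒜 ∈ covers A → ∀ 𝓑 : VSieve 𝒢 A,
    (∀ (X : 𝒢.Obj) (f : LHom 𝒢 X A), 𝒢.tgt f.arr ∈ 𝒜.carrier → 𝓑.pullback f ∈ covers X) →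
      𝓑 ∈ covers A

theorem EhresmannTopology.superset (T : EhresmannTopology 𝒢) {A : 𝒢.Obj} {𝒜 𝓑 : VSieve 𝒢 A}
    (h : 𝒜 ∈ T.covers A) (h' : 𝒜.carrier ⊆ 𝓑.carrier) : 𝓑 ∈ T.covers A := by
  refine T.transitive 𝒜 h 𝓑 fun X f hf => ?_
  have e : 𝓑.pullback f = VSieve.top X := by
    apply VSieve.ext
    ext Y
    refine ⟨fun hY => (𝓑.pullback f).le _ hY, fun hY => ?_⟩
    have hY' : Y ≤ 𝒢.src f.arr := by rw [f.src_eq]; exact hY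
    exact ⟨hY', 𝓑.downward_closed _ (h' hf) _ (OrderedGroupoid.tgt_restrict_le _ _ hY')⟩
  rw [e]
  exact T.top_mem X

/-- The vertical sieve generated by the image `F𝒜` of a vertical sieve `𝒜`. -/
def VSieve.map (F : OrdFunctor 𝒢 ℋ) {A : 𝒢.Obj} (𝒜 : VSieve 𝒢 A) : VSieve ℋ (F.obj A) where
  carrier := {Y | ∃ X ∈ 𝒜.carrier, Y ≤ F.obj X}
  le := by
    rintro Y ⟨X, hX, hY⟩
    exact hY.trans (F.obj_mono (𝒜.le X hX))
  downward_closed := by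
    rintro Y ⟨X, hX, hY⟩ Z hZ
    exact ⟨X, hX, hZ.trans hY⟩

/-- An hv-cone over a diagram `D : I → 𝒢` of ordered groupoids: an object `pt` with arrows
`pt → E_i ≤ D_i` such that, with `ξ_i` denoting the horizontal part of the leg at `i`, one has
`D_α|_{E_i} ∘ ξ_i = ξ_{i'}` for each horizontal arrow `α : i → i'`, and `ξ_i = ξ_{i'}` for each
vertical arrow `i ≤ i'`. -/
structure HVCone {I : OrderedGroupoid.{w}} (D : OrdFunctor I 𝒢) : Type (max u w) where
  pt : 𝒢.Obj
  leg : ∀ i : I.Obj, LHom 𝒢 pt (D.obj i)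
  horizontal : ∀ α : I.Arr,
    𝒢.comp (leg (I.src α)).arr
      (OrderedGroupoid.restrict (D.arr α) (𝒢.tgt (leg (I.src α)).arr)
        ((leg (I.src α)).tgt_le.trans_eq (D.src_arr α).symm))
      (OrderedGroupoid.src_restrict _ _ _).symm = (leg (I.tgt α)).arr
  vertical : ∀ i i' : I.Obj, i ≤ i' → (leg i).arr = (leg i').arr

/-- The arrow `U = U ≤ A` of `L(𝒢)`. -/
@[simps]
def LHom.ofLE {U A : 𝒢.Obj} (h : U ≤ A) : LHom 𝒢 U A :=
  ⟨𝒢.one U, 𝒢.src_one U, (𝒢.tgt_one U).trans_le h⟩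

/-- Covering-flat double functors.  The displayed equation compares two formal composites of a
horizontal and a vertical arrow: its left-hand side is `ξ_i|_{U'} : U' → E_i' ≤ F D_i`, its
right-hand side is `U' → T' → E_i' ≤ F D_i` with horizontal part `(F θ_i)|_{T'} ∘ h`. -/
def ECoveringFlat (T : EhresmannTopology ℋ) (F : OrdFunctor 𝒢 ℋ) : Prop :=
  ∀ (I : OrderedGroupoid.{0}) [Finite I.Obj] [Finite I.Arr] (D : OrdFunctor I 𝒢)
    (ξ : HVCone (D.comp F)), ∃ 𝒰 ∈ T.covers ξ.pt, ∀ (U' : ℋ.Obj) (hU' : U' ∈ 𝒰.carrier),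
      ∃ (θ : HVCone D) (h : LHom ℋ U' (F.obj θ.pt)), ∀ i : I.Obj,
        (LHom.ofLE (𝒰.le U' hU')).comp (ξ.leg i) = h.comp ((θ.leg i).map F)

/-- An Ehresmann site. -/
structure ESite : Type (u + 1) where
  gpd : OrderedGroupoid.{u}
  topology : EhresmannTopology gpd

/-- Morphisms of Ehresmann sites: covering-preserving, covering-flat double functors. -/
structure IsESiteMorphism (S S' : ESite.{u}) (F : OrdFunctor S.gpd S'.gpd) : Prop where
  coverPreserving : ∀ (A : S.gpd.Obj) (𝒜 : VSieve S.gpd A), 𝒜 ∈ S.topology.covers A →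
    𝒜.map F ∈ S'.topology.covers (F.obj A)
  coveringFlat : ECoveringFlat S'.topology F

theorem IsESiteMorphism.id (S : ESite.{u}) : IsESiteMorphism S S (OrdFunctor.id S.gpd) where
  coverPreserving A 𝒜 h := S.topology.superset h fun X hX => ⟨X, hX, le_rfl⟩
  coveringFlat I _ _ D ξ := ⟨VSieve.top ξ.pt, S.topology.top_mem _, fun U' hU' =>
    ⟨ξ, LHom.ofLE hU', fun i => rfl⟩⟩

theorem LHom.ofLE_comp_ofLE {U V A : 𝒢.Obj} (h : U ≤ V) (h' : V ≤ A) :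
    (LHom.ofLE h).comp (LHom.ofLE h') = LHom.ofLE (h.trans h') := by
  apply LHom.ext
  simp only [LHom.comp_arr, LHom.ofLE_arr]
  rw [𝒢.one_comp']
  exact OrderedGroupoid.restrict_eq _ (by simp) (by simpa using h)

/-- Every arrow of `L(𝒢)` factors through any object above its horizontal codomain. -/
def LHom.corestrict {U A B : 𝒢.Obj} (f : LHom 𝒢 U A) (h : 𝒢.tgt f.arr ≤ B) : LHom 𝒢 U B :=
  ⟨f.arr, f.src_eq, h⟩

theorem LHom.corestrict_comp {U A B : 𝒢.Obj} (f : LHom 𝒢 U A) (h : 𝒢.tgt f.arr ≤ B)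
    (h' : B ≤ A) : (f.corestrict h).comp (LHom.ofLE h') = f := by
  apply LHom.ext
  simp only [LHom.comp_arr, LHom.corestrict, LHom.ofLE_arr]
  have e : OrderedGroupoid.restrict (𝒢.one B) (𝒢.tgt f.arr) (by simpa using h) =
      𝒢.one (𝒢.tgt f.arr) := OrderedGroupoid.restrict_eq _ (by simp) (by simpa using h)
  rw [𝒢.comp_congr rfl e, 𝒢.comp_one']

theorem LHom.map_ofLE (F : OrdFunctor 𝒢 ℋ) {U A : 𝒢.Obj} (h : U ≤ A) :
    (LHom.ofLE h).map F = LHom.ofLE (F.obj_mono h) :=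
  LHom.ext (F.arr_one U)

theorem LHom.inv_exists {U A : 𝒢.Obj} (f : LHom 𝒢 U A) :
    ∃ g : LHom 𝒢 (𝒢.tgt f.arr) U, g.comp f = LHom.ofLE f.tgt_le := by
  refine ⟨⟨𝒢.inv f.arr, by simp, by simp⟩, ?_⟩
  apply LHom.ext
  simp only [LHom.comp_arr, LHom.ofLE_arr]
  have e : OrderedGroupoid.restrict f.arr (𝒢.tgt (𝒢.inv f.arr)) (by simp) = f.arr :=
    OrderedGroupoid.restrict_eq _ (by simp) le_rfl
  rw [𝒢.comp_congr rfl e, 𝒢.inv_comp]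

theorem IsESiteMorphism.comp {S S' S'' : ESite.{u}} {F : OrdFunctor S.gpd S'.gpd}
    {F' : OrdFunctor S'.gpd S''.gpd} (hF : IsESiteMorphism S S' F)
    (hF' : IsESiteMorphism S' S'' F') : IsESiteMorphism S S'' (F.comp F') where
  coverPreserving A 𝒜 h := by
    refine S''.topology.superset (hF'.coverPreserving _ _ (hF.coverPreserving A 𝒜 h)) ?_
    rintro Z ⟨Y, ⟨X, hX, hY⟩, hZ⟩
    exact ⟨X, hX, hZ.trans (F'.obj_mono hY)⟩
  coveringFlat I _ _ D ξ := by
    let ξ' : HVCone ((D.comp F).comp F') := ξ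
    obtain ⟨𝒰, h𝒰, H⟩ := hF'.coveringFlat I (D.comp F) ξ'
    let 𝒲 : VSieve S''.gpd ξ.pt :=
      { carrier := {W | ∃ (hW : W ≤ ξ.pt) (φ : HVCone D)
          (k : LHom S''.gpd W (F'.obj (F.obj φ.pt))), ∀ i : I.Obj,
          (LHom.ofLE hW).comp (ξ.leg i) = k.comp (((φ.leg i).map F).map F')}
        le := fun W hW => hW.1
        downward_closed := by
          rintro W ⟨hW, φ, k, hk⟩ V hV
          refine ⟨hV.trans hW, φ, (LHom.ofLE hV).comp k, fun i => ?_⟩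
          rw [← LHom.ofLE_comp_ofLE hV hW, LHom.comp_assoc, hk i, LHom.comp_assoc]
          rfl }
    refine ⟨𝒲, S''.topology.transitive 𝒰 h𝒰 𝒲 ?_, ?_⟩
    · intro X f hf
      obtain ⟨θ, h, hθ⟩ := H _ hf
      obtain ⟨𝒱, h𝒱, H'⟩ := hF.coveringFlat I D θ
      let f₁ : LHom S''.gpd X (S''.gpd.tgt f.arr) := f.corestrict le_rfl
      refine S''.topology.superset
        (S''.topology.pullback_mem _ (hF'.coverPreserving _ _ h𝒱) (f₁.comp h)) ?_
      rintro Y ⟨hY, V, hV, hYV⟩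
      have hYX : Y ≤ S''.gpd.src f.arr := by
        rw [f.src_eq]; exact hY.trans_eq (f₁.comp h).src_eq
      refine ⟨hYX, ?_⟩
      let p : LHom S''.gpd Y (S''.gpd.tgt (OrderedGroupoid.restrict f.arr Y hYX)) :=
        ⟨OrderedGroupoid.restrict f.arr Y hYX, OrderedGroupoid.src_restrict _ _ _, le_rfl⟩
      have hpf : S''.gpd.tgt (OrderedGroupoid.restrict f.arr Y hYX) ≤ S''.gpd.tgt f.arr :=
        OrderedGroupoid.tgt_restrict_le _ _ _
      obtain ⟨q, hq⟩ := p.inv_exists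
      have hYX' : Y ≤ X := hYX.trans_eq f.src_eq
      have hp : p.comp (LHom.ofLE hpf) = (LHom.ofLE hYX').comp f₁ := by
        apply LHom.ext
        simp only [LHom.comp_arr, LHom.ofLE_arr, p, f₁, LHom.corestrict]
        rw [S''.gpd.comp_congr rfl (OrderedGroupoid.restrict_eq (g := S''.gpd.one
            (S''.gpd.tgt (OrderedGroupoid.restrict f.arr Y hYX))) _ (by simp) (by simpa using hpf)),
          S''.gpd.comp_one', S''.gpd.one_comp']
        exact (OrderedGroupoid.restrict_eq _ (by simp) (OrderedGroupoid.restrict_le _ _ _)).symm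
      let r₀ := (LHom.ofLE hYX').comp (f₁.comp h)
      have hr₀ : S''.gpd.tgt r₀.arr ≤ F'.obj V := by
        refine le_of_eq_of_le ?_ hYV
        simp only [r₀, LHom.comp_arr (LHom.ofLE hYX'), OrderedGroupoid.tgt_comp, LHom.ofLE_arr,
          OrderedGroupoid.tgt_one]
      obtain ⟨φ, t, ht⟩ := H' V hV
      refine ⟨hpf.trans (f.tgt_le), φ, q.comp ((r₀.corestrict hr₀).comp (t.map F')), fun i => ?_⟩
      have h1 : ∀ {B : S''.gpd.Obj} (a : LHom S''.gpd (S''.gpd.tgt f.arr) B),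
          (LHom.ofLE hpf).comp a = q.comp ((LHom.ofLE hYX').comp (f₁.comp a)) := by
        intro B a
        rw [← LHom.comp_assoc (LHom.ofLE hYX'), ← hp, LHom.comp_assoc, ← LHom.comp_assoc q, hq]
        change _ = (LHom.id _).comp _
        rw [LHom.id_comp]
      rw [← LHom.ofLE_comp_ofLE hpf f.tgt_le, LHom.comp_assoc]
      refine (congrArg (LHom.ofLE hpf).comp (hθ i)).trans
        ((h1 (h.comp ((θ.leg i).map F'))).trans ?_)
      rw [← LHom.comp_assoc f₁, ← LHom.comp_assoc (LHom.ofLE hYX'), LHom.comp_assoc q,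
        LHom.comp_assoc (r₀.corestrict hr₀)]
      change q.comp (r₀.comp ((θ.leg i).map F')) = _
      rw [← LHom.map_comp]
      refine Eq.trans ?_ (congrArg (fun a => q.comp ((r₀.corestrict hr₀).comp (LHom.map F' a)))
        (ht i))
      refine Eq.trans ?_ (congrArg (fun a => q.comp ((r₀.corestrict hr₀).comp a))
        (LHom.map_comp F' _ (θ.leg i)).symm)
      rw [LHom.map_ofLE, ← LHom.comp_assoc (r₀.corestrict hr₀), LHom.corestrict_comp]
    · rintro W ⟨hW, φ, k, hk⟩
      exact ⟨φ, k, hk⟩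

end Ehresmann

end

section

/-! ### The Grothendieck topology on `L(𝒢)` -/

section LTopology

variable {𝒢 : OrderedGroupoid.{u}}

theorem LHom.corestrict_comp_ofLE {A B : 𝒢.Obj} (f : LHom 𝒢 A B) :
    (f.corestrict le_rfl).comp (LHom.ofLE f.tgt_le) = f :=
  f.corestrict_comp le_rfl f.tgt_le

/-- A sieve in `L(𝒢)` contains `A → B' ≤ B` if and only if it contains `B' = B' ≤ B`. -/
theorem sieve_ofLE_iff {A B : LObj 𝒢} (S : Sieve B) (f : A ⟶ B) :
    S.arrows (Y := ⟨𝒢.tgt (lArr f)⟩) (LHom.ofLE (tgt_lArr_le f)) ↔ S.arrows f := by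
  constructor
  · intro h
    have := S.downward_closed h (Z := A) (LHom.corestrict f le_rfl)
    have e := LHom.corestrict_comp_ofLE f
    exact e ▸ this
  · intro h
    obtain ⟨q, hq⟩ := LHom.inv_exists f
    have := S.downward_closed h (Z := ⟨𝒢.tgt (lArr f)⟩) q
    exact hq ▸ this

/-- The vertical sieve `{A' ≤ A}` of all codomains of the horizontal parts of the members
`B → A' ≤ A` of a sieve on `A` in `L(𝒢)`. -/
def verticalPart {A : LObj 𝒢} (S : Sieve A) : VSieve 𝒢 A.obj where
  carrier := {A' | ∃ (B : LObj 𝒢) (f : B ⟶ A), S.arrows f ∧ 𝒢.tgt (lArr f) = A'}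
  le := by
    rintro _ ⟨B, f, -, rfl⟩
    exact tgt_lArr_le f
  downward_closed := by
    rintro _ ⟨B, f, hf, rfl⟩ Y hY
    refine ⟨⟨Y⟩, LHom.ofLE (hY.trans (tgt_lArr_le f)), ?_, 𝒢.tgt_one Y⟩
    have := S.downward_closed ((sieve_ofLE_iff S f).2 hf) (Z := ⟨Y⟩) (LHom.ofLE hY)
    have e := LHom.ofLE_comp_ofLE hY (tgt_lArr_le f)
    exact e ▸ this

theorem mem_verticalPart {A B : LObj 𝒢} (S : Sieve A) (f : B ⟶ A) :
    𝒢.tgt (lArr f) ∈ (verticalPart S).carrier ↔ S.arrows f := by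
  constructor
  · rintro ⟨B', f', hf', e⟩
    rw [← sieve_ofLE_iff] at hf' ⊢
    have key : ∀ (X Y : 𝒢.Obj) (hX : X ≤ A.obj) (hY : Y ≤ A.obj), X = Y →
        S.arrows (Y := ⟨X⟩) (LHom.ofLE hX) → S.arrows (Y := ⟨Y⟩) (LHom.ofLE hY) := by
      rintro X _ hX hY rfl h
      exact h
    exact key _ _ _ _ e hf'
  · intro h
    exact ⟨B, f, h, rfl⟩

theorem verticalPart_pullback {A B : LObj 𝒢} (S : Sieve A) (f : B ⟶ A) :
    verticalPart (S.pullback f) = (verticalPart S).pullback f := by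
  have harr : ∀ (Y : 𝒢.Obj) (h : Y ≤ B.obj) (h' : Y ≤ 𝒢.src (lArr f)),
      LHom.arr ((LHom.ofLE h).comp f) = OrderedGroupoid.restrict (lArr f) Y h' := by
    intro Y h h'
    rw [LHom.comp_arr]
    refine (𝒢.one_comp' _).trans ?_
    exact (OrderedGroupoid.restrict_eq _ (by simp) (OrderedGroupoid.restrict_le _ _ _))
  have hmem : ∀ (Y : 𝒢.Obj) (h : Y ≤ B.obj) (R : Sieve B),
      Y ∈ (verticalPart R).carrier ↔ R.arrows (Y := ⟨Y⟩) (LHom.ofLE h) := by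
    intro Y h R
    rw [← mem_verticalPart]
    have : 𝒢.tgt (lArr (A := ⟨Y⟩) (B := B) (LHom.ofLE h)) = Y := 𝒢.tgt_one Y
    rw [this]
  apply VSieve.ext
  ext Y
  constructor
  · intro hY
    have h := (verticalPart (S.pullback f)).le Y hY
    have h' : Y ≤ 𝒢.src (lArr f) := h.trans_eq (src_lArr f).symm
    refine ⟨h', ?_⟩
    have h1 := (mem_verticalPart S _).2 ((hmem Y h _).1 hY)
    have e := congrArg 𝒢.tgt (harr Y h h')
    exact e ▸ h1
  · rintro ⟨h', h1⟩
    have h : Y ≤ B.obj := h'.trans_eq (src_lArr f)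
    refine (hmem Y h _).2 ((mem_verticalPart S _).1 ?_)
    have e := congrArg 𝒢.tgt (harr Y h h')
    exact e.symm ▸ h1

/-- The Grothendieck topology `J_T` on `L(𝒢)`. -/
def lTopology (T : EhresmannTopology 𝒢) : GrothendieckTopology (LObj 𝒢) where
  sieves A := {S | verticalPart S ∈ T.covers A.obj}
  top_mem' A := by
    refine T.superset (T.top_mem A.obj) fun Y hY => ?_
    exact ⟨⟨Y⟩, LHom.ofLE hY, trivial, 𝒢.tgt_one Y⟩
  pullback_stable' X Y S f hS := by
    have h := T.pullback_mem _ hS f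
    rw [← verticalPart_pullback] at h
    exact h
  transitive' X S hS R hR := by
    refine T.transitive _ hS _ fun Y f hf => ?_
    have h := hR (Y := ⟨Y⟩) ((mem_verticalPart S (B := ⟨Y⟩) f).1 hf)
    have e := verticalPart_pullback (B := ⟨Y⟩) R f
    exact e ▸ h

end LTopology

/-! ### The Ehresmann topology on `G(C)` -/

section GTopology

variable {C : LcCat.{u}}

/-- The vertical sieve `[mS] = {[mn] ≤ [m] | n ∈ S}`. -/
def imageSieve {A B : C.carrier} (m : A ⟶ B) (S : Sieve A) : VSieve (gGpd C) (GObj.mk m) where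
  carrier := {X | ∃ (A' : C.carrier) (n : A' ⟶ A), S.arrows n ∧ X = GObj.mk (n ≫ m)}
  le := by
    rintro _ ⟨A', n, -, rfl⟩
    exact GObj.mk_le_iff.2 ⟨n, rfl⟩
  downward_closed := by
    rintro _ ⟨A', n, hn, rfl⟩ Y hY
    obtain ⟨A'', k, rfl⟩ := GObj.exists_of_le_mk hY
    exact ⟨A'', k ≫ n, S.downward_closed hn k, by rw [Category.assoc]⟩

/-- The sieve of all `n` with `[mn] ∈ 𝒱`. -/
def preimageSieve {A B : C.carrier} (m : A ⟶ B) (𝒱 : VSieve (gGpd C) (GObj.mk m)) : Sieve A where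
  arrows _ n := GObj.mk (n ≫ m) ∈ 𝒱.carrier
  downward_closed {Y Z n} hn k :=
    𝒱.downward_closed _ hn _ (GObj.mk_le_iff.2 ⟨k, by rw [Category.assoc]⟩)

theorem imageSieve_preimageSieve {A B : C.carrier} (m : A ⟶ B)
    (𝒱 : VSieve (gGpd C) (GObj.mk m)) : imageSieve m (preimageSieve m 𝒱) = 𝒱 := by
  apply VSieve.ext
  ext X
  constructor
  · rintro ⟨A', n, hn, rfl⟩
    exact hn
  · intro hX
    obtain ⟨A', n, rfl⟩ := GObj.exists_of_le_mk (𝒱.le X hX)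
    exact ⟨A', n, hX, rfl⟩

/-- The collection `{[mS] | S ∈ J(A)}` of vertical sieves on `[m : A ⟶ B]`. -/
def gCovers (J : GrothendieckTopology C.carrier) (X : (gGpd C).Obj) : Set (VSieve (gGpd C) X) :=
  {𝒱 | ∃ (A B : C.carrier) (m : A ⟶ B) (S : Sieve A), S ∈ J A ∧ X = GObj.mk m ∧
    𝒱.carrier = (imageSieve m S).carrier}

theorem mem_gCovers_iff (J : GrothendieckTopology C.carrier) {A B : C.carrier} (m : A ⟶ B)
    (𝒱 : VSieve (gGpd C) (GObj.mk m)) : 𝒱 ∈ gCovers J (GObj.mk m) ↔ preimageSieve m 𝒱 ∈ J A := by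
  constructor
  · rintro ⟨A', B', m', S, hS, e, h𝒱⟩
    obtain ⟨rfl, -⟩ := GObj.mk_le_cases (m := m) (m' := m') (le_of_eq e)
    obtain ⟨k, hk⟩ := gObj_mk_eq_iff.1 e
    refine J.superset_covering ?_ (J.pullback_stable k.hom hS)
    intro Z n hn
    change GObj.mk (n ≫ m) ∈ 𝒱.carrier
    rw [h𝒱]
    exact ⟨Z, n ≫ k.hom, hn, by rw [Category.assoc, hk]⟩
  · intro h
    exact ⟨A, B, m, _, h, rfl, by rw [imageSieve_preimageSieve]⟩

theorem preimageSieve_pullback {A B P : C.carrier} (p : A ⟶ P) {A' : C.carrier} (m : A' ⟶ B)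
    (k : A ⟶ A') (f : LHom (gGpd C) (GObj.mk p) (GObj.mk m)) (hf : f.arr = GArr.mk p (k ≫ m))
    (𝒱 : VSieve (gGpd C) (GObj.mk m)) :
    preimageSieve p (𝒱.pullback f) = (preimageSieve m 𝒱).pullback k := by
  ext Z n
  have h : GObj.mk (n ≫ p) ≤ (gGpd C).src f.arr := by
    rw [f.src_eq]; exact GObj.mk_le_iff.2 ⟨n, rfl⟩
  have e : OrderedGroupoid.restrict f.arr (GObj.mk (n ≫ p)) h =
      GArr.mk (n ≫ p) ((n ≫ k) ≫ m) := by
    refine OrderedGroupoid.restrict_eq _ rfl ?_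
    rw [hf]
    exact GArr.mk_le_iff.2 ⟨n, rfl, by rw [Category.assoc]⟩
  constructor
  · rintro ⟨h', hn⟩
    rw [e] at hn
    exact hn
  · intro hn
    refine ⟨h, ?_⟩
    rw [e]
    exact hn

/-- The Ehresmann topology `T_J` on `G(C)`, with `T_J([m : A ⟶ B]) = {[mS] | S ∈ J(A)}`. -/
def gTopology (J : GrothendieckTopology C.carrier) : EhresmannTopology (gGpd C) where
  covers X := gCovers J X
  top_mem X := by
    induction X using GObj.ind with
    | h m =>
    refine (mem_gCovers_iff J m _).2 (J.superset_covering (S := ⊤) ?_ (J.top_mem _))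
    intro Z n _
    exact GObj.mk_le_iff.2 ⟨n, rfl⟩
  pullback_mem {X Y} 𝒱 h𝒱 f := by
    induction Y using GObj.ind with
    | h m =>
    obtain ⟨f, rfl, hf⟩ := f
    induction f using GArr.ind with
    | h p q =>
    have hf' : GObj.mk q ≤ GObj.mk m := hf
    obtain ⟨e, k, hk⟩ := GObj.mk_le_cases hf'
    subst e
    have hk' : k ≫ m = q := by rw [← hk]; simp
    refine (mem_gCovers_iff J p _).2 ?_
    have h := preimageSieve_pullback p m k ⟨GArr.mk p q, rfl, hf⟩ (by rw [hk']) 𝒱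
    refine (congrArg (· ∈ J _) h).mpr ?_
    exact J.pullback_stable k ((mem_gCovers_iff J m _).1 h𝒱)
  transitive {X} 𝒜 h𝒜 𝓑 h := by
    induction X using GObj.ind with
    | h m =>
    rw [mem_gCovers_iff] at h𝒜 ⊢
    refine J.transitive h𝒜 _ fun Z n hn => ?_
    have hle : GObj.mk (n ≫ m) ≤ GObj.mk m := GObj.mk_le_iff.2 ⟨n, rfl⟩
    have := (mem_gCovers_iff J (n ≫ m) _).1 (h _ (LHom.ofLE (𝒢 := gGpd C) hle)
      (by
        have e : (gGpd C).tgt (LHom.ofLE (𝒢 := gGpd C) hle).arr = GObj.mk (n ≫ m) :=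
          (gGpd C).tgt_one (GObj.mk (n ≫ m))
        rw [e]; exact hn))
    rw [preimageSieve_pullback (n ≫ m) m n (LHom.ofLE (𝒢 := gGpd C) hle) rfl] at this
    exact this

end GTopology

/-! ### Maximal objects -/

/-- Every object is less than or equal to a unique maximal object. -/
def HasMaximalObjects (𝒢 : OrderedGroupoid.{u}) : Prop :=
  ∀ X : 𝒢.Obj, ∃! M : 𝒢.Obj, X ≤ M ∧ IsMax M

theorem gGpd_hasMaximalObjects (C : LcCat.{u}) : HasMaximalObjects (gGpd C) := by
  have key : ∀ (B : C.carrier) (Y : (gGpd C).Obj), GObj.mk (𝟙 B) ≤ Y → Y ≤ GObj.mk (𝟙 B) := by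
    intro B Y h
    induction Y using GObj.ind with
    | h n =>
    obtain ⟨rfl, -⟩ := GObj.mk_le_cases h
    exact GObj.mk_le_iff.2 ⟨n, Category.comp_id n⟩
  intro X
  induction X using GObj.ind with
  | @h A B m =>
  have hm : ∀ {A' : C.carrier} (n : A' ⟶ B), GObj.mk n ≤ GObj.mk (𝟙 B) := fun n =>
    GObj.mk_le_iff.2 ⟨n, Category.comp_id n⟩
  refine ⟨GObj.mk (𝟙 B), ⟨hm m, fun Y h => key B Y h⟩, ?_⟩
  rintro Y ⟨h, hmax⟩
  induction Y using GObj.ind with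
  | h n =>
  obtain ⟨rfl, -⟩ := GObj.mk_le_cases h
  exact le_antisymm (hm n) (hmax (hm n))

end

section

/-! ### Locally full sub-2-categories -/

/-- A family of objects `obj x` of a bicategory together with a class of 1-cells between them which
is closed under identities and composition. -/
structure OneCells (B : Type u₁) [Bicategory.{w₁, v₁} B] (X : Type u₂) where
  obj : X → B
  mem : ∀ {x y : X}, (obj x ⟶ obj y) → Prop
  id_mem : ∀ x : X, mem (𝟙 (obj x))
  comp_mem : ∀ {x y z : X} {f : obj x ⟶ obj y} {g : obj y ⟶ obj z},
    mem f → mem g → mem (f ≫ g)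

namespace OneCells

variable {B : Type u₁} [Bicategory.{w₁, v₁} B] {X : Type u₂} (P : OneCells B X)

/-- The 1-cells `x ⟶ y`: those 1-cells `obj x ⟶ obj y` that belong to the given class. -/
@[ext]
structure Hom (x y : X) : Type v₁ where
  val : P.obj x ⟶ P.obj y
  property : P.mem val

variable {P}

/-- The 2-cells between two 1-cells of the class: all 2-cells of the ambient bicategory. -/
@[ext]
structure Hom₂ {x y : X} (f g : P.Hom x y) : Type w₁ where
  val : f.val ⟶ g.val

instance homCategory (x y : X) : Category.{w₁} (P.Hom x y) where
  Hom f g := Hom₂ f g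
  id f := ⟨𝟙 f.val⟩
  comp η θ := ⟨η.val ≫ θ.val⟩

theorem hom₂_ext {x y : X} {f g : P.Hom x y} {η θ : f ⟶ g} (h : η.val = θ.val) : η = θ :=
  Hom₂.ext h

theorem id_val {x y : X} (f : P.Hom x y) : (𝟙 f : f ⟶ f).val = 𝟙 f.val := rfl

theorem comp_val {x y : X} {f g h : P.Hom x y} (η : f ⟶ g) (θ : g ⟶ h) :
    (η ≫ θ).val = η.val ≫ θ.val := rfl

/-- Invertible 2-cells are inherited from the ambient bicategory. -/
def isoMk {x y : X} {f g : P.Hom x y} (φ : f.val ≅ g.val) : f ≅ g where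
  hom := ⟨φ.hom⟩
  inv := ⟨φ.inv⟩
  hom_inv_id := hom₂_ext φ.hom_inv_id
  inv_hom_id := hom₂_ext φ.inv_hom_id

theorem eqToHom_val {x y : X} {f g : P.Hom x y} (h : f = g) :
    (eqToHom h).val = eqToHom (congrArg Hom.val h) := by
  subst h; rfl

variable (P)

/-- The locally full sub-bicategory on a class of 1-cells. -/
abbrev bicategory : Bicategory.{w₁, v₁} X where
  Hom x y := P.Hom x y
  id x := ⟨𝟙 (P.obj x), P.id_mem x⟩
  comp f g := ⟨f.val ≫ g.val, P.comp_mem f.property g.property⟩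
  homCategory x y := homCategory x y
  whiskerLeft f _ _ η := ⟨f.val ◁ η.val⟩
  whiskerRight η g := ⟨η.val ▷ g.val⟩
  associator f g h := isoMk (α_ f.val g.val h.val)
  leftUnitor f := isoMk (λ_ f.val)
  rightUnitor f := isoMk (ρ_ f.val)
  whiskerLeft_id f g := hom₂_ext (Bicategory.whiskerLeft_id f.val g.val)
  whiskerLeft_comp f _ _ _ η θ := hom₂_ext (Bicategory.whiskerLeft_comp f.val η.val θ.val)
  id_whiskerLeft η := hom₂_ext (Bicategory.id_whiskerLeft η.val)
  comp_whiskerLeft f g _ _ η := hom₂_ext (Bicategory.comp_whiskerLeft f.val g.val η.val)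
  id_whiskerRight f g := hom₂_ext (Bicategory.id_whiskerRight f.val g.val)
  comp_whiskerRight η θ g := hom₂_ext (Bicategory.comp_whiskerRight η.val θ.val g.val)
  whiskerRight_id η := hom₂_ext (Bicategory.whiskerRight_id η.val)
  whiskerRight_comp η f g := hom₂_ext (Bicategory.whiskerRight_comp η.val f.val g.val)
  whisker_assoc f _ _ η g := hom₂_ext (Bicategory.whisker_assoc f.val η.val g.val)
  whisker_exchange η θ := hom₂_ext (Bicategory.whisker_exchange η.val θ.val)
  pentagon f g h i := hom₂_ext (Bicategory.pentagon f.val g.val h.val i.val)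
  triangle f g := hom₂_ext (Bicategory.triangle f.val g.val)

theorem strict [Bicategory.Strict B] : @Bicategory.Strict X P.bicategory :=
  letI := P.bicategory
  { id_comp := fun f => Hom.ext (Bicategory.Strict.id_comp f.val)
    comp_id := fun f => Hom.ext (Bicategory.Strict.comp_id f.val)
    assoc := fun f g h => Hom.ext (Bicategory.Strict.assoc f.val g.val h.val)
    leftUnitor_eqToIso := fun f => Iso.ext (hom₂_ext (by
      rw [eqToIso.hom, eqToHom_val]
      exact congrArg Iso.hom (Bicategory.Strict.leftUnitor_eqToIso f.val)))
    rightUnitor_eqToIso := fun f => Iso.ext (hom₂_ext (by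
      rw [eqToIso.hom, eqToHom_val]
      exact congrArg Iso.hom (Bicategory.Strict.rightUnitor_eqToIso f.val)))
    associator_eqToIso := fun f g h => Iso.ext (hom₂_ext (by
      rw [eqToIso.hom, eqToHom_val]
      exact congrArg Iso.hom (Bicategory.Strict.associator_eqToIso f.val g.val h.val))) }

end OneCells

/-! ### The 2-categories of sites -/

/-- The class of morphisms of left-cancellative Grothendieck sites. -/
def gSiteCells : OneCells LcCat.{u} LcGSite.{u} where
  obj S := S.cat
  mem {S S'} F := IsGSiteMorphism S S' F
  id_mem S := IsGSiteMorphism.id S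
  comp_mem hf hg := IsGSiteMorphism.comp hf hg

/-- The 2-category of left-cancellative Grothendieck sites, covering-preserving covering-flat
functors and natural transformations. -/
instance : Bicategory LcGSite.{u} := gSiteCells.bicategory

instance : Bicategory.Strict LcGSite.{u} := gSiteCells.strict

/-- An Ehresmann site with maximal objects. -/
structure ESiteMax : Type (u + 1) extends ESite.{u} where
  hasMaximalObjects : HasMaximalObjects gpd

/-- The class of morphisms of Ehresmann sites with maximal objects. -/
def eSiteCells : OneCells OrderedGroupoid.{u} ESiteMax.{u} where
  obj S := S.gpd
  mem {S S'} F := IsESiteMorphism S.toESite S'.toESite F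
  id_mem S := IsESiteMorphism.id S.toESite
  comp_mem hf hg := IsESiteMorphism.comp hf hg

/-- The 2-category of Ehresmann sites with maximal objects, covering-preserving covering-flat double
functors and `Λ`-transformations. -/
instance : Bicategory ESiteMax.{u} := eSiteCells.bicategory

instance : Bicategory.Strict ESiteMax.{u} := eSiteCells.strict

/-- The Ehresmann site `(G(C), T_J)`. -/
def gSite (S : LcGSite.{u}) : ESiteMax.{u} where
  gpd := gGpd S.cat
  topology := gTopology S.topology
  hasMaximalObjects := gGpd_hasMaximalObjects S.cat

/-- The left-cancellative Grothendieck site `(L(𝒢), J_T)`. -/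
def lSite (E : ESite.{u}) : LcGSite.{u} where
  cat := lCat E.gpd
  topology := lTopology E.topology

section Strict

variable {B : Type u₁} [Bicategory.{w₁, v₁} B] {C : Type u₂} [Bicategory.{w₂, v₂} C]

theorem map₂_whiskerLeft_strict (F : StrictPseudofunctor B C) {a b c : B} (f : a ⟶ b)
    {g g' : b ⟶ c} (η : g ⟶ g') :
    F.map₂ (f ◁ η) = eqToHom (F.map_comp f g) ≫ F.map f ◁ F.map₂ η ≫
      eqToHom (F.map_comp f g').symm := by
  rw [F.map₂_whisker_left, F.mapComp_eq_eqToIso, F.mapComp_eq_eqToIso]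
  rfl

theorem map₂_whiskerRight_strict (F : StrictPseudofunctor B C) {a b c : B} {f f' : a ⟶ b}
    (η : f ⟶ f') (g : b ⟶ c) :
    F.map₂ (η ▷ g) = eqToHom (F.map_comp f g) ≫ F.map₂ η ▷ F.map g ≫
      eqToHom (F.map_comp f' g).symm := by
  rw [F.map₂_whisker_right, F.mapComp_eq_eqToIso, F.mapComp_eq_eqToIso]
  rfl

end Strict

/-- The 2-functor between the 2-categories of sites given by `G`, provided that `G` sends morphisms
of sites to morphisms of sites. -/
def gSiteFunctor (hG : ∀ {S S' : LcGSite.{u}} (F : S.cat ⟶ S'.cat), IsGSiteMorphism S S' F →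
    IsESiteMorphism (gSite S).toESite (gSite S').toESite (G.map F)) :
    StrictPseudofunctor LcGSite.{u} ESiteMax.{u} :=
  StrictPseudofunctor.mk''
    { obj := gSite
      map := fun F => ⟨G.map F.val, hG F.val F.property⟩
      map₂ := fun θ => ⟨G.map₂ θ.val⟩
      map₂_id := fun F => OneCells.hom₂_ext (G.map₂_id F.val)
      map₂_comp := fun θ θ' => OneCells.hom₂_ext (G.map₂_comp θ.val θ'.val)
      map_id := fun S => OneCells.Hom.ext (G.map_id S.cat)
      map_comp := fun F F' => OneCells.Hom.ext (G.map_comp F.val F'.val)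
      map₂_whisker_left := fun F F' F'' θ => OneCells.hom₂_ext (by
        rw [OneCells.comp_val, OneCells.comp_val, OneCells.eqToHom_val, OneCells.eqToHom_val]
        exact map₂_whiskerLeft_strict G F.val θ.val)
      map₂_whisker_right := fun θ F => OneCells.hom₂_ext (by
        rw [OneCells.comp_val, OneCells.comp_val, OneCells.eqToHom_val, OneCells.eqToHom_val]
        exact map₂_whiskerRight_strict G θ.val F.val) }

/-- The 2-functor between the 2-categories of sites given by `L`, provided that `L` sends morphisms
of sites to morphisms of sites. -/
def lSiteFunctor (hL : ∀ {E E' : ESiteMax.{u}} (M : E.gpd ⟶ E'.gpd),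
    IsESiteMorphism E.toESite E'.toESite M →
      IsGSiteMorphism (lSite E.toESite) (lSite E'.toESite) (L.map M)) :
    StrictPseudofunctor ESiteMax.{u} LcGSite.{u} :=
  StrictPseudofunctor.mk''
    { obj := fun E => lSite E.toESite
      map := fun M => ⟨L.map M.val, hL M.val M.property⟩
      map₂ := fun β => ⟨L.map₂ β.val⟩
      map₂_id := fun M => OneCells.hom₂_ext (L.map₂_id M.val)
      map₂_comp := fun β γ => OneCells.hom₂_ext (L.map₂_comp β.val γ.val)
      map_id := fun E => OneCells.Hom.ext (L.map_id E.gpd)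
      map_comp := fun M M' => OneCells.Hom.ext (L.map_comp M.val M'.val)
      map₂_whisker_left := fun M M' M'' β => OneCells.hom₂_ext (by
        rw [OneCells.comp_val, OneCells.comp_val, OneCells.eqToHom_val, OneCells.eqToHom_val]
        exact map₂_whiskerLeft_strict L M.val β.val)
      map₂_whisker_right := fun β M => OneCells.hom₂_ext (by
        rw [OneCells.comp_val, OneCells.comp_val, OneCells.eqToHom_val, OneCells.eqToHom_val]
        exact map₂_whiskerRight_strict L β.val M.val) }

/-! ### 2-adjoint biequivalences -/

section Adjunction

variable {B : Type u₁} [Bicategory.{w₁, v₁} B] {C : Type u₂} [Bicategory.{w₂, v₂} C]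

/-- (Strict) 2-natural transformations between 2-functors. -/
structure TwoNatTrans (F F' : StrictPseudofunctor B C) where
  app : ∀ a : B, F.obj a ⟶ F'.obj a
  naturality : ∀ {a b : B} (f : a ⟶ b), F.map f ≫ app b = app a ≫ F'.map f
  naturality₂ : ∀ {a b : B} {f g : a ⟶ b} (η : f ⟶ g),
    F.map₂ η ▷ app b ≫ eqToHom (naturality g) = eqToHom (naturality f) ≫ app a ◁ F'.map₂ η

/-- A (strict) 2-adjunction `F ⊣ U` between 2-functors. -/
structure TwoAdjunction (F : StrictPseudofunctor B C) (U : StrictPseudofunctor C B) where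
  unit : TwoNatTrans (StrictPseudofunctor.id B) (F.comp U)
  counit : TwoNatTrans (U.comp F) (StrictPseudofunctor.id C)
  left_triangle : ∀ a : B, F.map (unit.app a) ≫ counit.app (F.obj a) = 𝟙 (F.obj a)
  right_triangle : ∀ c : C, unit.app (U.obj c) ≫ U.map (counit.app c) = 𝟙 (U.obj c)

/-- A 1-cell is an internal equivalence when it has a pseudo-inverse. -/
def IsInternalEquivalence {a b : B} (f : a ⟶ b) : Prop :=
  ∃ g : b ⟶ a, Nonempty (f ≫ g ≅ 𝟙 a) ∧ Nonempty (g ≫ f ≅ 𝟙 b)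

/-- A 2-adjunction is a 2-adjoint biequivalence when all components of its unit and of its counit
are internal equivalences. -/
def TwoAdjunction.IsBiequivalence {F : StrictPseudofunctor B C} {U : StrictPseudofunctor C B}
    (A : TwoAdjunction F U) : Prop :=
  (∀ a : B, IsInternalEquivalence (A.unit.app a)) ∧
    ∀ c : C, IsInternalEquivalence (A.counit.app c)

end Adjunction

end

end

end EhresmannSite

namespace EhresmannSite

noncomputable section

/-! ### Covering-flat functors of left-cancellative sites -/

section Flat

variable {C D : LcCat.{u}}

theorem coveringFlat_of_isEquivalence (J : GrothendieckTopology D.carrier)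
    (F : C.carrier ⥤ D.carrier) [F.IsEquivalence] : CoveringFlat J F := by
  intro I _ _ K T
  refine J.superset_covering (S := ⊤) (fun V h _ => ?_) (J.top_mem _)
  let e := F.objObjPreimageIso V
  let S : Limits.Cone K :=
    { pt := F.objPreimage V
      π :=
        { app := fun i => F.preimage (e.hom ≫ h ≫ T.π.app i)
          naturality := fun i j f => F.map_injective (by
            have := T.w f
            dsimp at this ⊢
            simp [this]) } }
  exact ⟨S, e.inv, fun i => by simp [S]⟩

theorem CoveringFlat.of_iso {J : GrothendieckTopology D.carrier} {F F' : C.carrier ⥤ D.carrier}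
    (h : CoveringFlat J F) (e : F ≅ F') : CoveringFlat J F' := by
  intro I _ _ K T
  let T' : Limits.Cone (K ⋙ F) :=
    { pt := T.pt
      π :=
        { app := fun i => T.π.app i ≫ e.inv.app (K.obj i)
          naturality := fun i j f => by
            have := T.w f
            dsimp at this ⊢
            rw [Category.id_comp, ← this, Category.assoc, Category.assoc, e.inv.naturality] } }
  refine J.superset_covering ?_ (h I K T')
  rintro V k ⟨S, g, hg⟩
  refine ⟨S, g ≫ e.hom.app S.pt, fun i => ?_⟩
  have := congrArg (· ≫ e.hom.app (K.obj i)) (hg i)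
  simpa [T'] using this

theorem coverPreserving_of_iso {C D : Type*} [Category* C] [Category* D]
    {J : GrothendieckTopology C} {J' : GrothendieckTopology D}
    {F F' : C ⥤ D} (h : CoverPreserving J J' F) (e : F ≅ F') : CoverPreserving J J' F' where
  cover_preserve {U S} hS := by
    refine J'.superset_covering ?_ (J'.pullback_stable (e.inv.app U) (h.cover_preserve hS))
    rintro V k ⟨Z, s, g, hs, hg⟩
    refine ⟨Z, s, g ≫ e.hom.app Z, hs, ?_⟩
    have := congrArg (· ≫ e.hom.app U) hg
    simpa using this

theorem IsGSiteMorphism.of_iso {S S' : LcGSite.{u}} {F F' : S.cat.carrier ⥤ S'.cat.carrier}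
    (h : IsGSiteMorphism S S' F) (e : F ≅ F') : IsGSiteMorphism S S' F' :=
  ⟨coverPreserving_of_iso h.coverPreserving e, h.coveringFlat.of_iso e⟩

/-- An equivalence which identifies the covering sieves is a morphism of sites. -/
theorem IsGSiteMorphism.of_isEquivalence {S S' : LcGSite.{u}}
    (F : S.cat.carrier ⥤ S'.cat.carrier) [F.IsEquivalence]
    (h : ∀ {A : S.cat.carrier} (R : Sieve A),
      R.functorPushforward F ∈ S'.topology (F.obj A) ↔ R ∈ S.topology A) :
    IsGSiteMorphism S S' F :=
  ⟨⟨fun hR => (h _).2 hR⟩, coveringFlat_of_isEquivalence _ _⟩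

/-- The pseudo-inverse of an equivalence which identifies the covering sieves is a morphism of
sites. -/
theorem IsGSiteMorphism.inverse_of_equivalence {S S' : LcGSite.{u}}
    (e : S.cat.carrier ≌ S'.cat.carrier)
    (h : ∀ {A : S.cat.carrier} (R : Sieve A),
      R.functorPushforward e.functor ∈ S'.topology (e.functor.obj A) ↔ R ∈ S.topology A) :
    IsGSiteMorphism S' S e.inverse where
  coverPreserving := ⟨fun {U R} hR => by
    rw [← h]
    refine S'.topology.superset_covering ?_
      (S'.topology.pullback_stable (e.counit.app U) hR)
    intro V k hk
    refine ⟨e.inverse.obj V, e.inverse.map (k ≫ e.counit.app U),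
      e.counitInv.app V, ⟨V, _, 𝟙 _, hk, (Category.id_comp _).symm⟩, ?_⟩
    have := e.counitInv.naturality (k ≫ e.counit.app U)
    dsimp at this
    rw [← this]
    simp⟩
  coveringFlat := coveringFlat_of_isEquivalence _ _

end Flat

/-! ### Equality of arrows of `L(𝒢)` -/

section LHomExt

variable {𝒢 ℋ : OrderedGroupoid.{u}}

theorem lHom_ext {A B : LObj 𝒢} {f g : A ⟶ B} (h : lArr f = lArr g) : f = g := LHom.ext h

theorem lHom_hext {A B A' B' : LObj 𝒢} {f : A ⟶ B} {g : A' ⟶ B'} (hA : A = A') (hB : B = B')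
    (h : lArr f = lArr g) : f ≍ g := by
  subst hA; subst hB; exact heq_of_eq (lHom_ext h)

theorem lArr_comp_eqToHom {A B B' : LObj 𝒢} (f : A ⟶ B) (h : B = B') :
    lArr (f ≫ eqToHom h) = lArr f := by
  subst h; simp

theorem lArr_eqToHom_comp {A A' B : LObj 𝒢} (h : A = A') (f : A' ⟶ B) :
    lArr (eqToHom h ≫ f) = lArr f := by
  subst h; simp

end LHomExt

/-! ### Comparison of morphisms of Ehresmann sites with morphisms of Grothendieck sites -/

section Comparison

variable {𝒢 ℋ : OrderedGroupoid.{u}}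

/-- The diagram in `L(𝒢)` induced by a diagram of ordered groupoids. -/
def lDiagram {I : OrderedGroupoid.{w}} (D : OrdFunctor I 𝒢) : LObj I ⥤ LObj 𝒢 where
  obj i := ⟨D.obj i.obj⟩
  map {i j} f := (⟨D.arr (lArr f), by rw [D.src_arr, src_lArr],
    by rw [D.tgt_arr]; exact D.obj_mono (tgt_lArr_le f)⟩ : LHom 𝒢 (D.obj i.obj) (D.obj j.obj))
  map_id i := lHom_ext (D.arr_one i.obj)
  map_comp {i j k} f g := by
    apply LHom.ext
    refine (D.arr_comp _ _ _).trans (𝒢.comp_congr rfl ?_ _)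
    refine (D.arr_restrict _ _ _).trans
      (OrderedGroupoid.restrict_eq _ ?_ (OrderedGroupoid.restrict_le _ _ _))
    exact (OrderedGroupoid.src_restrict _ _ _).trans (D.tgt_arr _)

/-- An hv-cone over `D` is a cone over the induced diagram in `L(𝒢)`. -/
def HVCone.toCone {I : OrderedGroupoid.{w}} {D : OrdFunctor I 𝒢} (ξ : HVCone D) :
    Limits.Cone (lDiagram D) where
  pt := ⟨ξ.pt⟩
  π :=
    { app := fun i => ξ.leg i.obj
      naturality := fun i j f => by
        have h1 := ξ.vertical _ _ (tgt_lArr_le f)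
        have h2 := ξ.horizontal (lArr f)
        obtain ⟨i⟩ := i
        obtain ⟨a, ha, hf⟩ := f
        have ha' : I.src a = i := ha
        subst ha'
        refine (Category.id_comp (X := (⟨ξ.pt⟩ : LObj 𝒢)) (Y := (lDiagram D).obj j) _).trans ?_
        exact LHom.ext (h1.symm.trans h2.symm) }

/-- A cone over the diagram in `L(𝒢)` induced by `D` is an hv-cone over `D`. -/
def HVCone.ofCone {I : OrderedGroupoid.{w}} {D : OrdFunctor I 𝒢} (S : Limits.Cone (lDiagram D)) :
    HVCone D where
  pt := S.pt.obj
  leg i := S.π.app ⟨i⟩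
  horizontal α := by
    have h := S.w (j := ⟨I.src α⟩) (j' := ⟨I.tgt α⟩) ⟨α, rfl, le_rfl⟩
    exact congrArg lArr h
  vertical i i' h := by
    have h' := S.w (j := ⟨i⟩) (j' := ⟨i'⟩) (LHom.ofLE h)
    refine Eq.trans ?_ (congrArg lArr h')
    refine (𝒢.comp_one' (X := 𝒢.tgt (lArr (S.π.app ⟨i⟩))) (𝒢.src_one _).symm).symm.trans
      (𝒢.comp_congr rfl ?_ _)
    refine (OrderedGroupoid.restrict_eq _ (𝒢.src_one _) ?_).symm
    change _ ≤ D.arr (I.one i)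
    rw [D.arr_one]
    exact (𝒢.one_le_one _ _).2 (tgt_lArr_le (S.π.app ⟨i⟩))

theorem mem_verticalPart_iff {A : LObj 𝒢} (S : Sieve A) {Y : 𝒢.Obj} (h : Y ≤ A.obj) :
    Y ∈ (verticalPart S).carrier ↔ S.arrows (Y := ⟨Y⟩) (LHom.ofLE h) := by
  rw [← mem_verticalPart]
  have : 𝒢.tgt (lArr (A := ⟨Y⟩) (B := A) (LHom.ofLE h)) = Y := 𝒢.tgt_one Y
  rw [this]

theorem finite_lHom {I : OrderedGroupoid.{w}} [Finite I.Arr] (A B : I.Obj) :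
    Finite (LHom I A B) :=
  Finite.of_injective LHom.arr fun _ _ h => LHom.ext h

theorem eCoveringFlat_of_coveringFlat (T : EhresmannTopology ℋ) (M : OrdFunctor 𝒢 ℋ)
    (h : CoveringFlat (C := lCat 𝒢) (D := lCat ℋ) (lTopology T) (lFunctor M)) :
    ECoveringFlat T M := by
  intro I _ _ D ξ
  have : Finite (LObj I) := Finite.of_injective LObj.obj fun ⟨_⟩ ⟨_⟩ h => congrArg LObj.mk h
  have : ∀ i j : LObj I, Finite (i ⟶ j) := fun i j => finite_lHom i.obj j.obj
  let _ : Fintype (LObj I) := Fintype.ofFinite _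
  let _ : FinCategory (LObj I) := { fintypeHom := fun i j => Fintype.ofFinite _ }
  let K : LObj I ⥤ (lCat 𝒢).carrier := lDiagram D
  let T' : Limits.Cone (K ⋙ lFunctor M) := ξ.toCone
  refine ⟨_, h (LObj I) K T', fun U' hU' => ?_⟩
  obtain ⟨S, g, hg⟩ := (mem_verticalPart_iff (factorSieve (C := lCat 𝒢) (D := lCat ℋ)
    (lFunctor M) K T') (VSieve.le _ U' hU')).1 hU'
  exact ⟨HVCone.ofCone (D := D) S, g, fun i => hg ⟨i⟩⟩

end Comparison

/-! ### Finite diagrams in `L(𝒢)` as diagrams of ordered groupoids -/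

section Mesh

/-- The objects of the ordered groupoid `mesh I`: the arrows of `I`, and a top for each object. -/
inductive MeshObj (I : Type w) [SmallCategory I] : Type w
  | arrow {i j : I} (α : i ⟶ j)
  | top (j : I)

variable {I : Type w} [SmallCategory I]

namespace MeshObj

/-- Two objects of `mesh I` are joined by a horizontal arrow when they have the same key. -/
def key : MeshObj I → I ⊕ I
  | @arrow _ _ i _ _ => .inl i
  | top j => .inr j

/-- An arrow of `I` is below the top of its codomain. -/
inductive Le : MeshObj I → MeshObj I → Prop
  | refl (x : MeshObj I) : Le x x
  | arrow_top {i j : I} (α : i ⟶ j) : Le (arrow α) (top j)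

instance : PartialOrder (MeshObj I) where
  le := Le
  le_refl := Le.refl
  le_trans a b c h k := by
    cases h with
    | refl => exact k
    | arrow_top α => cases k; exact Le.arrow_top α
  le_antisymm a b h k := by
    cases h with
    | refl => rfl
    | arrow_top α => cases k

theorem arrow_le_top {i j : I} (α : i ⟶ j) : arrow α ≤ top j := Le.arrow_top α

theorem eq_of_key_eq {x y z : MeshObj I} (h : x ≤ y) (hxy : x ≠ y) (hz : key y = key z) :
    y = z := by
  cases h with
  | refl => exact absurd rfl hxy
  | arrow_top α =>
    cases z with
    | arrow β => cases hz
    | top j => cases hz; rfl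

end MeshObj

/-- The horizontal arrows of `mesh I`. -/
@[ext]
structure MeshArr (I : Type w) [SmallCategory I] : Type w where
  src : MeshObj I
  tgt : MeshObj I
  key_eq : src.key = tgt.key

namespace MeshArr

/-- The identity arrows of `mesh I`. -/
@[simps]
def one (x : MeshObj I) : MeshArr I := ⟨x, x, rfl⟩

/-- The only relations between distinct horizontal arrows are those between identities. -/
inductive Le : MeshArr I → MeshArr I → Prop
  | refl (f : MeshArr I) : Le f f
  | one {x y : MeshObj I} (h : x ≤ y) : Le (one x) (one y)

theorem Le.cases {f g : MeshArr I} (h : Le f g) :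
    f = g ∨ ∃ x y, x ≤ y ∧ f = MeshArr.one x ∧ g = MeshArr.one y := by
  cases h with
  | refl => exact Or.inl rfl
  | one h => exact Or.inr ⟨_, _, h, rfl, rfl⟩

instance : PartialOrder (MeshArr I) where
  le := Le
  le_refl := Le.refl
  le_trans a b c h k := by
    obtain rfl | ⟨x, y, hxy, rfl, rfl⟩ := h.cases
    · exact k
    · obtain rfl | ⟨x', y', hxy', e, rfl⟩ := k.cases
      · exact Le.one hxy
      · obtain rfl : y = x' := congrArg MeshArr.src e
        exact Le.one (hxy.trans hxy')
  le_antisymm a b h k := by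
    obtain rfl | ⟨x, y, hxy, rfl, rfl⟩ := h.cases
    · rfl
    · obtain e | ⟨x', y', hxy', e, e'⟩ := k.cases
      · exact e.symm
      · obtain rfl : y = x' := congrArg MeshArr.src e
        obtain rfl : x = y' := congrArg MeshArr.src e'
        exact congrArg MeshArr.one (le_antisymm hxy hxy')

theorem le_cases {f g : MeshArr I} (h : f ≤ g) :
    f = g ∨ ∃ x y, x ≤ y ∧ f = one x ∧ g = one y :=
  Le.cases h

theorem one_le_one {x y : MeshObj I} (h : x ≤ y) : one x ≤ one y := Le.one h

theorem src_mono {f g : MeshArr I} (h : f ≤ g) : f.src ≤ g.src := by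
  cases h with
  | refl => exact le_rfl
  | one h => exact h

end MeshArr

/-- The ordered groupoid with the same cones as the category `I`: its vertical arrows relate each
arrow of `I` to the top of its codomain, and any two arrows of `I` with the same domain are joined
by a unique horizontal arrow. -/
def mesh (I : Type w) [SmallCategory I] : OrderedGroupoid.{w} where
  Obj := MeshObj I
  Arr := MeshArr I
  src := MeshArr.src
  tgt := MeshArr.tgt
  one := MeshArr.one
  comp f g h := ⟨f.src, g.tgt, f.key_eq.trans ((congrArg MeshObj.key h).trans g.key_eq)⟩
  inv f := ⟨f.tgt, f.src, f.key_eq.symm⟩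
  src_one _ := rfl
  tgt_one _ := rfl
  src_comp _ _ _ := rfl
  tgt_comp _ _ _ := rfl
  one_comp _ := rfl
  comp_one _ := rfl
  assoc _ _ _ _ _ := rfl
  src_inv _ := rfl
  tgt_inv _ := rfl
  comp_inv _ := rfl
  inv_comp _ := rfl
  one_le_one _ _ := ⟨MeshArr.src_mono, MeshArr.one_le_one⟩
  inv_le_inv f g h := by
    cases h with
    | refl => exact le_rfl
    | one h => exact MeshArr.one_le_one h
  comp_le_comp f f' g g' h h' hf hg := by
    obtain rfl | ⟨x, y, hxy, rfl, rfl⟩ := MeshArr.le_cases hf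
    · obtain rfl | ⟨x, y, hxy, rfl, rfl⟩ := MeshArr.le_cases hg
      · exact le_rfl
      · obtain rfl : x = y := h.symm.trans h'
        exact le_rfl
    · obtain rfl | ⟨x', y', hxy', rfl, rfl⟩ := MeshArr.le_cases hg
      · obtain rfl : x = y := h.trans h'.symm
        exact le_rfl
      · obtain rfl : x = x' := h
        obtain rfl : y = y' := h'
        exact MeshArr.one_le_one hxy
  existsUnique_restrict f x h := by
    by_cases hx : x = f.src
    · refine ⟨f, ⟨hx.symm, le_rfl⟩, ?_⟩
      rintro g ⟨hg, hle⟩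
      obtain rfl | ⟨x', y, -, rfl, rfl⟩ := MeshArr.le_cases hle
      · rfl
      · obtain rfl : x' = y := hg.trans hx
        rfl
    · have hf : f = MeshArr.one f.src :=
        MeshArr.ext rfl (MeshObj.eq_of_key_eq h hx f.key_eq).symm
      refine ⟨MeshArr.one x, ⟨rfl, hf ▸ MeshArr.one_le_one h⟩, ?_⟩
      rintro g ⟨hg, hle⟩
      obtain rfl | ⟨x', y, -, rfl, rfl⟩ := MeshArr.le_cases hle
      · exact absurd hg.symm hx
      · obtain rfl : x' = x := hg
        rfl

theorem finite_meshObj [Finite I] [∀ i j : I, Finite (i ⟶ j)] : Finite (MeshObj I) :=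
  Finite.of_surjective
    (fun x : (Σ (i : I) (j : I), (i ⟶ j)) ⊕ I =>
      Sum.elim (fun α => MeshObj.arrow α.2.2) MeshObj.top x)
    fun y => by
      cases y with
      | arrow α => exact ⟨.inl ⟨_, _, α⟩, rfl⟩
      | top j => exact ⟨.inr j, rfl⟩

theorem finite_meshArr [Finite (MeshObj I)] : Finite (MeshArr I) :=
  Finite.of_injective (fun f => (f.src, f.tgt)) fun _ _ h =>
    MeshArr.ext (congrArg Prod.fst h) (congrArg Prod.snd h)

variable {𝒢 ℋ : OrderedGroupoid.{u}} (K : I ⥤ LObj 𝒢)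

/-- The horizontal part of the image of an arrow of `I`, and the identity at a top. -/
def meshLeg : MeshObj I → 𝒢.Arr
  | .arrow α => lArr (K.map α)
  | .top j => 𝒢.one (K.obj j).obj

/-- The common domain of the arrows `meshLeg K x` for the objects `x` with a given key. -/
def meshBase : I ⊕ I → 𝒢.Obj := Sum.elim (fun i => (K.obj i).obj) fun j => (K.obj j).obj

theorem src_meshLeg (x : MeshObj I) : 𝒢.src (meshLeg K x) = meshBase K x.key := by
  cases x with
  | arrow α => exact src_lArr _
  | top j => exact 𝒢.src_one _

theorem src_meshLeg_eq (f : MeshArr I) :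
    𝒢.src (meshLeg K f.src) = 𝒢.src (meshLeg K f.tgt) := by
  rw [src_meshLeg, src_meshLeg, f.key_eq]

/-- The diagram of ordered groupoids with the same cones as the diagram `K` in `L(𝒢)`. -/
def meshDiagram : OrdFunctor (mesh I) 𝒢 where
  obj x := 𝒢.tgt (meshLeg K x)
  arr f := 𝒢.comp (𝒢.inv (meshLeg K f.src)) (meshLeg K f.tgt)
    ((𝒢.tgt_inv _).trans (src_meshLeg_eq K f))
  src_arr f := by rw [𝒢.src_comp, 𝒢.src_inv]; rfl
  tgt_arr f := by rw [𝒢.tgt_comp]; rfl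
  arr_one x := 𝒢.inv_comp _
  arr_comp f g h := by
    obtain ⟨a, b, hab⟩ := f
    obtain ⟨b', c, hbc⟩ := g
    obtain rfl : b = b' := h
    have hab' := src_meshLeg_eq K ⟨a, b, hab⟩
    have hbc' := src_meshLeg_eq K ⟨b, c, hbc⟩
    rw [𝒢.assoc _ _ _ ((𝒢.tgt_inv _).trans hab') (by simp)]
    exact 𝒢.comp_congr rfl (OrderedGroupoid.comp_inv_comp_cancel hbc').symm _
  arr_mono f g h := by
    obtain rfl | ⟨x, y, hxy, rfl, rfl⟩ := MeshArr.le_cases h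
    · exact le_rfl
    · refine (𝒢.inv_comp _).trans_le (le_of_le_of_eq ?_ (𝒢.inv_comp _).symm)
      refine (𝒢.one_le_one _ _).2 ?_
      cases hxy with
      | refl => exact le_rfl
      | arrow_top α => exact (tgt_lArr_le (K.map α)).trans_eq (𝒢.tgt_one _).symm

end Mesh

section MeshCone

variable {𝒢 ℋ : OrderedGroupoid.{u}} {I : Type} [SmallCategory I]

theorem lArr_map_id (K : I ⥤ LObj 𝒢) (i : I) : lArr (K.map (𝟙 i)) = 𝒢.one (K.obj i).obj := by
  rw [K.map_id]; rfl

/-- The arrow `meshLeg K x` as an arrow of `L(𝒢)`. -/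
@[simps]
def meshHom (K : I ⥤ LObj 𝒢) (x : MeshObj I) (k : I ⊕ I) (h : x.key = k) :
    LHom 𝒢 (meshBase K k) (𝒢.tgt (meshLeg K x)) :=
  ⟨meshLeg K x, by rw [src_meshLeg, h], le_rfl⟩

theorem meshHom_comp (K : I ⥤ LObj 𝒢) (f : MeshArr I) :
    (meshHom K f.src f.src.key rfl).comp
      ⟨(meshDiagram K).arr f, (meshDiagram K).src_arr f, ((meshDiagram K).tgt_arr f).le⟩ =
      meshHom K f.tgt f.src.key f.key_eq.symm := by
  refine LHom.ext (Eq.trans (𝒢.comp_congr rfl ?_ _)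
    (OrderedGroupoid.comp_inv_comp_cancel (src_meshLeg_eq K f)))
  exact OrderedGroupoid.restrict_eq _ ((meshDiagram K).src_arr f) le_rfl

/-- The leg of a cone at the object of `I` underlying a key. -/
def meshBaseLeg (K : I ⥤ LObj 𝒢) (M : OrdFunctor 𝒢 ℋ) (T : Limits.Cone (K ⋙ lFunctor M)) :
    ∀ k : I ⊕ I, LHom ℋ T.pt.obj (M.obj (meshBase K k))
  | .inl i => T.π.app i
  | .inr j => T.π.app j

/-- The image under `M` of a cone over `K`, as an hv-cone over the diagram `meshDiagram K`. -/
def meshCone (K : I ⥤ LObj 𝒢) (M : OrdFunctor 𝒢 ℋ) (T : Limits.Cone (K ⋙ lFunctor M)) :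
    HVCone ((meshDiagram K).comp M) where
  pt := T.pt.obj
  leg x := (meshBaseLeg K M T x.key).comp ((meshHom K x x.key rfl).map M)
  horizontal f := by
    have key : ∀ (x : MeshObj I) (k : I ⊕ I) (h : x.key = k),
        ((meshBaseLeg K M T x.key).comp ((meshHom K x x.key rfl).map M)).arr =
          ((meshBaseLeg K M T k).comp ((meshHom K x k h).map M)).arr := by
      rintro x _ rfl
      rfl
    refine Eq.trans ?_ (key f.tgt f.src.key f.key_eq.symm).symm
    have h := congrArg (fun a => ((meshBaseLeg K M T f.src.key).comp (a.map M)).arr)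
      (meshHom_comp K f)
    rw [LHom.map_comp, ← LHom.comp_assoc] at h
    exact h
  vertical x y h := by
    cases h with
    | refl => rfl
    | @arrow_top i j α =>
      refine (congrArg lArr (T.w α)).trans ?_
      refine ((ℋ.comp_congr rfl ?_ _).trans (ℋ.comp_one' (ℋ.src_one _).symm)).symm
      refine OrderedGroupoid.restrict_eq _ (ℋ.src_one _) ?_
      exact ((ℋ.one_le_one _ _).2 (tgt_lArr_le (T.π.app j))).trans_eq (M.arr_one _).symm

theorem meshCone_leg_top (K : I ⥤ LObj 𝒢) (M : OrdFunctor 𝒢 ℋ)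
    (T : Limits.Cone (K ⋙ lFunctor M)) (j : I) :
    ((meshCone K M T).leg (.top j)).arr = lArr (T.π.app j) := by
  refine (ℋ.comp_congr rfl ?_ _).trans (ℋ.comp_one' (ℋ.src_one _).symm)
  refine OrderedGroupoid.restrict_eq _ (ℋ.src_one _) ?_
  exact ((ℋ.one_le_one _ _).2 (tgt_lArr_le (T.π.app j))).trans_eq (M.arr_one _).symm

/-- The cone over `K` given by an hv-cone over `meshDiagram K`. -/
def ofMeshCone (K : I ⥤ LObj 𝒢) (θ : HVCone (meshDiagram K)) : Limits.Cone K where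
  pt := ⟨θ.pt⟩
  π :=
    { app := fun j => (⟨(θ.leg (.top j)).arr, (θ.leg (.top j)).src_eq,
        (θ.leg (.top j)).tgt_le.trans_eq (𝒢.tgt_one _)⟩ : LHom 𝒢 θ.pt (K.obj j).obj)
      naturality := fun i j α => by
        refine (Category.id_comp (X := (⟨θ.pt⟩ : LObj 𝒢)) (Y := K.obj j) _).trans ?_
        have h1 := θ.vertical _ _ (MeshObj.arrow_le_top α)
        have h2 := θ.vertical _ _ (MeshObj.arrow_le_top (𝟙 i))
        have h3 := θ.horizontal (⟨.arrow (𝟙 i), .arrow α, rfl⟩ : MeshArr I)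
        refine LHom.ext (h1.symm.trans (h3.symm.trans (𝒢.comp_congr h2 ?_ _)))
        refine OrderedGroupoid.eq_of_le_of_src (k := lArr (K.map α))
          ((OrderedGroupoid.restrict_le _ _ _).trans_eq ?_) (OrderedGroupoid.restrict_le _ _ _)
          ((OrderedGroupoid.src_restrict _ _ _).trans
            ((congrArg 𝒢.tgt h2).trans (OrderedGroupoid.src_restrict _ _ _).symm))
        refine (𝒢.comp_congr (f' := 𝒢.one (K.obj i).obj) ?_ rfl _).trans (𝒢.one_comp' _)
        refine (congrArg 𝒢.inv (lArr_map_id K i)).trans ?_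
        have h4 := 𝒢.inv_comp (𝒢.one (K.obj i).obj)
        rwa [𝒢.comp_one', 𝒢.tgt_one] at h4 }

theorem coveringFlat_of_eCoveringFlat (T : EhresmannTopology ℋ) (M : OrdFunctor 𝒢 ℋ)
    (h : ECoveringFlat T M) :
    CoveringFlat (C := lCat 𝒢) (D := lCat ℋ) (lTopology T) (lFunctor M) := by
  intro I _ _ K S
  have : Finite (MeshObj I) := finite_meshObj
  have : Finite (mesh I).Obj := this
  have : Finite (mesh I).Arr := finite_meshArr (I := I)
  obtain ⟨𝒰, h𝒰, H⟩ := h (mesh I) (meshDiagram K) (meshCone K M S)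
  refine T.superset h𝒰 fun U hU => ?_
  obtain ⟨θ, k, hk⟩ := H U hU
  refine (mem_verticalPart_iff _ (𝒰.le U hU)).2 ⟨ofMeshCone K θ, k, fun j => ?_⟩
  have h1 := congrArg LHom.arr (hk (.top j))
  refine LHom.ext (Eq.trans ?_ h1)
  exact ℋ.comp_congr rfl (OrderedGroupoid.eq_of_le_of_src (k := lArr (S.π.app j))
    (OrderedGroupoid.restrict_le _ _ _) ((OrderedGroupoid.restrict_le _ _ _).trans_eq
      (meshCone_leg_top K M S j)) ((OrderedGroupoid.src_restrict _ _ _).trans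
        (OrderedGroupoid.src_restrict _ _ _).symm)) _

end MeshCone

section Morphism

variable {E E' : ESite.{u}}

theorem IsESiteMorphism.lFunctor {M : OrdFunctor E.gpd E'.gpd} (h : IsESiteMorphism E E' M) :
    IsGSiteMorphism (lSite E) (lSite E') (lFunctor M) where
  coverPreserving := ⟨fun {A S} hS => by
    refine E'.topology.superset (h.coverPreserving _ _ hS) ?_
    rintro Y ⟨X, hX, hY⟩
    have hXA := (verticalPart S).le X hX
    refine (mem_verticalPart_iff _ (hY.trans (M.obj_mono hXA))).2
      ⟨⟨X⟩, LHom.ofLE hXA, LHom.ofLE hY, (mem_verticalPart_iff S hXA).1 hX, ?_⟩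
    refine (LHom.ofLE_comp_ofLE hY (M.obj_mono hXA)).symm.trans ?_
    rw [← LHom.map_ofLE]
    rfl⟩
  coveringFlat := coveringFlat_of_eCoveringFlat _ _ h.coveringFlat

/-- The sieve of all arrows `B → A' ≤ A` of `L(𝒢)` with `A'` in a given vertical sieve on `A`. -/
def sieveOfVSieve {𝒢 : OrderedGroupoid.{u}} {A : 𝒢.Obj} (𝒜 : VSieve 𝒢 A) :
    Sieve (⟨A⟩ : LObj 𝒢) where
  arrows _ f := 𝒢.tgt (lArr f) ∈ 𝒜.carrier
  downward_closed hf _ := 𝒜.downward_closed _ hf _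
    ((𝒢.tgt_comp _ _ _).trans_le (OrderedGroupoid.tgt_restrict_le _ _ _))

theorem verticalPart_sieveOfVSieve {𝒢 : OrderedGroupoid.{u}} {A : 𝒢.Obj} (𝒜 : VSieve 𝒢 A) :
    verticalPart (sieveOfVSieve 𝒜) = 𝒜 := by
  apply VSieve.ext
  ext Y
  constructor
  · rintro ⟨B, f, hf, rfl⟩
    exact hf
  · intro hY
    refine ⟨⟨Y⟩, LHom.ofLE (𝒜.le Y hY), ?_, 𝒢.tgt_one Y⟩
    change 𝒢.tgt (𝒢.one Y) ∈ 𝒜.carrier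
    rwa [𝒢.tgt_one]

theorem IsESiteMorphism.of_lFunctor {M : OrdFunctor E.gpd E'.gpd}
    (h : IsGSiteMorphism (lSite E) (lSite E') (EhresmannSite.lFunctor M)) :
    IsESiteMorphism E E' M where
  coverPreserving A 𝒜 h𝒜 := by
    have h1 : sieveOfVSieve 𝒜 ∈ lTopology E.topology ⟨A⟩ := by
      change verticalPart (sieveOfVSieve 𝒜) ∈ E.topology.covers A
      rwa [verticalPart_sieveOfVSieve]
    refine E'.topology.superset (h.coverPreserving.cover_preserve h1) ?_
    rintro _ ⟨B, f, ⟨Z, s, g, hs, rfl⟩, rfl⟩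
    refine ⟨_, hs, ?_⟩
    exact (E'.gpd.tgt_comp _ _ _).trans_le
      ((OrderedGroupoid.tgt_restrict_le _ _ _).trans_eq (M.tgt_arr _))
  coveringFlat := eCoveringFlat_of_coveringFlat _ _ h.coveringFlat

end Morphism

/-! ### The unit is an equivalence of sites -/

section Eta

variable (C : LcCat.{u})

instance : (eta C).Faithful where
  map_injective {A B f g} h := by
    obtain ⟨k, hk, hk'⟩ := gArr_mk_eq_iff.1 (congrArg lArr h)
    have : k.hom = 𝟙 A := by simpa using hk
    rw [← hk', this, Category.id_comp]

instance : (eta C).Full where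
  map_surjective {A B} f := by
    obtain ⟨a, ha, hB⟩ := f
    obtain ⟨Y, n, rfl⟩ := GArr.exists_rep_src (𝟙 A) ha.symm
    obtain ⟨rfl, -⟩ := GObj.mk_le_cases (m' := 𝟙 B) (m := n) hB
    exact ⟨n, rfl⟩

/-- A horizontal arrow is an isomorphism of `L(𝒢)`. -/
def lIso {𝒢 : OrderedGroupoid.{u}} {A B : 𝒢.Obj} (f : 𝒢.Arr) (hA : 𝒢.src f = A)
    (hB : 𝒢.tgt f = B) : (⟨A⟩ : LObj 𝒢) ≅ ⟨B⟩ where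
  hom := (⟨f, hA, hB.le⟩ : LHom 𝒢 A B)
  inv := (⟨𝒢.inv f, (𝒢.src_inv f).trans hB, ((𝒢.tgt_inv f).trans hA).le⟩ : LHom 𝒢 B A)
  hom_inv_id := by
    subst hA
    refine LHom.ext (Eq.trans (𝒢.comp_congr rfl ?_ _) (𝒢.comp_inv f))
    exact OrderedGroupoid.restrict_eq _ (𝒢.src_inv f) le_rfl
  inv_hom_id := by
    subst hB
    refine LHom.ext (Eq.trans (𝒢.comp_congr rfl ?_ _) (𝒢.inv_comp f))
    exact OrderedGroupoid.restrict_eq _ (𝒢.tgt_inv f).symm le_rfl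

instance : (eta C).EssSurj where
  mem_essImage X := by
    obtain ⟨X⟩ := X
    induction X using GObj.ind with
    | @h A B m =>
    exact ⟨A, ⟨lIso (𝒢 := gGpd C) (GArr.mk (𝟙 A) m) rfl rfl⟩⟩

instance eta_isEquivalence : (eta C).IsEquivalence where

variable (S : LcGSite.{u})

theorem eta_pushforward_mem_iff {A : S.cat.carrier} (R : Sieve A) :
    R.functorPushforward (eta S.cat) ∈ (lSite (gSite S).toESite).topology ((eta S.cat).obj A) ↔
      R ∈ S.topology A := by
  refine (mem_gCovers_iff S.topology (𝟙 A) _).trans ?_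
  have : preimageSieve (𝟙 A) (verticalPart (R.functorPushforward (eta S.cat))) = R := by
    ext B n
    change GObj.mk (n ≫ 𝟙 A) ∈ _ ↔ _
    rw [Category.comp_id]
    exact (mem_verticalPart (R.functorPushforward (eta S.cat)) ((eta S.cat).map n)).trans
      (Sieve.mem_functorPushforward_iff_of_full_of_faithful _ R n)
  exact iff_of_eq (congrArg (· ∈ S.topology A) this)

theorem isGSiteMorphism_eta : IsGSiteMorphism S (lSite (gSite S).toESite) (eta S.cat) :=
  @IsGSiteMorphism.of_isEquivalence S (lSite (gSite S).toESite) (eta S.cat)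
    (eta_isEquivalence S.cat) (eta_pushforward_mem_iff S)

theorem isGSiteMorphism_eta_inv :
    IsGSiteMorphism (lSite (gSite S).toESite) S (eta S.cat).inv :=
  IsGSiteMorphism.inverse_of_equivalence (S := S) (S' := lSite (gSite S).toESite)
    (eta S.cat).asEquivalence (eta_pushforward_mem_iff S)

end Eta

section UnitCounit

/-- Naturality of `η`. -/
theorem eta_naturality {C D : LcCat.{u}} (F : C.carrier ⥤ D.carrier) :
    F ⋙ eta D = eta C ⋙ lFunctor (gFunctor F) := by
  have h : ∀ A, (F ⋙ eta D).obj A = (eta C ⋙ lFunctor (gFunctor F)).obj A := fun A => by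
    change (⟨GObj.mk (𝟙 (F.obj A))⟩ : LObj (gGpd D)) = ⟨GObj.mk (F.map (𝟙 A))⟩
    rw [F.map_id]
  refine Functor.hext h fun A B f => lHom_hext (h A) (h B) ?_
  change GArr.mk (𝟙 (F.obj A)) (F.map f) = GArr.mk (F.map (𝟙 A)) (F.map f)
  rw [F.map_id]

theorem eta_comp_lFunctor_kappa (𝒢 : OrderedGroupoid.{u}) :
    eta (lCat 𝒢) ⋙ lFunctor (kappa 𝒢) = 𝟭 (LObj 𝒢) := by
  have h : ∀ A, (eta (lCat 𝒢) ⋙ lFunctor (kappa 𝒢)).obj A = (𝟭 (LObj 𝒢)).obj A := fun A =>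
    congrArg LObj.mk (𝒢.tgt_one A.obj)
  refine Functor.hext h fun A B f => lHom_hext (h A) (h B) ?_
  change 𝒢.comp (𝒢.inv (𝒢.one A.obj)) (lArr f) _ = lArr f
  have h1 : 𝒢.inv (𝒢.one A.obj) = 𝒢.one A.obj := by
    have := 𝒢.inv_comp (𝒢.one A.obj)
    rwa [𝒢.comp_one', 𝒢.tgt_one] at this
  exact (𝒢.comp_congr h1 rfl _).trans (𝒢.one_comp' _)

theorem gFunctor_eta_comp_kappa (C : LcCat.{u}) :
    (gFunctor (D := lCat (gGpd C)) (eta C)).comp (kappa (gGpd C)) = OrdFunctor.id (gGpd C) := by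
  refine OrdFunctor.ext (funext fun X => ?_) (funext fun f => ?_)
  · induction X using GObj.ind
    rfl
  · induction f using GArr.ind with
    | @h A X Y m n =>
    exact GArr.comp_mk m (𝟙 A) n rfl

/-- A functor out of the target of an equivalence is determined by its composite with it. -/
def inverseCompIso {A B D : Type*} [Category* A] [Category* B] [Category* D] (e : A ≌ B)
    {X : A ⥤ D} {Y : B ⥤ D} (h : X ≅ e.functor ⋙ Y) : e.inverse ⋙ X ≅ Y :=
  Functor.isoWhiskerLeft e.inverse h ≪≫ (Functor.associator _ _ _).symm ≪≫
    Functor.isoWhiskerRight e.counitIso Y ≪≫ Functor.leftUnitor Y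

theorem IsGSiteMorphism.lFunctor_gFunctor {S S' : LcGSite.{u}}
    {F : S.cat.carrier ⥤ S'.cat.carrier} (h : IsGSiteMorphism S S' F) :
    IsGSiteMorphism (lSite (gSite S).toESite) (lSite (gSite S').toESite)
      (EhresmannSite.lFunctor (gFunctor F)) :=
  ((isGSiteMorphism_eta_inv S).comp (h.comp (isGSiteMorphism_eta S'))).of_iso
    (inverseCompIso (eta S.cat).asEquivalence (eqToIso (eta_naturality F)))

theorem isESiteMorphism_gFunctor {S S' : LcGSite.{u}} {F : S.cat.carrier ⥤ S'.cat.carrier}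
    (h : IsGSiteMorphism S S' F) :
    IsESiteMorphism (gSite S).toESite (gSite S').toESite (gFunctor F) :=
  IsESiteMorphism.of_lFunctor h.lFunctor_gFunctor

/-- `L(κ)` is a pseudo-inverse of `η`. -/
def etaInvIso (𝒢 : OrderedGroupoid.{u}) : (eta (lCat 𝒢)).inv ≅ lFunctor (kappa 𝒢) :=
  (Functor.rightUnitor _).symm ≪≫ inverseCompIso (eta (lCat 𝒢)).asEquivalence
    (eqToIso (eta_comp_lFunctor_kappa 𝒢).symm)

theorem isESiteMorphism_kappa (E : ESite.{u}) :
    IsESiteMorphism (gSite (lSite E)).toESite E (kappa E.gpd) :=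
  IsESiteMorphism.of_lFunctor
    ((isGSiteMorphism_eta_inv (lSite E)).of_iso (etaInvIso E.gpd))

/-- A double functor which is right inverse to `κ` is a morphism of sites. -/
theorem isESiteMorphism_of_comp_kappa (E : ESite.{u})
    (N : OrdFunctor E.gpd (gGpd (lCat E.gpd))) (h : N.comp (kappa E.gpd) = OrdFunctor.id E.gpd) :
    IsESiteMorphism E (gSite (lSite E)).toESite N := by
  have h' : lFunctor N ⋙ lFunctor (kappa E.gpd) = 𝟭 (LObj E.gpd) := congrArg lFunctor h
  refine IsESiteMorphism.of_lFunctor ((isGSiteMorphism_eta (lSite E)).of_iso ?_)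
  let e := (eta (lCat E.gpd)).asEquivalence
  exact (Functor.leftUnitor (eta (lCat E.gpd))).symm ≪≫
    Functor.isoWhiskerRight (eqToIso h'.symm ≪≫
      Functor.isoWhiskerLeft (lFunctor N) (etaInvIso E.gpd).symm) (eta (lCat E.gpd)) ≪≫
    Functor.associator _ _ _ ≪≫ Functor.isoWhiskerLeft (lFunctor N) e.counitIso ≪≫
    Functor.rightUnitor (lFunctor N)

end UnitCounit

/-! ### The pseudo-inverse of the counit -/

section Sigma

variable {𝒢 : OrderedGroupoid.{u}}

/-- The subobject `[X = X ≤ M]` in `L(𝒢)`. -/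
def subObj (X M : 𝒢.Obj) (h : X ≤ M) : GObj (lCat 𝒢) :=
  GObj.mk (C := lCat 𝒢) (A := (⟨X⟩ : LObj 𝒢)) (B := (⟨M⟩ : LObj 𝒢)) (LHom.ofLE h)

/-- The span `M ≥ X → Y ≤ N` in `L(𝒢)` determined by `f : X → Y`. -/
def spanArr (f : 𝒢.Arr) (M N : 𝒢.Obj) (hM : 𝒢.src f ≤ M) (hN : 𝒢.tgt f ≤ N) :
    GArr (lCat 𝒢) :=
  GArr.mk (C := lCat 𝒢) (A := (⟨𝒢.src f⟩ : LObj 𝒢)) (X := (⟨M⟩ : LObj 𝒢)) (Y := (⟨N⟩ : LObj 𝒢))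
    (LHom.ofLE hM) (⟨f, rfl, hN⟩ : LHom 𝒢 (𝒢.src f) N)

theorem spanArr_congr {f : 𝒢.Arr} {M N M' N' : 𝒢.Obj} (hM : 𝒢.src f ≤ M) (hN : 𝒢.tgt f ≤ N)
    (hM' : 𝒢.src f ≤ M') (hN' : 𝒢.tgt f ≤ N') (e : M = M') (e' : N = N') :
    spanArr f M N hM hN = spanArr f M' N' hM' hN' := by
  subst e; subst e'; rfl

theorem lIso_hom_comp {A B N : LObj 𝒢} (f : 𝒢.Arr) (hA : 𝒢.src f = A.obj) (hB : 𝒢.tgt f = B.obj)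
    (g : B ⟶ N) : lArr ((lIso f hA hB).hom ≫ g) =
      𝒢.comp f (lArr g) (hB.trans (src_lArr g).symm) :=
  𝒢.comp_congr rfl (OrderedGroupoid.restrict_eq _ ((src_lArr g).trans hB.symm) le_rfl) _

/-- Every representation of `X ≤ M` as an image. -/
theorem mk_eq_subObj {A : LObj 𝒢} {X M : 𝒢.Obj} (h : X ≤ M) (p : A ⟶ (⟨M⟩ : LObj 𝒢))
    (hp : 𝒢.tgt (lArr p) = X) : GObj.mk (C := lCat 𝒢) p = subObj X M h := by
  refine gObj_mk_eq_iff.2 ⟨lIso (lArr p) (src_lArr p) hp, lHom_ext ?_⟩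
  refine (lIso_hom_comp (B := ⟨X⟩) (N := ⟨M⟩) (lArr p) (src_lArr p) hp (LHom.ofLE h)).trans ?_
  exact 𝒢.comp_one' (X := X) (by rw [𝒢.src_one]; exact hp)

theorem mk_eq_spanArr {A : LObj 𝒢} {M N : 𝒢.Obj} {f : 𝒢.Arr} (hM : 𝒢.src f ≤ M)
    (hN : 𝒢.tgt f ≤ N) (p : A ⟶ (⟨M⟩ : LObj 𝒢)) (q : A ⟶ (⟨N⟩ : LObj 𝒢))
    (h : 𝒢.tgt (lArr p) = 𝒢.src f) (hq : lArr q = 𝒢.comp (lArr p) f h) :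
    GArr.mk (C := lCat 𝒢) p q = spanArr f M N hM hN := by
  refine gArr_mk_eq_iff.2 ⟨lIso (lArr p) (src_lArr p) h, lHom_ext ?_, lHom_ext ?_⟩
  · refine (lIso_hom_comp (B := ⟨𝒢.src f⟩) (N := ⟨M⟩) (lArr p) (src_lArr p) h
      (LHom.ofLE hM)).trans ?_
    exact 𝒢.comp_one' (X := 𝒢.src f) (by rw [𝒢.src_one]; exact h)
  · exact (lIso_hom_comp (B := ⟨𝒢.src f⟩) (N := ⟨N⟩) (lArr p) (src_lArr p) h
      ⟨f, rfl, hN⟩).trans hq.symm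

theorem spanArr_mono {f g : 𝒢.Arr} (h : f ≤ g) {M N : 𝒢.Obj} (hM : 𝒢.src f ≤ M)
    (hN : 𝒢.tgt f ≤ N) (hM' : 𝒢.src g ≤ M) (hN' : 𝒢.tgt g ≤ N) :
    spanArr f M N hM hN ≤ spanArr g M N hM' hN' := by
  refine GArr.mk_le_iff.2 ⟨LHom.ofLE (𝒢.src_mono h), LHom.ofLE_comp_ofLE _ _, LHom.ext ?_⟩
  refine (𝒢.comp_congr rfl ?_ _).trans (𝒢.one_comp' (𝒢.tgt_one (𝒢.src f)))
  exact OrderedGroupoid.restrict_eq _ (𝒢.tgt_one _).symm h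

variable (H : HasMaximalObjects 𝒢)

/-- The maximal object above an object. -/
def maxObj (X : 𝒢.Obj) : 𝒢.Obj := (H X).choose

theorem le_maxObj (X : 𝒢.Obj) : X ≤ maxObj H X := (H X).choose_spec.1.1

theorem maxObj_eq {X Y : 𝒢.Obj} (h : X ≤ Y) : maxObj H X = maxObj H Y :=
  (H X).unique (H X).choose_spec.1 ⟨h.trans (le_maxObj H Y), (H Y).choose_spec.1.2⟩

/-- The pseudo-inverse of `κ_𝒢`. It sends `X` to `[X ≤ M]` with `M` the maximal object
above `X`. -/
def sigma : OrdFunctor 𝒢 (gGpd (lCat 𝒢)) where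
  obj X := subObj X (maxObj H X) (le_maxObj H X)
  arr f := spanArr f (maxObj H _) (maxObj H _) (le_maxObj H _) (le_maxObj H _)
  src_arr f := rfl
  tgt_arr f := mk_eq_subObj _ _ rfl
  arr_one X := by
    have h := mk_eq_spanArr (f := 𝒢.one X) (M := maxObj H X) (N := maxObj H X)
      ((𝒢.src_one X).trans_le (le_maxObj H X)) ((𝒢.tgt_one X).trans_le (le_maxObj H X))
      (A := ⟨X⟩) (LHom.ofLE (le_maxObj H X)) (LHom.ofLE (le_maxObj H X))
      ((𝒢.tgt_one X).trans (𝒢.src_one X).symm) (𝒢.one_comp' _).symm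
    refine Eq.trans ?_ h.symm
    exact spanArr_congr _ _ _ _ (by rw [𝒢.src_one]) (by rw [𝒢.tgt_one])
  arr_comp f g h := by
    let p : (⟨𝒢.src f⟩ : LObj 𝒢) ⟶ ⟨maxObj H (𝒢.tgt f)⟩ :=
      (⟨f, rfl, le_maxObj H _⟩ : LHom 𝒢 _ _)
    let q : (⟨𝒢.src f⟩ : LObj 𝒢) ⟶ ⟨maxObj H (𝒢.tgt g)⟩ :=
      (⟨𝒢.comp f g h, 𝒢.src_comp _ _ _, (𝒢.tgt_comp _ _ _).trans_le (le_maxObj H _)⟩ :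
        LHom 𝒢 _ _)
    let i : (⟨𝒢.src f⟩ : LObj 𝒢) ⟶ ⟨maxObj H (𝒢.src f)⟩ := LHom.ofLE (le_maxObj H _)
    have hg : spanArr g (maxObj H (𝒢.src g)) (maxObj H (𝒢.tgt g)) (le_maxObj H _)
        (le_maxObj H _) = GArr.mk (C := lCat 𝒢) p q :=
      (spanArr_congr _ _ (h.ge.trans (le_maxObj H _)) (le_maxObj H _) (by rw [h]) rfl).trans
        (mk_eq_spanArr _ _ p q h rfl).symm
    have hfg : GArr.mk (C := lCat 𝒢) i q =
        spanArr (𝒢.comp f g h) (maxObj H (𝒢.src f)) (maxObj H (𝒢.tgt g))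
          ((𝒢.src_comp _ _ _).trans_le (le_maxObj H _))
          ((𝒢.tgt_comp _ _ _).trans_le (le_maxObj H _)) :=
      mk_eq_spanArr _ _ i q ((𝒢.tgt_one _).trans (𝒢.src_comp _ _ _).symm)
        (𝒢.one_comp' _).symm
    refine (spanArr_congr _ _ _ _ (by rw [𝒢.src_comp]) (by rw [𝒢.tgt_comp])).trans
      (hfg.symm.trans ?_)
    exact (GArr.comp_mk (C := lCat 𝒢) i p q rfl).symm.trans
      ((gGpd (lCat 𝒢)).comp_congr rfl hg.symm rfl)
  arr_mono f g h := by
    refine le_of_eq_of_le (spanArr_congr _ _ ((𝒢.src_mono h).trans (le_maxObj H _))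
      ((𝒢.tgt_mono h).trans (le_maxObj H _)) (maxObj_eq H (𝒢.src_mono h))
      (maxObj_eq H (𝒢.tgt_mono h))) (spanArr_mono h _ _ _ _)

theorem sigma_comp_kappa : (sigma H).comp (kappa 𝒢) = OrdFunctor.id 𝒢 := by
  refine OrdFunctor.ext (funext fun X => 𝒢.tgt_one X) (funext fun f => ?_)
  change 𝒢.comp (𝒢.inv (𝒢.one (𝒢.src f))) f _ = f
  have h1 : 𝒢.inv (𝒢.one (𝒢.src f)) = 𝒢.one (𝒢.src f) := by
    have := 𝒢.inv_comp (𝒢.one (𝒢.src f))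
    rwa [𝒢.comp_one', 𝒢.tgt_one] at this
  exact (𝒢.comp_congr h1 rfl _).trans (𝒢.one_comp' _)

/-- The arrow `A → B' ≤ N` for an arrow `A → B' ≤ B` and an object `N` above `B'`. -/
def retarget {A B : LObj 𝒢} (m : A ⟶ B) (N : 𝒢.Obj) (h : 𝒢.tgt (lArr m) ≤ N) :
    A ⟶ (⟨N⟩ : LObj 𝒢) :=
  LHom.corestrict m h

theorem mk_retarget_mono {A A' B : LObj 𝒢} {m : A ⟶ B} {m' : A' ⟶ B} {k : A ⟶ A'}
    (w : k ≫ m' = m) {N N' : 𝒢.Obj} (h : 𝒢.tgt (lArr m) ≤ N) (h' : 𝒢.tgt (lArr m') ≤ N')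
    (e : N = N') : GArr.mk (C := lCat 𝒢) m (retarget m N h) ≤
      GArr.mk (C := lCat 𝒢) m' (retarget m' N' h') := by
  subst e
  have hk := congrArg lArr w
  exact GArr.mk_le_iff.2 ⟨k, w, LHom.ext hk⟩

theorem kappaSigma_aux (s t : SubRep (lCat 𝒢)) (h : s ≤ t) :
    GArr.mk (C := lCat 𝒢) s.hom (retarget s.hom (maxObj H _) (le_maxObj H _)) ≤
      GArr.mk (C := lCat 𝒢) t.hom (retarget t.hom (maxObj H _) (le_maxObj H _)) := by
  have h' := kappaObj_aux s t h
  obtain ⟨k, m, m', w⟩ := h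
  exact mk_retarget_mono w _ _ (maxObj_eq H h')

/-- The horizontal transformation with components `[m] → [B' ≤ M]`, where `B'` is the image of `m`
and `M` is the maximal object above it. -/
def kappaSigma : HorTrans (gGpd (lCat 𝒢)) (gGpd (lCat 𝒢)) where
  dom := OrdFunctor.id _
  cod := (kappa 𝒢).comp (sigma H)
  app := Quotient.lift
    (fun s : SubRep (lCat 𝒢) =>
      GArr.mk (C := lCat 𝒢) s.hom (retarget s.hom (maxObj H _) (le_maxObj H _)))
    fun s t h => le_antisymm (kappaSigma_aux H s t h.1) (kappaSigma_aux H t s h.2)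
  src_app X := by induction X using GObj.ind; rfl
  tgt_app X := by
    induction X using GObj.ind with
    | h m =>
    exact mk_eq_subObj _ _ rfl
  naturality f := by
    induction f using GArr.ind with
    | h m n =>
    let m' := retarget m (maxObj H _) (le_maxObj H _)
    let n' := retarget n (maxObj H _) (le_maxObj H _)
    refine (GArr.comp_mk (C := lCat 𝒢) m n n' rfl).trans
      ((GArr.comp_mk (C := lCat 𝒢) m m' n' rfl).symm.trans
        ((gGpd (lCat 𝒢)).comp_congr rfl ?_ rfl))
    have hs := (kappa 𝒢).src_arr (GArr.mk (C := lCat 𝒢) m n)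
    have ht := (kappa 𝒢).tgt_arr (GArr.mk (C := lCat 𝒢) m n)
    refine (mk_eq_spanArr (f := (kappa 𝒢).arr (GArr.mk (C := lCat 𝒢) m n))
      (hs.trans_le (le_maxObj H _)) (ht.trans_le (le_maxObj H _)) m' n' hs.symm ?_).trans
      (spanArr_congr _ _ _ _ (congrArg (maxObj H) hs.symm) (congrArg (maxObj H) ht.symm))
    exact (OrderedGroupoid.comp_inv_comp_cancel ((src_lArr m).trans (src_lArr n).symm)).symm
  app_mono X Y h := by
    induction X using GObj.ind
    induction Y using GObj.ind
    exact kappaSigma_aux H _ _ h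

/-- A horizontal transformation is an invertible `Λ`-transformation. -/
def lambdaIso {𝒢 ℋ : OrderedGroupoid.{u}} (α : HorTrans 𝒢 ℋ) : α.dom ≅ α.cod where
  hom := Lambda.mk α rfl le_rfl
  inv := Lambda.mk α.inv rfl le_rfl
  hom_inv_id := (lIso (𝒢 := dblCat 𝒢 ℋ) α rfl rfl).hom_inv_id
  inv_hom_id := (lIso (𝒢 := dblCat 𝒢 ℋ) α rfl rfl).inv_hom_id

theorem isESiteMorphism_sigma (E : ESiteMax.{u}) :
    IsESiteMorphism E.toESite (gSite (lSite E.toESite)).toESite (sigma E.hasMaximalObjects) :=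
  isESiteMorphism_of_comp_kappa E.toESite _ (sigma_comp_kappa E.hasMaximalObjects)

end Sigma

/-! ### The 2-adjunction -/

section TwoNaturality

theorem eta_naturality₂ {C D : LcCat.{u}} {F F' : C.carrier ⥤ D.carrier} (θ : F ⟶ F') :
    Functor.whiskerRight θ (eta D) ≫ eqToHom (eta_naturality F') =
      eqToHom (eta_naturality F) ≫ Functor.whiskerLeft (eta C) (lNatTrans (gLambda θ)) := by
  refine NatTrans.ext (funext fun A => lHom_ext ?_)
  rw [NatTrans.comp_app, NatTrans.comp_app, eqToHom_app, eqToHom_app]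
  refine (lArr_comp_eqToHom _ _).trans (Eq.trans ?_ (lArr_eqToHom_comp _ _).symm)
  change GArr.mk (𝟙 (F.obj A)) (θ.app A) = GArr.mk (F.map (𝟙 A)) (θ.app A ≫ F'.map (𝟙 A))
  rw [F.map_id, F'.map_id, Category.comp_id]

theorem kappa_naturality {𝒢 ℋ : OrderedGroupoid.{u}} (M : OrdFunctor 𝒢 ℋ) :
    (gFunctor (C := lCat 𝒢) (D := lCat ℋ) (lFunctor M)).comp (kappa ℋ) = (kappa 𝒢).comp M := by
  refine OrdFunctor.ext (funext fun X => ?_) (funext fun f => ?_)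
  · induction X using GObj.ind
    exact M.tgt_arr _
  · induction f using GArr.ind with
    | h m n =>
    exact Eq.symm ((M.arr_comp _ _ _).trans (ℋ.comp_congr (M.arr_inv _) rfl _))

theorem kappa_naturality₂ {𝒢 ℋ : OrderedGroupoid.{u}} {M M' : OrdFunctor 𝒢 ℋ} (β : M ⟶ M') :
    Lambda.whiskerRight (gLambda (C := lCat 𝒢) (D := lCat ℋ) (lNatTrans β)) (kappa ℋ) ≫
        eqToHom (kappa_naturality M') =
      eqToHom (kappa_naturality M) ≫ Lambda.whiskerLeft (kappa 𝒢) β := by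
  refine Lambda.ext fun X => LHom.ext ?_
  have h1 := Lambda.eqToHom_comp_app_arr rfl
    (Lambda.whiskerRight (gLambda (C := lCat 𝒢) (D := lCat ℋ) (lNatTrans β)) (kappa ℋ))
    (kappa_naturality M') X
  have h2 := Lambda.eqToHom_comp_app_arr (kappa_naturality M)
    (Lambda.whiskerLeft (kappa 𝒢) β) rfl X
  rw [eqToHom_refl, Category.id_comp] at h1
  rw [eqToHom_refl, Category.comp_id] at h2
  refine h1.trans (Eq.trans ?_ h2.symm)
  induction X using GObj.ind with
  | @h A B m =>
  let m' : LHom 𝒢 A.obj (𝒢.tgt (lArr m)) := LHom.corestrict m le_rfl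
  have h := congrArg LHom.arr (Lambda.naturality β m')
  have hs : ℋ.tgt (M.arr (lArr m)) = ℋ.src (Lambda.app β (𝒢.tgt (lArr m))).arr := by
    rw [M.tgt_arr, LHom.src_eq]
  have h' : ((m'.map M).comp (Lambda.app β _)).arr =
      ℋ.comp (M.arr (lArr m)) (Lambda.app β (𝒢.tgt (lArr m))).arr hs :=
    ℋ.comp_congr rfl (OrderedGroupoid.restrict_eq _ hs.symm le_rfl) _
  change ℋ.comp (ℋ.inv (M.arr (lArr m))) ((Lambda.app β A.obj).comp (m'.map M')).arr _ = _
  exact (ℋ.comp_congr rfl (h.symm.trans h') _).trans (OrderedGroupoid.inv_comp_cancel hs)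

end TwoNaturality

section Sites

theorem isESiteMorphism_map {S S' : LcGSite.{u}} (F : S.cat ⟶ S'.cat)
    (h : IsGSiteMorphism S S' F) :
    IsESiteMorphism (gSite S).toESite (gSite S').toESite (G.map F) :=
  isESiteMorphism_gFunctor h

theorem isGSiteMorphism_map {E E' : ESiteMax.{u}} (M : E.gpd ⟶ E'.gpd)
    (h : IsESiteMorphism E.toESite E'.toESite M) :
    IsGSiteMorphism (lSite E.toESite) (lSite E'.toESite) (L.map M) :=
  IsESiteMorphism.lFunctor h

/-- The unit of the 2-adjunction. -/
noncomputable def siteUnit : TwoNatTrans (StrictPseudofunctor.id LcGSite.{u})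
    ((gSiteFunctor isESiteMorphism_map).comp (lSiteFunctor isGSiteMorphism_map)) where
  app S := (⟨eta S.cat, isGSiteMorphism_eta S⟩ :
    gSiteCells.Hom S (lSite (gSite S).toESite))
  naturality F := OneCells.Hom.ext (eta_naturality F.val)
  naturality₂ {S S' F F'} θ := OneCells.hom₂_ext (by
    rw [OneCells.comp_val, OneCells.comp_val, OneCells.eqToHom_val, OneCells.eqToHom_val]
    exact eta_naturality₂ θ.val)

/-- The counit of the 2-adjunction. -/
noncomputable def siteCounit : TwoNatTrans
    ((lSiteFunctor isGSiteMorphism_map).comp (gSiteFunctor isESiteMorphism_map))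
    (StrictPseudofunctor.id ESiteMax.{u}) where
  app E := (⟨kappa E.gpd, isESiteMorphism_kappa E.toESite⟩ :
    eSiteCells.Hom (gSite (lSite E.toESite)) E)
  naturality M := OneCells.Hom.ext (kappa_naturality M.val)
  naturality₂ {E E' M M'} β := OneCells.hom₂_ext (by
    rw [OneCells.comp_val, OneCells.comp_val, OneCells.eqToHom_val, OneCells.eqToHom_val]
    exact kappa_naturality₂ β.val)

/-- The 2-adjunction between left-cancellative Grothendieck sites and Ehresmann sites with maximal
objects. -/
noncomputable def siteAdjunction : TwoAdjunction (gSiteFunctor.{u} isESiteMorphism_map)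
    (lSiteFunctor isGSiteMorphism_map) where
  unit := siteUnit
  counit := siteCounit
  left_triangle S := OneCells.Hom.ext (gFunctor_eta_comp_kappa S.cat)
  right_triangle E := OneCells.Hom.ext (eta_comp_lFunctor_kappa E.gpd)

theorem siteAdjunction_isBiequivalence : siteAdjunction.{u}.IsBiequivalence := by
  refine ⟨fun S => ?_, fun E => ?_⟩
  · let e := (eta S.cat).asEquivalence
    exact ⟨(⟨e.inverse, isGSiteMorphism_eta_inv S⟩ : gSiteCells.Hom (lSite (gSite S).toESite) S),
      ⟨OneCells.isoMk e.unitIso.symm⟩, ⟨OneCells.isoMk e.counitIso⟩⟩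
  · exact ⟨(⟨sigma E.hasMaximalObjects, isESiteMorphism_sigma E⟩ :
        eSiteCells.Hom E (gSite (lSite E.toESite))),
      ⟨OneCells.isoMk (lambdaIso (kappaSigma E.hasMaximalObjects)).symm⟩,
      ⟨OneCells.isoMk (eqToIso (sigma_comp_kappa E.hasMaximalObjects))⟩⟩

end Sites

end

end EhresmannSite

theorem mainTheorem7 :
    ∃ (hG : ∀ {S S' : EhresmannSite.LcGSite.{u}} (F : S.cat ⟶ S'.cat),
        EhresmannSite.IsGSiteMorphism S S' F →
          EhresmannSite.IsESiteMorphism (EhresmannSite.gSite S).toESite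
            (EhresmannSite.gSite S').toESite (EhresmannSite.G.map F))
      (hL : ∀ {E E' : EhresmannSite.ESiteMax.{u}} (M : E.gpd ⟶ E'.gpd),
        EhresmannSite.IsESiteMorphism E.toESite E'.toESite M →
          EhresmannSite.IsGSiteMorphism (EhresmannSite.lSite E.toESite)
            (EhresmannSite.lSite E'.toESite) (EhresmannSite.L.map M))
      (A : EhresmannSite.TwoAdjunction (EhresmannSite.gSiteFunctor hG)
        (EhresmannSite.lSiteFunctor hL)),
      (∀ S : EhresmannSite.LcGSite.{u}, (A.unit.app S).val = EhresmannSite.eta S.cat) ∧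
        (∀ E : EhresmannSite.ESiteMax.{u}, (A.counit.app E).val = EhresmannSite.kappa E.gpd) ∧
          A.IsBiequivalence :=
  ⟨EhresmannSite.isESiteMorphism_map, EhresmannSite.isGSiteMorphism_map,
    EhresmannSite.siteAdjunction, fun _ => rfl, fun _ => rfl,
    EhresmannSite.siteAdjunction_isBiequivalence⟩
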